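/- **Setting.** Let $\mathcal F$ be the class of continuous log-concave probability densities on $\mathbb R$. For $f_0\in\mathcal F$ let $\psi_0$ be its score function, i.e. the (right) derivative of $\log f_0$ on $\{f_0>0\}$, with $\psi_0=\infty$ to the left and $\psi_0=-\infty$ to the right of $\{f_0>0\}$, and let $i(f_0)=\int\psi_0^2f_0$. For $\beta\in[1,2]$ and $L,r>0$ let $$\mathcal F_{\beta,L}=\{f_0\in\mathcal F:\ |\psi_0(x)-\psi_0(y)|\le L|x-y|^{\beta-1}\ \text{for all }x,y\in\mathbb R\},\qquad \mathcal F_{\beta,L,r}=\{f_0\in\mathcal F_{\beta,L}:\ i(f_0)\le r\}.$$ For an estimator $\hat\psi(\cdot)=\hat\psi(\cdot;X_1,\dots,X_n)$ based on $X_1,\dots,X_n\overset{\rm iid}{\sim}f_0$ put $\mathcal L(\hat\psi,\psi_0)=\int(\hat\psi-\psi_0)^2f_0$ and $$Q_{f_0}(1-\delta,\hat\psi)=\inf\{s\in[0,\infty):\ \mathbb P_{f_0}(\mathcal L(\hat\psi,\psi_0)\le s)\ge 1-\delta\},\qquad \mathcal M_n(\delta,\mathcal G)=\inf_{\hat\psi}\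 \sup_{f_0\in\mathcal G}Q_{f_0}(1-\delta,\hat\psi),$$ the infimum being over all jointly measurable $\hat\psi:\mathbb R\times\mathbb R^n\to\mathbb R$. Let $\log_+(x)=\max\{1,\log x\}$ and $\varepsilon_{n,\delta}=n^{-1}\log(n^2/\delta)$. **The multiscale estimator.** Let $K(x)=(1-|x|)_+$, $\mathrm{sgn}(x)=1$ for $x\ge0$ and $-1$ for $x<0$, $K'(x)=-\mathrm{sgn}(x)\mathbb 1_{\{|x|<1\}}$, $\hat f_h(z)=\frac1n\sum_i\frac1hK(\frac{z-X_i}h)$, $\hat f_h'(z)=\frac1n\sum_i\frac1{h^2}K'(\frac{z-X_i}h)$, let $\mathbb P_n$ be the empirical distribution, $\epsilon=\frac29\varepsilon_{n,\delta}$ and $\hat\tau=\mathrm{sgn}(\hat f_h'(z))$. For $z\in\mathbb R$, $h>0$, $\omega\in\{-1,1\}$ set $$V=3\sqrt{\epsilon\,\mathbb P_n([z-h,z+h])+\epsilon^2}+\tfrac{1+4\epsilon}{n},\quad M^{(\omega)}=(1-2\epsilon)h^2|\hat f_h'(z)|+2\omega V,\quad D^{(\omega)}=h\bigl\{(1-2\epsilon)h\hat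 f_h(z)+\omega V+(3-\tfrac4n)\epsilon-\tfrac1n\bigr\},$$ and let $\hat\psi^{(\omega)}_h(z)$ be $\hat\tau M^{(\omega\hat\tau)}/D^{(-\omega\hat\tau)}$ if $D^{(-1)}>0$ and $M^{(-1)}>0$; $\hat\tau M^{(\omega\hat\tau)}/D^{(-1)}$ if $D^{(-1)}>0$ and $M^{(-1)}\le0$; and $\omega\cdot\infty$ otherwise. Let $\hat u(x)=\inf\{\hat\psi_h^{(1)}(z):0<h\le x-z\}$ and $\hat l(x)=\sup\{\hat\psi_h^{(-1)}(z):0<h\le z-x\}$, and let $\hat\psi_{n,\delta}(x)\in[-\infty,\infty]$ be $\hat l(x)$ if $\hat l(x)>0$, $\hat u(x)$ if otherwise $\hat u(x)<0$, and $0$ otherwise. It does not depend on $\beta,L,r$. **Theorem.** For every $\beta\in[1,2]$ there is a constant $C_\beta\in(0,\infty)$ such that for all $n\ge3$, $\delta\in(0,1)$ and $L,r>0$, with $r'=\min\{r,L^{2/\beta}\}$, $$\mathcal M_n(\delta,\mathcal F_{\beta,L,r})\le C_\beta\, r'\min\Bigl\{\Bigl(\tfrac{L^{2/\beta}}{r'}\varepsilon_{n,\delta}\Bigr)^{\frac{\beta}{2\beta+1}}\log_+^{\frac{\beta-1}{2\beta+1}}\Bigl(\tfrac{L^{2/\beta}}{r'}\Bigr)+\tfrac{L^{2/\beta}}{r'}\varepsilon_{n,\delta}\log_+^{3-\frac2\beta}\Bigl(\tfrac1{\varepsilon_{n,\delta}}\Bigr),\,1\Bigr\}$$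 and $$\mathcal M_n(\delta,\mathcal F_{\beta,L})\le C_\beta\, L^{2/\beta}\min\{\varepsilon_{n,\delta},1\}^{\frac{\beta}{2\beta+1}}.$$ Both bounds are attained by $\hat\psi_{n,\delta}$: it is jointly measurable, and $\sup_{f_0\in\mathcal F_{\beta,L,r}}Q_{f_0}(1-\delta,\hat\psi_{n,\delta})$ and $\sup_{f_0\in\mathcal F_{\beta,L}}Q_{f_0}(1-\delta,\hat\psi_{n,\delta})$ obey the same respective bounds. -/

import Mathlib

open MeasureTheory

noncomputable section

namespace ScoreEstimation

/-! ## Log-concave densities, scores, Fisher information, loss -/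

/-- The continuous, log-concave probability densities on `ℝ`. -/
structure IsLogConcaveDensity (f : ℝ → ℝ) : Prop where
  continuous : Continuous f
  nonneg : ∀ x, 0 ≤ f x
  lintegral_eq_one : ∫⁻ x, ENNReal.ofReal (f x) = 1
  logConcave : ∀ x y a b : ℝ, 0 ≤ a → 0 ≤ b → a + b = 1 →
    f x ^ a * f y ^ b ≤ f (a * x + b * y)

/-- The score function of a log-concave density `f`: the right derivative of `log f` on
`{f > 0}`, with value `∞` to the left and `-∞` to the right of `{f > 0}`. -/
def score (f : ℝ → ℝ) (x : ℝ) : EReal :=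
  open scoped Classical in
  if 0 < f x then ((derivWithin (fun y => Real.log (f y)) (Set.Ioi x) x : ℝ) : EReal)
  else if ∀ y, 0 < f y → x ≤ y then ⊤ else ⊥

/-- The weighted squared `L²` distance `∫ (ψ - ψ₀)² f`, as an extended nonnegative number
(with the convention `∞ · 0 = 0`). -/
def loss (f : ℝ → ℝ) (ψ ψ₀ : ℝ → EReal) : ENNReal :=
  ∫⁻ x, (ψ x - ψ₀ x).abs ^ 2 * ENNReal.ofReal (f x)

/-- The Fisher information for location `∫ ψ₀² f`, where `ψ₀` is the score of `f`. -/
def fisherInformation (f : ℝ → ℝ) : ENNReal :=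
  ∫⁻ x, (score f x).abs ^ 2 * ENNReal.ofReal (f x)

/-- The log-concave densities whose score is `(β - 1, L)`-Hölder on `ℝ`. -/
def holderClass (β L : ℝ) : Set (ℝ → ℝ) :=
  {f | IsLogConcaveDensity f ∧
    ∀ x y, (score f x - score f y).abs ≤ ENNReal.ofReal (L * |x - y| ^ (β - 1))}

/-- The densities in `holderClass β L` with Fisher information at most `r`. -/
def holderFisherClass (β L r : ℝ) : Set (ℝ → ℝ) :=
  {f ∈ holderClass β L | fisherInformation f ≤ ENNReal.ofReal r}

/-! ## Minimax quantiles -/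

/-- The joint law of `n` independent observations with density `f`. -/
def sampleLaw (n : ℕ) (f : ℝ → ℝ) : Measure (Fin n → ℝ) :=
  Measure.pi fun _ => (volume : Measure ℝ).withDensity fun x => ENNReal.ofReal (f x)

/-- The `(1 - δ)`th quantile of the loss of `ψ` under sampling from `f`;
here `ψ x X` is the estimate at the point `x` based on the sample `X`. -/
def lossQuantile (n : ℕ) (δ : ℝ) (f : ℝ → ℝ) (ψ : ℝ → (Fin n → ℝ) → EReal) : ENNReal :=
  sInf {s | s ≠ ⊤ ∧
    ENNReal.ofReal (1 - δ) ≤ sampleLaw n f {X | loss f (fun x => ψ x X) (score f) ≤ s}}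

/-- The worst-case `(1 - δ)`th quantile of the loss of `ψ` over the class `G`. -/
def worstQuantile (n : ℕ) (δ : ℝ) (G : Set (ℝ → ℝ)) (ψ : ℝ → (Fin n → ℝ) → EReal) : ENNReal :=
  ⨆ f ∈ G, lossQuantile n δ f ψ

/-- The jointly measurable real-valued estimators `ℝ × ℝⁿ → ℝ`. -/
def estimators (n : ℕ) : Set (ℝ → (Fin n → ℝ) → ℝ) :=
  {ψ | Measurable fun p : ℝ × (Fin n → ℝ) => ψ p.1 p.2}

/-- The minimax `(1 - δ)`th quantile of the loss over the class `G`. -/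
def minimaxQuantile (n : ℕ) (δ : ℝ) (G : Set (ℝ → ℝ)) : ENNReal :=
  ⨅ ψ ∈ estimators n, worstQuantile n δ G fun x X => ((ψ x X : ℝ) : EReal)

/-! ## The multiscale score estimator

Throughout, `n` is the sample size, `δ` the confidence level, `X` the sample, `h` the bandwidth,
`z` or `x` a point of `ℝ`, and `ω ∈ {-1, 1}` selects the lower or the upper confidence limit. -/

/-- The sign function with `sgn 0 = 1`. -/
def sgn (x : ℝ) : ℝ := open scoped Classical in if 0 ≤ x then 1 else -1

/-- The triangular kernel. -/
def kernel (x : ℝ) : ℝ := open scoped Classical in if |x| ≤ 1 then 1 - |x| else 0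

/-- The weak derivative of the triangular kernel. -/
def kernelDeriv (x : ℝ) : ℝ := open scoped Classical in if |x| < 1 then -sgn x else 0

/-- `ε_{n,δ} = log (n² / δ) / n`. -/
def eps (n : ℕ) (δ : ℝ) : ℝ := Real.log ((n : ℝ) ^ 2 / δ) / n

/-- `ϵ_{n,δ} = (2 / 9) ε_{n,δ}`. -/
def epsBand (n : ℕ) (δ : ℝ) : ℝ := 2 * eps n δ / 9

/-- The kernel density estimator with bandwidth `h`. -/
def kde {n : ℕ} (X : Fin n → ℝ) (h z : ℝ) : ℝ :=
  (∑ i, h⁻¹ * kernel ((z - X i) / h)) / n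

/-- The (weak) derivative of the kernel density estimator with bandwidth `h`. -/
def kdeDeriv {n : ℕ} (X : Fin n → ℝ) (h z : ℝ) : ℝ :=
  (∑ i, (h ^ 2)⁻¹ * kernelDeriv ((z - X i) / h)) / n

/-- The empirical distribution of the sample `X`. -/
def empirical {n : ℕ} (X : Fin n → ℝ) (B : Set ℝ) : ℝ :=
  (∑ i, B.indicator (fun _ => (1 : ℝ)) (X i)) / n

/-- The width term `V`. -/
def bandV {n : ℕ} (δ : ℝ) (X : Fin n → ℝ) (h z : ℝ) : ℝ :=
  3 * √(epsBand n δ * empirical X (Set.Icc (z - h) (z + h)) + epsBand n δ ^ 2)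
    + (1 + 4 * epsBand n δ) / n

/-- The numerator term `M^(ω)`. -/
def bandM {n : ℕ} (δ : ℝ) (X : Fin n → ℝ) (h : ℝ) (ω z : ℝ) : ℝ :=
  (1 - 2 * epsBand n δ) * h ^ 2 * |kdeDeriv X h z| + 2 * ω * bandV δ X h z

/-- The denominator term `D^(ω)`. -/
def bandD {n : ℕ} (δ : ℝ) (X : Fin n → ℝ) (h : ℝ) (ω z : ℝ) : ℝ :=
  h * ((1 - 2 * epsBand n δ) * h * kde X h z + ω * bandV δ X h z
    + (3 - 4 / n) * epsBand n δ - 1 / n)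

/-- The lower (`ω = -1`) and upper (`ω = 1`) confidence limits at bandwidth `h`. -/
def bandAt {n : ℕ} (δ : ℝ) (X : Fin n → ℝ) (h : ℝ) (ω z : ℝ) : EReal :=
  open scoped Classical in
  let τ := sgn (kdeDeriv X h z)
  if 0 < bandD δ X h (-1) z ∧ 0 < bandM δ X h (-1) z then
    ((τ * bandM δ X h (ω * τ) z / bandD δ X h (-(ω * τ)) z : ℝ) : EReal)
  else if 0 < bandD δ X h (-1) z ∧ bandM δ X h (-1) z ≤ 0 then
    ((τ * bandM δ X h (ω * τ) z / bandD δ X h (-1) z : ℝ) : EReal)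
  else (ω : EReal) * ⊤

/-- The upper limit of the multiscale confidence band. -/
def upperBand {n : ℕ} (δ : ℝ) (X : Fin n → ℝ) (x : ℝ) : EReal :=
  sInf {u | ∃ z h : ℝ, 0 < h ∧ h ≤ x - z ∧ u = bandAt δ X h 1 z}

/-- The lower limit of the multiscale confidence band. -/
def lowerBand {n : ℕ} (δ : ℝ) (X : Fin n → ℝ) (x : ℝ) : EReal :=
  sSup {u | ∃ z h : ℝ, 0 < h ∧ h ≤ z - x ∧ u = bandAt δ X h (-1) z}

/-- The multiscale estimator: the point of the confidence interval at `x` that is closest to `0`. -/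
def multiscale (n : ℕ) (δ : ℝ) (x : ℝ) (X : Fin n → ℝ) : EReal :=
  open scoped Classical in
  if 0 < lowerBand δ X x then lowerBand δ X x
  else if upperBand δ X x < 0 then upperBand δ X x
  else 0

/-! ## The rate -/

/-- `log₊ x = max 1 (log x)` (for `x > 0`). -/
def logPlus (x : ℝ) : ℝ := max 1 (Real.log x)

/-- The rate over `holderFisherClass β L r`, where `s = min r (L ^ (2 / β))` and `ε = ε_{n,δ}`. -/
def holderRate (β L s ε : ℝ) : ℝ :=
  s * min ((L ^ (2 / β) / s * ε) ^ (β / (2 * β + 1))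
        * logPlus (L ^ (2 / β) / s) ^ ((β - 1) / (2 * β + 1))
      + L ^ (2 / β) / s * ε * logPlus (1 / ε) ^ (3 - 2 / β)) 1

end ScoreEstimation

end

open ScoreEstimation

/-! The argument is deterministic on one event of probability at least `1 - δ`, on which confidence
limits hold for the masses of all intervals at once (`ofReal_le_measure_intervalBounds`). Sliding an
interval so that it starts at an observation, or at `-∞`, leaves finitely many random intervals for
each count `m`. Conditionally on its starting point the count is binomial; Chernoff's method and the
Bernstein-type entropy bound `entropy_gap` give probability at most `(n - m + 1) * exp (-n ε)`,
where `exp (-n ε) = δ / n ^ 2`. The prefactors sum to exactly `n ^ 2`.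

For the triangular kernel, the smoothed derivative and the smoothed density are combinations or
integrals of interval masses, and their ratio is an average of the score over the window. As the
score `ψ` is antitone, windows on either side of `x` bracket `ψ x`, so the band covers the score
(`lowerBand_le`, `le_upperBand`). The estimator is the point of the band closest to zero; its error
is therefore at most `|ψ x|` and has a known sign. To the left of the mode the error is also at most
`ψ x - ψ (x + 2 b) + 40 √(ε / (f x * b ^ 3))` for every admissible bandwidth `b`
(`multiscale_accuracy_left`). The right side follows by reflection.

The loss is integrated without choosing a bandwidth in advance. Given the error `d` at `x`,
`sq_error_le` picks the width `H` at which the stochastic term is `d / 2`. The bias must then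
account for the other half, so `d / 2` is at most the length of the range of score levels crossed on
`[x, x + H]`. Hence `d ^ 2 * f x` is bounded by an integral over levels `t` of a kernel centred at
the right endpoint of `{ψ > t}`. Tonelli's theorem turns the total into the weighted information `∫
ψ ^ 2 f ^ γ` with `γ = (β + 1) / (2 β + 1)` (`lintegral_majorant_le`). Exceptional points cost `ε ∫
ψ ^ 3`, and the far tail costs its own Fisher information.

These integrals rest on the growth bound `score_le`, by which `ψ` is at most of order `L ^ (1/β) *
log (1/f) ^ ((β-1)/β)` after scaling, and on the exact identities `∫ ψ f ^ p = f ^ p / p` and `∫ ψ =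
Δ log f`. Splitting at a density level gives `weighted_fisher_le`, `cube_superlevel_le` and
`fisher_sublevel_le`. The class without an information constraint is the case `r = 72 * L ^ (2/β)`,
since the Hölder condition alone bounds the information. -/

namespace ScoreEstimation

/-! ### Hölder log-concave densities: integral identities and pointwise bounds. -/

open Set Filter Topology

/-- A positive continuous probability density `f` with antitone Hölder score `ψ`, described by
integral identities that are invariant under reflection. -/
structure HolderScore (f ψ : ℝ → ℝ) (β L : ℝ) : Prop where
  continuous : Continuous f
  pos : ∀ x, 0 < f x
  lintegral_eq_one : ∫⁻ x, ENNReal.ofReal (f x) = 1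
  antitone : Antitone ψ
  log_sub : ∀ a b, Real.log (f b) - Real.log (f a) = ∫ x in a..b, ψ x
  rpow_sub : ∀ p a b : ℝ, f b ^ p - f a ^ p = ∫ x in a..b, p * (ψ x * f x ^ p)
  holder : ∀ x y, |ψ x - ψ y| ≤ L * |x - y| ^ (β - 1)

/-- In `EReal`, `⊤ - ⊤ = ⊥` has absolute value `⊤`, so the Hölder condition on the diagonal already
excludes infinite scores. Positivity of the density everywhere is a consequence. -/
theorem score_ne_top_of_mem {f : ℝ → ℝ} {β L : ℝ} (hf : f ∈ holderClass β L) (x : ℝ) :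
    score f x ≠ ⊤ ∧ score f x ≠ ⊥ := by
  have h := hf.2 x x
  constructor
  · intro hx
    rw [hx] at h
    have : ((⊤ : EReal) - ⊤).abs = ⊤ := by
      rw [EReal.sub_top]; rfl
    rw [this] at h
    exact absurd h (by simp)
  · intro hx
    rw [hx] at h
    have : ((⊥ : EReal) - ⊥).abs = ⊤ := by
      rw [EReal.bot_sub]; rfl
    rw [this] at h
    exact absurd h (by simp)

theorem pos_of_mem_holderClass {f : ℝ → ℝ} {β L : ℝ} (hf : f ∈ holderClass β L) (x : ℝ) :
    0 < f x := by
  by_contra h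
  have := score_ne_top_of_mem hf x
  simp only [score, h, if_false] at this
  split_ifs at this <;> simp at this

theorem score_eq_derivWithin {f : ℝ → ℝ} {β L : ℝ} (hf : f ∈ holderClass β L) (x : ℝ) :
    score f x = ((derivWithin (fun y => Real.log (f y)) (Ioi x) x : ℝ) : EReal) := by
  simp only [score, pos_of_mem_holderClass hf x, if_true]

theorem coe_toReal_score {f : ℝ → ℝ} {β L : ℝ} (hf : f ∈ holderClass β L) (x : ℝ) :
    (((score f x).toReal : ℝ) : EReal) = score f x := by
  rw [score_eq_derivWithin hf, EReal.toReal_coe]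

theorem concaveOn_log {f : ℝ → ℝ} (hf : IsLogConcaveDensity f) (hpos : ∀ x, 0 < f x) :
    ConcaveOn ℝ univ fun x => Real.log (f x) := by
  refine ⟨convex_univ, fun x _ y _ a b ha hb hab => ?_⟩
  have h := hf.logConcave x y a b ha hb hab
  have h2 := Real.log_le_log (mul_pos (Real.rpow_pos_of_pos (hpos x) a)
    (Real.rpow_pos_of_pos (hpos y) b)) h
  rw [Real.log_mul (Real.rpow_pos_of_pos (hpos x) a).ne' (Real.rpow_pos_of_pos (hpos y) b).ne',
    Real.log_rpow (hpos x), Real.log_rpow (hpos y)] at h2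
  simpa using h2

/-- Concavity of `log f` provides an antitone right derivative everywhere. The fundamental theorem
of calculus for right derivatives then applies to `log f` and `f ^ p`, since antitone functions are
interval integrable. -/
theorem holderScore_of_mem {f : ℝ → ℝ} {β L : ℝ} (hL : 0 < L) (hf : f ∈ holderClass β L) :
    HolderScore f (fun x => (score f x).toReal) β L := by
  have hpos := pos_of_mem_holderClass hf
  have hconc := concaveOn_log hf.1 hpos
  have hconv := hconc.neg
  have hψ : (fun x => (score f x).toReal) =
      fun x => derivWithin (fun y => Real.log (f y)) (Ioi x) x := by
    funext x
    rw [score_eq_derivWithin hf, EReal.toReal_coe]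
  rw [hψ]
  set ψ : ℝ → ℝ := fun x => derivWithin (fun y => Real.log (f y)) (Ioi x) x with hψdef
  have hder : ∀ x, HasDerivWithinAt (fun y => Real.log (f y)) (ψ x) (Ioi x) x := by
    intro x
    have h1 := hconv.hasDerivWithinAt_rightDeriv_of_mem_interior (x := x) (by simp)
    have h2 := h1.neg
    have h3 : HasDerivWithinAt (fun y => Real.log (f y))
        (-(derivWithin (-fun y => Real.log (f y)) (Ioi x) x)) (Ioi x) x := by
      simpa using h2
    have h4 := h3.derivWithin (uniqueDiffWithinAt_Ioi x)
    simp only [hψdef]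
    rw [h4]
    exact h3
  have hanti : Antitone ψ := by
    have h1 := hconv.monotoneOn_rightDeriv
    intro x y hxy
    have h2 := h1 (by simp) (by simp) hxy
    have e : ∀ z, derivWithin (-fun y => Real.log (f y)) (Ioi z) z = -ψ z := by
      intro z
      exact ((hder z).neg).derivWithin (uniqueDiffWithinAt_Ioi z)
    simp only [e] at h2
    linarith
  have hlogc : Continuous fun y => Real.log (f y) :=
    hf.1.continuous.log fun x => (hpos x).ne'
  refine ⟨hf.1.continuous, hpos, hf.1.lintegral_eq_one, hanti, ?_, ?_, ?_⟩
  · intro a b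
    rw [intervalIntegral.integral_eq_sub_of_hasDeriv_right hlogc.continuousOn
      (fun x _ => hder x) hanti.intervalIntegrable]
  · intro p a b
    have hc : Continuous fun y => f y ^ p :=
      hf.1.continuous.rpow_const fun x => Or.inl (hpos x).ne'
    rw [intervalIntegral.integral_eq_sub_of_hasDeriv_right hc.continuousOn
      (f' := fun x => p * (ψ x * f x ^ p))]
    · intro x _
      have h1 : HasDerivWithinAt (fun y => Real.exp (p * Real.log (f y)))
          (Real.exp (p * Real.log (f x)) * (p * ψ x)) (Ioi x) x :=
        ((hder x).const_mul p).exp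
      have e : ∀ y, Real.exp (p * Real.log (f y)) = f y ^ p := by
        intro y
        rw [Real.rpow_def_of_pos (hpos y), mul_comm]
      simp only [e] at h1
      have e2 : p * (ψ x * f x ^ p) = f x ^ p * (p * ψ x) := by ring
      rw [e2]
      exact h1
    · exact ((hanti.intervalIntegrable).mul_continuousOn hc.continuousOn).const_mul p
  · intro x y
    have h := hf.2 x y
    rw [score_eq_derivWithin hf, score_eq_derivWithin hf, ← EReal.coe_sub, EReal.abs_def] at h
    by_contra hlt
    push Not at hlt
    have hp : 0 < |ψ x - ψ y| :=
      (mul_nonneg hL.le (Real.rpow_nonneg (abs_nonneg (x - y)) (β - 1))).trans_lt hlt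
    exact absurd h (not_le.mpr ((ENNReal.ofReal_lt_ofReal_iff hp).2 hlt))


namespace HolderScore

variable {f ψ : ℝ → ℝ} {β L : ℝ}

/-- This is why the structure records integral identities: reflection would turn right derivatives
into left ones. -/
theorem reflect (h : HolderScore f ψ β L) :
    HolderScore (fun x => f (-x)) (fun x => -ψ (-x)) β L where
  continuous := h.continuous.comp continuous_neg
  pos x := h.pos (-x)
  lintegral_eq_one := by
    rw [← h.lintegral_eq_one]
    exact (Measure.measurePreserving_neg (volume : Measure ℝ)).lintegral_comp
      h.continuous.measurable.ennreal_ofReal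
  antitone x y hxy := by
    have := h.antitone (neg_le_neg hxy)
    simpa using this
  log_sub a b := by
    rw [h.log_sub, intervalIntegral.integral_neg, intervalIntegral.integral_comp_neg,
      intervalIntegral.integral_symm]
  rpow_sub p a b := by
    have e : (fun x => p * (-ψ (-x) * f (-x) ^ p)) = fun x => -(fun y => p * (ψ y * f y ^ p)) (-x) := by
      funext x; ring
    rw [h.rpow_sub, e, intervalIntegral.integral_neg, intervalIntegral.integral_comp_neg (fun y => p * (ψ y * f y ^ p)),
      intervalIntegral.integral_symm]
  holder x y := by
    have := h.holder (-y) (-x)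
    have e : -y - -x = x - y := by ring
    have e2 : -ψ (-x) - -ψ (-y) = ψ (-y) - ψ (-x) := by ring
    rw [e] at this
    rw [e2]
    exact this

theorem intervalIntegrable (h : HolderScore f ψ β L) (a b : ℝ) :
    IntervalIntegrable ψ volume a b := h.antitone.intervalIntegrable

theorem sub_eq (h : HolderScore f ψ β L) (a b : ℝ) : f b - f a = ∫ x in a..b, ψ x * f x := by
  simpa using h.rpow_sub 1 a b

theorem log_le (h : HolderScore f ψ β L) (x y : ℝ) :
    Real.log (f y) ≤ Real.log (f x) + ψ x * (y - x) := by
  have e := h.log_sub x y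
  rcases le_total x y with hxy | hxy
  · have : ∫ t in x..y, ψ t ≤ ∫ _ in x..y, ψ x :=
      intervalIntegral.integral_mono_on hxy (h.intervalIntegrable _ _) (by simp)
        fun t ht => h.antitone ht.1
    simp only [intervalIntegral.integral_const, smul_eq_mul] at this
    linarith
  · have : ∫ _ in y..x, ψ x ≤ ∫ t in y..x, ψ t :=
      intervalIntegral.integral_mono_on hxy (by simp) (h.intervalIntegrable _ _)
        fun t ht => h.antitone ht.2
    simp only [intervalIntegral.integral_const, smul_eq_mul] at this
    rw [intervalIntegral.integral_symm] at e
    linarith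

theorem le_exp (h : HolderScore f ψ β L) (x y : ℝ) : f y ≤ f x * Real.exp (ψ x * (y - x)) := by
  have := Real.exp_le_exp.2 (h.log_le x y)
  rwa [Real.exp_add, Real.exp_log (h.pos y), Real.exp_log (h.pos x)] at this

theorem setLIntegral_Icc_le (h : HolderScore f ψ β L) (a b : ℝ) :
    ∫⁻ x in Icc a b, ENNReal.ofReal (f x) ≤ 1 := by
  rw [← h.lintegral_eq_one]
  exact setLIntegral_le_lintegral _ _

/-- A nonnegative score cannot fall below `-L * w ^ (β - 1)` within distance `w`. With `L * w ^ β =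
1` the density loses at most a factor `e` on `[x, x + w]`, and that window has mass at most one. -/
theorem le_sup_of_nonneg (h : HolderScore f ψ β L) (hβ : 1 ≤ β) (hL : 0 < L) {x : ℝ}
    (hx : 0 ≤ ψ x) : f x ≤ Real.exp 1 * L ^ (1 / β) := by
  have hβ0 : 0 < β := by linarith
  set w := L ^ (-(1 / β)) with hw
  have hw0 : 0 < w := Real.rpow_pos_of_pos hL _
  have hwβ : L * w ^ β = 1 := by
    rw [hw, ← Real.rpow_mul hL.le, neg_mul, one_div, inv_mul_cancel₀ hβ0.ne', Real.rpow_neg_one,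
      mul_inv_cancel₀ hL.ne']
  have hle : ∀ v ∈ Icc x (x + w), f x * Real.exp (-1) ≤ f v := by
    intro v hv
    have h1 := h.log_le v x
    have h2 := (abs_le.1 (h.holder v x)).1
    have hvx : 0 ≤ v - x := by linarith [hv.1]
    rw [abs_of_nonneg hvx] at h2
    have h3 : L * (v - x) ^ (β - 1) * (v - x) ≤ 1 := by
      rcases hvx.eq_or_lt with h0 | h0
      · rw [← h0]; simp
      · rw [mul_assoc, ← Real.rpow_add_one h0.ne', sub_add_cancel, ← hwβ]
        exact mul_le_mul_of_nonneg_left (Real.rpow_le_rpow hvx (by linarith [hv.2]) hβ0.le) hL.le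
    have h4 : ψ v * (x - v) ≤ 1 := by nlinarith
    rw [← Real.exp_log (h.pos x), ← Real.exp_log (h.pos v), ← Real.exp_add]
    exact Real.exp_le_exp.2 (by linarith)
  have h1 := h.setLIntegral_Icc_le x (x + w)
  have h2 : ∫⁻ _ in Icc x (x + w), ENNReal.ofReal (f x * Real.exp (-1)) ≤
      ∫⁻ v in Icc x (x + w), ENNReal.ofReal (f v) :=
    setLIntegral_mono' measurableSet_Icc fun v hv => ENNReal.ofReal_le_ofReal (hle v hv)
  rw [setLIntegral_const, Real.volume_Icc, add_sub_cancel_left,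
    ← ENNReal.ofReal_mul (mul_nonneg (h.pos x).le (Real.exp_pos _).le)] at h2
  have h3 : f x * Real.exp (-1) * w ≤ 1 := by
    have := h2.trans h1
    rwa [← ENNReal.ofReal_one, ENNReal.ofReal_le_ofReal_iff zero_le_one] at this
  have h4 : w * L ^ (1 / β) = 1 := by
    rw [hw, ← Real.rpow_add hL]; simp
  have h5 : Real.exp (-1) * Real.exp 1 = 1 := by rw [← Real.exp_add]; simp
  calc f x = f x * Real.exp (-1) * w * (Real.exp 1 * L ^ (1 / β)) := by
        linear_combination (-f x) * h4 - f x * w * L ^ (1 / β) * h5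
    _ ≤ 1 * (Real.exp 1 * L ^ (1 / β)) :=
        mul_le_mul_of_nonneg_right h3 (by positivity)
    _ = _ := one_mul _

theorem le_sup (h : HolderScore f ψ β L) (hβ : 1 ≤ β) (hL : 0 < L) (x : ℝ) :
    f x ≤ Real.exp 1 * L ^ (1 / β) := by
  rcases le_total 0 (ψ x) with hx | hx
  · exact h.le_sup_of_nonneg hβ hL hx
  · have := h.reflect.le_sup_of_nonneg hβ hL (x := -x) (by simpa using hx)
    simpa using this

/-- The logarithmic height `log (e² L^(1/β) / f x)`, which is at least one. -/
noncomputable def logHeight (f : ℝ → ℝ) (β L x : ℝ) : ℝ :=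
  2 + 1 / β * Real.log L - Real.log (f x)

theorem log_f_le (h : HolderScore f ψ β L) (hβ : 1 ≤ β) (hL : 0 < L) (x : ℝ) :
    Real.log (f x) ≤ 1 + 1 / β * Real.log L := by
  have := Real.log_le_log (h.pos x) (h.le_sup hβ hL x)
  rwa [Real.log_mul (Real.exp_pos _).ne' (Real.rpow_pos_of_pos hL _).ne', Real.log_exp,
    Real.log_rpow hL] at this

theorem one_le_logHeight (h : HolderScore f ψ β L) (hβ : 1 ≤ β) (hL : 0 < L) (x : ℝ) :
    1 ≤ logHeight f β L x := by
  have := h.log_f_le hβ hL x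
  unfold logHeight
  linarith

/-- Concavity at `x + v`, with the bound on `sup f`, gives `ψ (x + v) * v ≤ ℓ`, and the Hölder
condition moves from `x + v` back to `x` at cost `L * v ^ (β - 1)`. The choice `v = (ℓ / L) ^ (1 /
β)` makes the two terms equal. -/
theorem score_le (h : HolderScore f ψ β L) (hβ : 1 ≤ β) (hL : 0 < L) (x : ℝ) :
    ψ x ≤ 2 * L ^ (1 / β) * logHeight f β L x ^ ((β - 1) / β) := by
  have hβ0 : 0 < β := by linarith
  have hℓ := h.one_le_logHeight hβ hL x
  set ℓ := logHeight f β L x with hℓdef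
  have hℓ0 : 0 < ℓ := by linarith
  set v := (ℓ / L) ^ (1 / β) with hv
  have hv0 : 0 < v := Real.rpow_pos_of_pos (by positivity) _
  have h1 := h.log_le (x + v) x
  have h2 := (abs_le.1 (h.holder x (x + v))).2
  have h3 := h.log_f_le hβ hL (x + v)
  have e : |x - (x + v)| = v := by rw [sub_add_cancel_left, abs_neg, abs_of_pos hv0]
  rw [e] at h2
  have h4 : ψ (x + v) * v ≤ ℓ := by
    simp only [hℓdef, logHeight]; nlinarith
  have e1 : ℓ / v = L ^ (1 / β) * ℓ ^ ((β - 1) / β) := by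
    rw [hv, Real.div_rpow hℓ0.le hL.le, div_div_eq_mul_div]
    rw [show (β - 1) / β = 1 - 1 / β by field_simp, Real.rpow_sub hℓ0, Real.rpow_one]
    field_simp
  have e2 : L * v ^ (β - 1) = L ^ (1 / β) * ℓ ^ ((β - 1) / β) := by
    rw [hv, ← Real.rpow_mul (by positivity), Real.div_rpow hℓ0.le hL.le]
    rw [show 1 / β * (β - 1) = (β - 1) / β by ring]
    have : L = L ^ (1 / β) * L ^ ((β - 1) / β) := by
      rw [← Real.rpow_add hL]
      rw [show 1 / β + (β - 1) / β = 1 by field_simp; ring, Real.rpow_one]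
    have hp : 0 < L ^ ((β - 1) / β) := Real.rpow_pos_of_pos hL _
    calc L * (ℓ ^ ((β - 1) / β) / L ^ ((β - 1) / β)) =
        L ^ (1 / β) * L ^ ((β - 1) / β) * (ℓ ^ ((β - 1) / β) / L ^ ((β - 1) / β)) := by
          rw [← this]
      _ = _ := by field_simp
  have h5 : ψ (x + v) ≤ ℓ / v := by rwa [le_div_iff₀ hv0]
  linarith

end HolderScore

end ScoreEstimation

/-! ### Integrals of the score over density levels to the left of the mode. -/

namespace ScoreEstimation

open Set Filter Topology

theorem setLIntegral_Ioo_eq {g : ℝ → ℝ} {a b : ℝ} (hab : a ≤ b)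
    (hg : IntervalIntegrable g volume a b) (h0 : ∀ x ∈ Ioo a b, 0 ≤ g x) :
    ∫⁻ x in Ioo a b, ENNReal.ofReal (g x) = ENNReal.ofReal (∫ x in a..b, g x) := by
  rw [intervalIntegral.integral_of_le hab, integral_Ioc_eq_integral_Ioo,
    ofReal_integral_eq_lintegral_ofReal]
  · exact ((intervalIntegrable_iff_integrableOn_Ioc_of_le hab).1 hg).mono_set Ioo_subset_Ioc_self
  · exact (ae_restrict_iff' measurableSet_Ioo).2 (Eventually.of_forall h0)

theorem le_of_tendsto_setLIntegral_Ioo {g : ℝ → ENNReal} {s : ℝ} {F : ℕ → ENNReal} {c : ENNReal}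
    (hF : ∀ n : ℕ, ∫⁻ x in Ioo (s - n) s, g x = F n) (hc : Tendsto F atTop (𝓝 c)) :
    ∫⁻ x in Iio s, g x = c := by
  have hU : Iio s = ⋃ n : ℕ, Ioo (s - n) s := by
    ext x
    simp only [mem_Iio, mem_iUnion, mem_Ioo]
    refine ⟨fun h => ?_, fun ⟨_, h⟩ => h.2⟩
    obtain ⟨n, hn⟩ := exists_nat_gt (s - x)
    exact ⟨n, by linarith, h⟩
  have hmono : Monotone fun n : ℕ => Ioo (s - n) s := by
    intro m n hmn
    exact Ioo_subset_Ioo_left (by have : (m : ℝ) ≤ n := by exact_mod_cast hmn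
                                  linarith)
  have h1 := setLIntegral_iUnion_of_directed (μ := volume) g hmono.directed_le
  rw [hU, h1]
  simp only [hF]
  refine tendsto_nhds_unique (tendsto_atTop_iSup ?_) hc
  intro m n hmn
  rw [← hF, ← hF]
  exact lintegral_mono_set (hmono hmn)

namespace HolderScore

variable {f ψ : ℝ → ℝ} {β L : ℝ}

theorem le_of_le (h : HolderScore f ψ β L) {x y : ℝ} (hxy : x ≤ y) (hy : 0 ≤ ψ y) : f x ≤ f y := by
  have := h.log_le y x
  exact (Real.log_le_log_iff (h.pos x) (h.pos y)).1 (by nlinarith)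

/-- Otherwise `f` would be nondecreasing, with infinite mass on a half line. -/
theorem exists_nonpos (h : HolderScore f ψ β L) : ∃ x, ψ x ≤ 0 := by
  by_contra! hc
  have h0 := h.pos 0
  have h1 : ∫⁻ _ in Ici (0 : ℝ), ENNReal.ofReal (f 0) ≤ ∫⁻ x in Ici (0 : ℝ), ENNReal.ofReal (f x) :=
    setLIntegral_mono' measurableSet_Ici fun x hx =>
      ENNReal.ofReal_le_ofReal (h.le_of_le hx (hc x).le)
  have h2 := h1.trans (setLIntegral_le_lintegral _ _)
  rw [h.lintegral_eq_one, setLIntegral_const, Real.volume_Ici,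
    ENNReal.mul_top (by simpa using h0)] at h2
  simp at h2

theorem bddAbove_pos (h : HolderScore f ψ β L) : BddAbove {x | 0 < ψ x} := by
  obtain ⟨x, hx⟩ := h.exists_nonpos
  exact ⟨x, fun y hy => le_of_not_gt fun hxy => absurd (h.antitone hxy.le) (by
    simp only [mem_ofPred_eq] at hy; linarith)⟩

theorem tendsto_atBot (h : HolderScore f ψ β L) {x : ℝ} (hx : 0 < ψ x) :
    Tendsto f atBot (𝓝 0) := by
  have h1 : Tendsto (fun y => f x * Real.exp (ψ x * (y - x))) atBot (𝓝 0) := by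
    rw [← mul_zero (f x)]
    refine Tendsto.const_mul _ (Real.tendsto_exp_atBot.comp ?_)
    exact (tendsto_atBot_add_const_right _ (-x) tendsto_id).const_mul_atBot hx
  exact tendsto_of_tendsto_of_tendsto_of_le_of_le tendsto_const_nhds h1 (fun y => (h.pos y).le)
    (h.le_exp x)

theorem continuous_rpow (h : HolderScore f ψ β L) (p : ℝ) : Continuous fun y => f y ^ p :=
  h.continuous.rpow_const fun x => Or.inl (h.pos x).ne'

theorem measurable (h : HolderScore f ψ β L) : Measurable ψ := h.antitone.measurable

/-- The integrand is the derivative of `f ^ p / p`, and `f` tends to zero at `-∞` because the score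
is positive there. -/
theorem setLIntegral_Iio_score (h : HolderScore f ψ β L) {s p : ℝ} (hp : 0 < p)
    (hs : ∀ x < s, 0 < ψ x) :
    ∫⁻ x in Iio s, ENNReal.ofReal (ψ x * f x ^ p) = ENNReal.ofReal (f s ^ p / p) := by
  refine le_of_tendsto_setLIntegral_Ioo
    (F := fun n : ℕ => ENNReal.ofReal ((f s ^ p - f (s - n) ^ p) / p)) (fun n => ?_) ?_
  · rw [setLIntegral_Ioo_eq (by simp)]
    · rw [h.rpow_sub, intervalIntegral.integral_const_mul, mul_div_cancel_left₀ _ hp.ne']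
    · exact (h.intervalIntegrable _ _).mul_continuousOn (h.continuous_rpow p).continuousOn
    · exact fun x hx => mul_nonneg (hs x hx.2).le (Real.rpow_nonneg (h.pos x).le p)
  · have h1 : Tendsto (fun n : ℕ => s - (n : ℝ)) atTop atBot :=
      tendsto_atBot_add_const_left _ s (tendsto_neg_atTop_atBot.comp tendsto_natCast_atTop_atTop)
    have h2 := (h.tendsto_atBot (hs (s - 1) (by linarith))).comp h1
    have h3 : Tendsto (fun n : ℕ => f (s - n) ^ p) atTop (𝓝 0) := by
      have := h2.rpow_const (p := p) (Or.inr hp.le)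
      rwa [Real.zero_rpow hp.ne'] at this
    have h4 := ENNReal.tendsto_ofReal ((h3.const_sub (f s ^ p)).div_const p)
    simpa using h4

/-- Where `ψ` is positive `f` increases, so the set is a left half line whose endpoint, by
continuity, has density at most `u`. -/
theorem setLIntegral_sublevel_le (h : HolderScore f ψ β L) {u p : ℝ} (hp : 0 < p) :
    ∫⁻ x in {x | 0 < ψ x ∧ f x < u}, ENNReal.ofReal (ψ x * f x ^ p) ≤
      ENNReal.ofReal (u ^ p / p) := by
  set S := {x | 0 < ψ x ∧ f x < u} with hS
  rcases S.eq_empty_or_nonempty with he | hne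
  · rw [he]; simp
  have hbdd : BddAbove S := h.bddAbove_pos.mono fun x hx => hx.1
  set s := sSup S
  have hlt : ∀ x < s, x ∈ S := by
    intro x hx
    obtain ⟨y, hy, hxy⟩ := exists_lt_of_lt_csSup hne hx
    exact ⟨hy.1.trans_le (h.antitone hxy.le), (h.le_of_le hxy.le hy.1.le).trans_lt hy.2⟩
  have hfs : f s ≤ u := by
    have : s ∈ closure S := csSup_mem_closure hne hbdd
    have h2 : closure S ⊆ {x | f x ≤ u} :=
      closure_minimal (fun x hx => hx.2.le) (isClosed_le h.continuous continuous_const)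
    exact h2 this
  calc ∫⁻ x in S, ENNReal.ofReal (ψ x * f x ^ p)
      ≤ ∫⁻ x in Iic s, ENNReal.ofReal (ψ x * f x ^ p) :=
        lintegral_mono_set fun x hx => le_csSup hbdd hx
    _ = ∫⁻ x in Iio s, ENNReal.ofReal (ψ x * f x ^ p) := setLIntegral_congr Iio_ae_eq_Iic.symm
    _ = ENNReal.ofReal (f s ^ p / p) := h.setLIntegral_Iio_score hp fun x hx => (hlt x hx).1
    _ ≤ _ := ENNReal.ofReal_le_ofReal (by
        have := Real.rpow_le_rpow (h.pos s).le hfs hp.le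
        gcongr)

/-- The set lies in a bounded interval whose left end has density at least `u`; over it the score
integrates to an increment of `log f`. -/
theorem setLIntegral_superlevel_le (h : HolderScore f ψ β L) {u m : ℝ} (hu : 0 < u)
    (hm : ∀ x, Real.log (f x) ≤ m) :
    ∫⁻ x in {x | 0 < ψ x ∧ u ≤ f x}, ENNReal.ofReal (ψ x) ≤ ENNReal.ofReal (m - Real.log u) := by
  set S := {x | 0 < ψ x ∧ u ≤ f x} with hS
  rcases S.eq_empty_or_nonempty with he | hne
  · rw [he]; simp
  have hbdd : BddAbove S := h.bddAbove_pos.mono fun x hx => hx.1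
  have hbdd' : BddBelow S := by
    obtain ⟨x, hx⟩ := hne
    obtain ⟨c, hc⟩ := eventually_atBot.1 ((h.tendsto_atBot hx.1).eventually_lt_const hu)
    exact ⟨c, fun y hy => le_of_not_ge fun hyc => absurd (hc y hyc) (not_lt.2 hy.2)⟩
  set s := sSup S
  set c := sInf S
  have hcs : c ≤ s := csInf_le_csSup hne hbdd' hbdd
  have hpos : ∀ x ∈ Ioo c s, 0 < ψ x := by
    intro x hx
    obtain ⟨y, hy, hxy⟩ := exists_lt_of_lt_csSup hne hx.2
    exact hy.1.trans_le (h.antitone hxy.le)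
  have hfc : u ≤ f c := by
    have : c ∈ closure S := csInf_mem_closure hne hbdd'
    have h2 : closure S ⊆ {x | u ≤ f x} :=
      closure_minimal (fun x hx => hx.2) (isClosed_le continuous_const h.continuous)
    exact h2 this
  calc ∫⁻ x in S, ENNReal.ofReal (ψ x)
      ≤ ∫⁻ x in Icc c s, ENNReal.ofReal (ψ x) :=
        lintegral_mono_set fun x hx => ⟨csInf_le hbdd' hx, le_csSup hbdd hx⟩
    _ = ∫⁻ x in Ioo c s, ENNReal.ofReal (ψ x) := setLIntegral_congr Ioo_ae_eq_Icc.symm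
    _ = ENNReal.ofReal (Real.log (f s) - Real.log (f c)) := by
        rw [setLIntegral_Ioo_eq hcs (h.intervalIntegrable _ _) fun x hx => (hpos x hx).le,
          h.log_sub]
    _ ≤ _ := ENNReal.ofReal_le_ofReal (by
        have := Real.log_le_log hu hfc
        linarith [hm s])

/-- `log y ≤ 2 (√y - 1)`, in the form needed for heights above a level `u`. -/
theorem logHeight_le (h : HolderScore f ψ β L) {u x : ℝ} (hu : 0 < u) :
    logHeight f β L x ≤ 2 + 1 / β * Real.log L - Real.log u + 2 * ((u / f x) ^ (1 / 2 : ℝ) - 1) := by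
  have h1 : 0 < u / f x := div_pos hu (h.pos x)
  have h2 := Real.log_le_sub_one_of_pos (Real.rpow_pos_of_pos h1 (1 / 2))
  rw [Real.log_rpow h1, Real.log_div hu.ne' (h.pos x).ne'] at h2
  unfold logHeight
  linarith

/-- Used with `logHeight_le`: the logarithmic growth of the score below level `u` is paid for by
half a power of `f`, which leaves the exactly integrable `ψ f ^ (p - 1/2)`. -/
theorem sqrt_ratio_mul (h : HolderScore f ψ β L) {u x p : ℝ} (hu : 0 < u) :
    (u / f x) ^ (1 / 2 : ℝ) * f x ^ p = u ^ (1 / 2 : ℝ) * f x ^ (p - 1 / 2) := by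
  have := h.pos x
  rw [Real.div_rpow hu.le this.le, Real.rpow_sub this]
  field_simp

theorem setLIntegral_le_const_mul {S : Set ℝ} (hS : MeasurableSet S) {g k : ℝ → ℝ} {c K : ℝ} (hc : 0 ≤ c)
    (hle : ∀ x ∈ S, g x ≤ c * k x) (hk : ∫⁻ x in S, ENNReal.ofReal (k x) ≤ ENNReal.ofReal K) :
    ∫⁻ x in S, ENNReal.ofReal (g x) ≤ ENNReal.ofReal (c * K) := by
  calc ∫⁻ x in S, ENNReal.ofReal (g x)
      ≤ ∫⁻ x in S, ENNReal.ofReal c * ENNReal.ofReal (k x) :=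
        setLIntegral_mono' hS fun x hx => by
          rw [← ENNReal.ofReal_mul hc]
          exact ENNReal.ofReal_le_ofReal (hle x hx)
    _ = ENNReal.ofReal c * ∫⁻ x in S, ENNReal.ofReal (k x) :=
        lintegral_const_mul' _ _ ENNReal.ofReal_ne_top
    _ ≤ ENNReal.ofReal c * ENNReal.ofReal K := by gcongr
    _ = _ := (ENNReal.ofReal_mul hc).symm

theorem measurableSet_sublevel (h : HolderScore f ψ β L) (u : ℝ) :
    MeasurableSet {x | 0 < ψ x ∧ f x < u} :=
  (measurableSet_lt measurable_const h.measurable).inter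
    (measurableSet_lt h.continuous.measurable measurable_const)

theorem measurableSet_superlevel (h : HolderScore f ψ β L) (u : ℝ) :
    MeasurableSet {x | 0 < ψ x ∧ u ≤ f x} :=
  (measurableSet_lt measurable_const h.measurable).inter
    (measurableSet_le measurable_const h.continuous.measurable)

theorem one_le_ratio (h : HolderScore f ψ β L) {u x : ℝ} (hx : f x < u) :
    1 ≤ (u / f x) ^ (1 / 2 : ℝ) :=
  Real.one_le_rpow ((one_le_div (h.pos x)).2 hx.le) (by norm_num)

theorem exponent_mem (hβ : 1 ≤ β) : 0 ≤ (β - 1) / β ∧ (β - 1) / β ≤ 1 := by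
  have : 0 < β := by linarith
  exact ⟨div_nonneg (by linarith) this.le, (div_le_one this).2 (by linarith)⟩

/-- Fisher information in the tail `{f < u}` to the left of the mode. -/
theorem fisher_sublevel_le (h : HolderScore f ψ β L) (hβ : 1 ≤ β) (hL : 0 < L) {ε : ℝ}
    (hε : 0 < ε) :
    ∫⁻ x in {x | 0 < ψ x ∧ f x < ε * L ^ (1 / β)}, ENNReal.ofReal (ψ x ^ 2 * f x) ≤
      ENNReal.ofReal (12 * (L ^ (2 / β) * ε * logPlus (1 / ε))) := by
  set u := ε * L ^ (1 / β) with hu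
  have hL1 : 0 < L ^ (1 / β) := Real.rpow_pos_of_pos hL _
  have hu0 : 0 < u := by positivity
  set Λ := logPlus (1 / ε) with hΛ
  have hΛ1 : 1 ≤ Λ := le_max_left _ _
  have hΛ2 : -Real.log ε ≤ Λ := by
    rw [← Real.log_inv, ← one_div]; exact le_max_right _ _
  have hlogu : Real.log u = Real.log ε + 1 / β * Real.log L := by
    rw [hu, Real.log_mul hε.ne' hL1.ne', Real.log_rpow hL]
  have key := setLIntegral_le_const_mul (h.measurableSet_sublevel u)
    (g := fun x => ψ x ^ 2 * f x) (k := fun x => ψ x * f x ^ (1 / 2 : ℝ))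
    (c := 6 * L ^ (1 / β) * Λ * u ^ (1 / 2 : ℝ)) (K := u ^ (1 / 2 : ℝ) / (1 / 2)) (by positivity)
    (fun x hx => ?_) (h.setLIntegral_sublevel_le (by norm_num))
  · refine key.trans_eq ?_
    congr 1
    have e1 : u ^ (1 / 2 : ℝ) * u ^ (1 / 2 : ℝ) = u := by
      rw [← Real.rpow_add hu0]; norm_num
    have e2 : L ^ (2 / β) = L ^ (1 / β) * L ^ (1 / β) := by
      rw [← Real.rpow_add hL]; ring_nf
    rw [e2]
    linear_combination (12 * L ^ (1 / β) * Λ) * e1 + 12 * L ^ (1 / β) * Λ * hu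
  · have hfx := h.pos x
    have h1 := h.logHeight_le (x := x) hu0
    have h2 := h.one_le_ratio hx.2
    have h3 := h.score_le hβ hL x
    have h4 := h.one_le_logHeight hβ hL x
    have h5 := h.sqrt_ratio_mul (x := x) (p := 1) hu0
    set y := (u / f x) ^ (1 / 2 : ℝ)
    set ℓ := logHeight f β L x
    -- The exponent is given away here: one full logarithm in the tail is still affordable in the
    -- final rate.
    have h6 : ℓ ^ ((β - 1) / β) ≤ ℓ := by
      simpa using Real.rpow_le_rpow_of_exponent_le h4 (exponent_mem hβ).2
    have h7 : ℓ ≤ 3 * Λ * y := by nlinarith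
    have h8 : ψ x ≤ 2 * L ^ (1 / β) * (3 * Λ * y) :=
      h3.trans (mul_le_mul_of_nonneg_left (h6.trans h7) (by positivity))
    rw [Real.rpow_one, show (1 : ℝ) - 1 / 2 = 1 / 2 by norm_num] at h5
    calc ψ x ^ 2 * f x = ψ x * (ψ x * f x) := by ring
      _ ≤ ψ x * (2 * L ^ (1 / β) * (3 * Λ * y) * f x) := by
          have := hx.1
          gcongr
      _ = 6 * L ^ (1 / β) * Λ * ψ x * (y * f x) := by ring
      _ = _ := by rw [h5]; ring

/-- The cubic score integral over `{f ≥ u}` to the left of the mode. -/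
theorem cube_superlevel_le (h : HolderScore f ψ β L) (hβ : 1 ≤ β) (hL : 0 < L) {ε : ℝ}
    (hε : 0 < ε) :
    ∫⁻ x in {x | 0 < ψ x ∧ ε * L ^ (1 / β) ≤ f x}, ENNReal.ofReal (ψ x ^ 3) ≤
      ENNReal.ofReal (72 * (L ^ (2 / β) * logPlus (1 / ε) ^ (3 - 2 / β))) := by
  set u := ε * L ^ (1 / β) with hu
  have hβ0 : 0 < β := by linarith
  have hL1 : 0 < L ^ (1 / β) := Real.rpow_pos_of_pos hL _
  have hu0 : 0 < u := by positivity
  set Λ := logPlus (1 / ε) with hΛ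
  have hΛ1 : 1 ≤ Λ := le_max_left _ _
  have hΛ0 : 0 < Λ := by linarith
  have hΛ2 : -Real.log ε ≤ Λ := by
    rw [← Real.log_inv, ← one_div]; exact le_max_right _ _
  have hlogu : Real.log u = Real.log ε + 1 / β * Real.log L := by
    rw [hu, Real.log_mul hε.ne' hL1.ne', Real.log_rpow hL]
  set a := (β - 1) / β with ha
  have ha' := exponent_mem hβ
  have e2 : L ^ (2 / β) = L ^ (1 / β) * L ^ (1 / β) := by
    rw [← Real.rpow_add hL]; ring_nf
  have key := setLIntegral_le_const_mul (h.measurableSet_superlevel u)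
    (g := fun x => ψ x ^ 3) (k := fun x => ψ x)
    (c := (6 * L ^ (1 / β) * Λ ^ a) ^ 2) (K := 2 * Λ) (by positivity)
    (fun x hx => ?_) ((h.setLIntegral_superlevel_le hu0 (h.log_f_le hβ hL)).trans
      (ENNReal.ofReal_le_ofReal (by linarith)))
  · refine key.trans_eq ?_
    congr 1
    -- Two factors `Λ ^ a` come from the pointwise bound on `ψ ^ 2`, and one `Λ` from `∫ ψ`.
    have e3 : Λ ^ (3 - 2 / β) = Λ ^ a * Λ ^ a * Λ := by
      rw [← Real.rpow_add hΛ0, ← Real.rpow_add_one hΛ0.ne']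
      congr 1
      rw [ha]; field_simp; ring
    rw [e2, e3]
    ring
  · have h3 := h.score_le hβ hL x
    have h4 := h.one_le_logHeight hβ hL x
    have h1 := Real.log_le_log hu0 hx.2
    have h5 : logHeight f β L x ≤ 3 * Λ := by unfold logHeight; linarith
    have h6 : logHeight f β L x ^ a ≤ 3 * Λ ^ a := by
      calc logHeight f β L x ^ a ≤ (3 * Λ) ^ a := Real.rpow_le_rpow (by linarith) h5 ha'.1
        _ = 3 ^ a * Λ ^ a := Real.mul_rpow (by norm_num) hΛ0.le
        _ ≤ 3 * Λ ^ a := by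
          have : (3 : ℝ) ^ a ≤ 3 ^ (1 : ℝ) := Real.rpow_le_rpow_of_exponent_le (by norm_num) ha'.2
          rw [Real.rpow_one] at this
          gcongr
    have h8 : ψ x ≤ 6 * L ^ (1 / β) * Λ ^ a :=
      h3.trans ((mul_le_mul_of_nonneg_left h6 (by positivity)).trans_eq (by ring))
    have := hx.1
    calc ψ x ^ 3 = ψ x ^ 2 * ψ x := by ring
      _ ≤ _ := by gcongr

/-- Since `e < 3`, the level `3 * L ^ (1 / β)` exceeds the whole density, and the tail bound covers
everything. -/
theorem fisher_left_le (h : HolderScore f ψ β L) (hβ : 1 ≤ β) (hL : 0 < L) :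
    ∫⁻ x in {x | 0 < ψ x}, ENNReal.ofReal (ψ x ^ 2 * f x) ≤
      ENNReal.ofReal (36 * L ^ (2 / β)) := by
  have h1 := h.fisher_sublevel_le hβ hL (ε := 3) (by norm_num)
  have e : {x | 0 < ψ x ∧ f x < 3 * L ^ (1 / β)} = {x | 0 < ψ x} := by
    ext x
    refine ⟨fun hx => hx.1, fun hx => ⟨hx, (h.le_sup hβ hL x).trans_lt ?_⟩⟩
    have := Real.exp_one_lt_d9
    have := Real.rpow_pos_of_pos hL (1 / β)
    nlinarith
  have e2 : logPlus (1 / 3) = 1 := by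
    refine max_eq_left ((Real.log_nonpos (by norm_num) (by norm_num)).trans zero_le_one)
  rw [e, e2] at h1
  refine h1.trans_eq ?_
  congr 1
  ring

/-- The weighted Fisher information `∫ ψ² f^γ` to the left of the mode. -/
theorem weighted_fisher_le (h : HolderScore f ψ β L) (hβ : 1 ≤ β) (hL : 0 < L) {γ s K : ℝ}
    (hγ : 3 / 5 ≤ γ) (hγ1 : γ ≤ 1) (hs : 0 < s) (hK : 0 ≤ K)
    (hF : ∫⁻ x in {x | 0 < ψ x}, ENNReal.ofReal (ψ x ^ 2 * f x) ≤ ENNReal.ofReal (K * s)) :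
    ∫⁻ x in {x | 0 < ψ x}, ENNReal.ofReal (ψ x * (ψ x * f x ^ γ)) ≤
      ENNReal.ofReal ((80 + K) * (s *
        (s / (L ^ (1 / β) * logPlus (L ^ (2 / β) / s) ^ ((β - 1) / β))) ^ (γ - 1))) := by
  have hβ0 : 0 < β := by linarith
  have hL1 : 0 < L ^ (1 / β) := Real.rpow_pos_of_pos hL _
  have hL2 : 0 < L ^ (2 / β) := Real.rpow_pos_of_pos hL _
  set Λ := logPlus (L ^ (2 / β) / s) with hΛ
  set a := (β - 1) / β with ha
  have ha' := exponent_mem hβ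
  have hΛ1 : 1 ≤ Λ := le_max_left _ _
  have hΛ0 : 0 < Λ := by linarith
  have hΛ2 : Real.log (L ^ (2 / β) / s) ≤ Λ := le_max_right _ _
  have hΛa : 0 < Λ ^ a := Real.rpow_pos_of_pos hΛ0 _
  -- This level balances the two halves: above `u`, `f ^ (γ - 1) ≤ u ^ (γ - 1)` and the information
  -- is of order `s`; below `u`, the growth bound gives a contribution of order `L ^ (1/β) * Λ ^ a *
  -- u ^ γ = s * u ^ (γ - 1)`.
  set u := s / (L ^ (1 / β) * Λ ^ a) with hu
  have hu0 : 0 < u := by positivity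
  have hlog : 1 / β * Real.log L - Real.log u ≤ 2 * Λ := by
    rw [hu, Real.log_div hs.ne' (by positivity), Real.log_mul hL1.ne' hΛa.ne', Real.log_rpow hL,
      Real.log_rpow hΛ0]
    rw [Real.log_div hL2.ne' hs.ne', Real.log_rpow hL] at hΛ2
    have h1 : a * Real.log Λ ≤ Λ := by
      have := Real.log_le_sub_one_of_pos hΛ0
      have h0 := Real.log_nonneg hΛ1
      nlinarith
    have e : 2 / β * Real.log L = 1 / β * Real.log L + 1 / β * Real.log L := by ring
    linarith
  have hus : L ^ (1 / β) * Λ ^ a * u = s := by rw [hu]; field_simp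
  have hlow : ∫⁻ x in {x | 0 < ψ x ∧ f x < u}, ENNReal.ofReal (ψ x * (ψ x * f x ^ γ)) ≤
      ENNReal.ofReal (80 * (s * u ^ (γ - 1))) := by
    have key := setLIntegral_le_const_mul (h.measurableSet_sublevel u)
      (g := fun x => ψ x * (ψ x * f x ^ γ)) (k := fun x => ψ x * f x ^ (γ - 1 / 2))
      (c := 8 * L ^ (1 / β) * Λ ^ a * u ^ (1 / 2 : ℝ)) (K := u ^ (γ - 1 / 2) / (γ - 1 / 2))
      (by positivity) (fun x hx => ?_) (h.setLIntegral_sublevel_le (by linarith))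
    · refine key.trans (ENNReal.ofReal_le_ofReal ?_)
      have e1 : u ^ (1 / 2 : ℝ) * u ^ (γ - 1 / 2) = u * u ^ (γ - 1) := by
        rw [← Real.rpow_add hu0, ← Real.rpow_one_add' hu0.le (by linarith)]
        congr 1; ring
      -- The factor `10` is `1 / (3/5 - 1/2)`; the value `γ = 3/5` occurs at `β = 2`.
      have h10 : u ^ (γ - 1 / 2) / (γ - 1 / 2) ≤ 10 * u ^ (γ - 1 / 2) := by
        rw [div_le_iff₀ (by linarith)]
        have := Real.rpow_pos_of_pos hu0 (γ - 1 / 2)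
        nlinarith
      calc 8 * L ^ (1 / β) * Λ ^ a * u ^ (1 / 2 : ℝ) * (u ^ (γ - 1 / 2) / (γ - 1 / 2))
          ≤ 8 * L ^ (1 / β) * Λ ^ a * u ^ (1 / 2 : ℝ) * (10 * u ^ (γ - 1 / 2)) := by gcongr
        _ = 80 * (L ^ (1 / β) * Λ ^ a) * (u ^ (1 / 2 : ℝ) * u ^ (γ - 1 / 2)) := by ring
        _ = 80 * (L ^ (1 / β) * Λ ^ a * u) * u ^ (γ - 1) := by rw [e1]; ring
        _ = _ := by rw [hus]; ring
    · have hfx := h.pos x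
      have h1 := h.logHeight_le (x := x) hu0
      have h2 := h.one_le_ratio hx.2
      have h3 := h.score_le hβ hL x
      have h4 := h.one_le_logHeight hβ hL x
      have h5 := h.sqrt_ratio_mul (x := x) (p := γ) hu0
      set y := (u / f x) ^ (1 / 2 : ℝ)
      set ℓ := logHeight f β L x
      have h7 : ℓ ≤ (4 * y) * Λ := by nlinarith
      have h6 : ℓ ^ a ≤ 4 * y * Λ ^ a := by
        calc ℓ ^ a ≤ ((4 * y) * Λ) ^ a := Real.rpow_le_rpow (by linarith) h7 ha'.1
          _ = (4 * y) ^ a * Λ ^ a := Real.mul_rpow (by linarith) hΛ0.le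
          _ ≤ 4 * y * Λ ^ a := by
            have : (4 * y) ^ a ≤ (4 * y) ^ (1 : ℝ) :=
              Real.rpow_le_rpow_of_exponent_le (by linarith) ha'.2
            rw [Real.rpow_one] at this
            gcongr
      have h8 : ψ x ≤ 2 * L ^ (1 / β) * (4 * y * Λ ^ a) :=
        h3.trans (mul_le_mul_of_nonneg_left h6 (by positivity))
      have hψ := hx.1
      calc ψ x * (ψ x * f x ^ γ) ≤ ψ x * (2 * L ^ (1 / β) * (4 * y * Λ ^ a) * f x ^ γ) := by
            gcongr
        _ = 8 * L ^ (1 / β) * Λ ^ a * ψ x * (y * f x ^ γ) := by ring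
        _ = _ := by rw [h5]; ring
  have hhigh : ∫⁻ x in {x | 0 < ψ x ∧ u ≤ f x}, ENNReal.ofReal (ψ x * (ψ x * f x ^ γ)) ≤
      ENNReal.ofReal (u ^ (γ - 1) * (K * s)) := by
    refine setLIntegral_le_const_mul (h.measurableSet_superlevel u)
      (k := fun x => ψ x ^ 2 * f x) (Real.rpow_nonneg hu0.le _) (fun x hx => ?_)
      ((lintegral_mono_set fun x hx => hx.1).trans hF)
    have hfx := h.pos x
    have e : f x ^ γ = f x ^ (γ - 1) * f x := by
      rw [← Real.rpow_add_one hfx.ne', sub_add_cancel]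
    have h1 : f x ^ (γ - 1) ≤ u ^ (γ - 1) :=
      Real.rpow_le_rpow_of_nonpos hu0 hx.2 (by linarith)
    calc ψ x * (ψ x * f x ^ γ) = f x ^ (γ - 1) * (ψ x ^ 2 * f x) := by rw [e]; ring
      _ ≤ _ := by gcongr
  have hun : {x | 0 < ψ x} = {x | 0 < ψ x ∧ f x < u} ∪ {x | 0 < ψ x ∧ u ≤ f x} := by
    ext x
    simp only [mem_ofPred_eq, mem_union, ← and_or_left, lt_or_ge, and_true]
  rw [hun]
  refine (lintegral_union_le _ _ _).trans ((add_le_add hlow hhigh).trans_eq ?_)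
  rw [← ENNReal.ofReal_add]
  · congr 1; ring
  · have := Real.rpow_nonneg hu0.le (γ - 1); positivity
  · have := Real.rpow_nonneg hu0.le (γ - 1); positivity

end HolderScore

end ScoreEstimation

/-! ### From an error bound at every bandwidth to the integrated loss. -/

namespace ScoreEstimation

open Set Filter Topology

/-- The substitution `v = y - x + w` leaves `∫ v in Ioi w, (v / 2) ^ (-3/2)`, and `2 ^ (3/2) ≤ 3`.
-/
theorem lintegral_rpow_shift (y : ℝ) {w : ℝ} (hw : 0 < w) :
    ∫⁻ x in Iic y, ENNReal.ofReal (((y - x + w) / 2) ^ (-3 / 2 : ℝ)) ≤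
      ENNReal.ofReal (6 * w ^ (-1 / 2 : ℝ)) := by
  have hmp := Measure.measurePreserving_sub_left (volume : Measure ℝ) (y + w)
  have hpre : (fun x => y + w - x) ⁻¹' Ici w = Iic y := by
    ext x; simp only [mem_preimage, mem_Ici, mem_Iic]; constructor <;> intro h <;> linarith
  have hmeas : Measurable fun v : ℝ => ENNReal.ofReal ((v / 2) ^ (-3 / 2 : ℝ)) := by fun_prop
  have e1 : ∫⁻ x in Iic y, ENNReal.ofReal (((y - x + w) / 2) ^ (-3 / 2 : ℝ)) =
      ∫⁻ v in Ici w, ENNReal.ofReal ((v / 2) ^ (-3 / 2 : ℝ)) := by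
    rw [← hmp.setLIntegral_comp_preimage measurableSet_Ici hmeas, hpre]
    congr 1; funext x; congr 3; ring
  have hle : ∀ v ∈ Ioi w, (v / 2) ^ (-3 / 2 : ℝ) ≤ 3 * v ^ (-3 / 2 : ℝ) := by
    intro v hv
    have hv0 : 0 < v := hw.trans hv
    rw [div_eq_mul_inv, Real.mul_rpow hv0.le (by norm_num), mul_comm]
    have : (2⁻¹ : ℝ) ^ (-3 / 2 : ℝ) ≤ 3 := by
      rw [Real.inv_rpow (by norm_num), ← Real.rpow_neg (by norm_num)]
      have h1 : (2 : ℝ) ^ (-(-3 / 2) : ℝ) = √8 := by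
        rw [Real.sqrt_eq_rpow, show (8 : ℝ) = 2 ^ (3 : ℝ) by norm_num, ← Real.rpow_mul (by norm_num)]
        norm_num
      rw [h1, Real.sqrt_le_left (by norm_num)]; norm_num
    have := Real.rpow_nonneg hv0.le (-3 / 2 : ℝ)
    gcongr
  have hint : IntegrableOn (fun v : ℝ => 3 * v ^ (-3 / 2 : ℝ)) (Ioi w) :=
    (integrableOn_Ioi_rpow_of_lt (by norm_num) hw).const_mul 3
  rw [e1, setLIntegral_congr Ioi_ae_eq_Ici.symm]
  calc ∫⁻ v in Ioi w, ENNReal.ofReal ((v / 2) ^ (-3 / 2 : ℝ))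
      ≤ ∫⁻ v in Ioi w, ENNReal.ofReal (3 * v ^ (-3 / 2 : ℝ)) :=
        setLIntegral_mono' measurableSet_Ioi fun v hv => ENNReal.ofReal_le_ofReal (hle v hv)
    _ = ENNReal.ofReal (∫ v in Ioi w, 3 * v ^ (-3 / 2 : ℝ)) := by
        rw [ofReal_integral_eq_lintegral_ofReal hint]
        exact (ae_restrict_iff' measurableSet_Ioi).2 (Eventually.of_forall fun v hv =>
          mul_nonneg (by norm_num) (Real.rpow_nonneg (hw.trans hv).le _))
    _ = _ := by
        rw [integral_const_mul, integral_Ioi_rpow_of_lt (by norm_num) hw]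
        congr 1; norm_num; ring

namespace HolderScore

variable {f ψ : ℝ → ℝ} {β L : ℝ}

/-- The right endpoint of `{ψ > t}`, for the levels `0 ≤ t < sup ψ`. -/
noncomputable def edge (ψ : ℝ → ℝ) (t : ℝ) : ℝ :=
  open scoped Classical in if 0 ≤ t ∧ ∃ x, t < ψ x then sSup {x | t < ψ x} else 0

theorem bddAbove_superlevel (h : HolderScore f ψ β L) {t : ℝ} (ht : 0 ≤ t) :
    BddAbove {x | t < ψ x} :=
  h.bddAbove_pos.mono fun _ hx => ht.trans_lt hx

theorem edge_eq {t x : ℝ} (ht : 0 ≤ t) (hx : t < ψ x) : edge ψ t = sSup {x | t < ψ x} := by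
  unfold edge; rw [if_pos ⟨ht, x, hx⟩]

theorem le_edge (h : HolderScore f ψ β L) {t x : ℝ} (ht : 0 ≤ t) (hx : t < ψ x) :
    x ≤ edge ψ t := by
  rw [edge_eq ht hx]; exact le_csSup (h.bddAbove_superlevel ht) hx

theorem edge_le (h : HolderScore f ψ β L) {t x y : ℝ} (ht : 0 ≤ t) (hx : t < ψ x) (hy : ψ y ≤ t) :
    edge ψ t ≤ y := by
  rw [edge_eq ht hx]
  refine csSup_le ⟨x, hx⟩ fun z hz => le_of_not_gt fun hyz => ?_
  exact absurd ((h.antitone hyz.le).trans hy) (not_le.2 hz)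

theorem lt_of_lt_edge (h : HolderScore f ψ β L) {t x z : ℝ} (ht : 0 ≤ t) (hx : t < ψ x)
    (hz : z < edge ψ t) : t < ψ z :=
  lt_of_not_ge fun hc => absurd (h.edge_le ht hx hc) (not_le.2 hz)

/-- The levels whose endpoint lies beyond `a` form an order-connected set. Outside the admissible
levels `edge` is zero, so their complement joins the preimage exactly when `a < 0`. -/
theorem measurable_edge (h : HolderScore f ψ β L) : Measurable (edge ψ) := by
  refine measurable_of_Ioi fun a => ?_
  set T := {t : ℝ | 0 ≤ t ∧ ∃ x, t < ψ x} with hT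
  have hTm : MeasurableSet T := by
    refine OrdConnected.measurableSet ⟨fun p hp q hq r hr => ?_⟩
    obtain ⟨x, hx⟩ := hq.2
    exact ⟨hp.1.trans hr.1, x, hr.2.trans_lt hx⟩
  have hAm : MeasurableSet {t : ℝ | 0 ≤ t ∧ ∃ x, a < x ∧ t < ψ x} := by
    refine OrdConnected.measurableSet ⟨fun p hp q hq r hr => ?_⟩
    obtain ⟨x, hax, hx⟩ := hq.2
    exact ⟨hp.1.trans hr.1, x, hax, hr.2.trans_lt hx⟩
  have e : edge ψ ⁻¹' Ioi a = {t : ℝ | 0 ≤ t ∧ ∃ x, a < x ∧ t < ψ x} ∪ (Tᶜ ∩ {_t | a < 0}) := by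
    ext t
    simp only [mem_preimage, mem_Ioi, mem_union, mem_inter_iff, mem_compl_iff]
    by_cases htT : t ∈ T
    · obtain ⟨ht, x, hx⟩ := id htT
      rw [edge_eq ht hx, lt_csSup_iff (h.bddAbove_superlevel ht) ⟨x, hx⟩]
      simp only [htT, not_true, false_and, or_false, mem_ofPred_eq, ht, true_and]
      exact ⟨fun ⟨b, hb1, hb2⟩ => ⟨b, hb2, hb1⟩, fun ⟨b, hb1, hb2⟩ => ⟨b, hb2, hb1⟩⟩
    · have : edge ψ t = 0 := by unfold edge; exact if_neg htT
      rw [this]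
      constructor
      · exact fun ha => Or.inr ⟨htT, ha⟩
      · rintro (⟨h1, x, _, hx⟩ | ⟨_, ha⟩)
        · exact absurd ⟨h1, x, hx⟩ htT
        · exact ha
  rw [e]
  exact hAm.union (hTm.compl.inter (MeasurableSet.const _))

theorem le_f_edge (h : HolderScore f ψ β L) {t x : ℝ} (ht : 0 ≤ t) (hx : t < ψ x) :
    f x ≤ f (edge ψ t) := by
  have h1 : edge ψ t ∈ closure {x | t < ψ x} := by
    rw [edge_eq ht hx]; exact csSup_mem_closure ⟨x, hx⟩ (h.bddAbove_superlevel ht)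
  -- The maximum makes the inequality hold at points left of `x` too, so that one closed condition
  -- covers all of `{ψ > t}`.
  have h2 : closure {x | t < ψ x} ⊆ {z | f x ≤ f (max z x)} := by
    refine closure_minimal (fun z hz => h.le_of_le (le_max_right _ _) ?_)
      (isClosed_le continuous_const (h.continuous.comp (continuous_id.max continuous_const)))
    rcases max_cases z x with ⟨e, _⟩ | ⟨e, _⟩ <;> rw [e]
    · exact ht.trans (le_of_lt hz)
    · exact ht.trans hx.le
  have h3 := h2 h1
  rwa [mem_ofPred_eq, max_eq_left (h.le_edge ht hx)] at h3

/-- The minimal bandwidth at density level `u`. -/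
noncomputable def minWidth (β L v u : ℝ) : ℝ := (v / (4 * L ^ 2 * u)) ^ (1 / (2 * β + 1))

/-- The majorant of `d x * f x` in terms of the right endpoint of `{ψ > t}`. -/
noncomputable def majorant (f ψ : ℝ → ℝ) (β L v x t : ℝ) : ℝ :=
  √(v * f (edge ψ t)) * ((edge ψ t - x + minWidth β L v (f (edge ψ t))) / 2) ^ (-3 / 2 : ℝ)

theorem minWidth_pos {v u : ℝ} (hL : 0 < L) (hv : 0 < v) (hu : 0 < u) : 0 < minWidth β L v u :=
  Real.rpow_pos_of_pos (by positivity) _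

/-- The pointwise bound for an error `d` at `x` that is controlled at every bandwidth. -/
theorem sq_error_le (h : HolderScore f ψ β L) (hβ : 1 ≤ β) (hL : 0 < L) {ε c₁ c₂ : ℝ}
    (hε : 0 < ε) (hc₁ : 1 ≤ c₁) (hc₂ : 1 ≤ c₂) {x d : ℝ} (hd0 : 0 ≤ d) (hd : d ≤ ψ x)
    (hx : 0 < ψ x)
    (hband : ∀ b, 0 < b → 2 * b * ψ x ≤ 1 → 0 ≤ ψ (x + 2 * b) → c₁ * ε ≤ b * f x →
      d ≤ ψ x - ψ (x + 2 * b) + c₂ * √(ε / (f x * b ^ 3))) :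
    ENNReal.ofReal (d ^ 2 * f x) ≤ ENNReal.ofReal ((32 * c₂ ^ 2 + 3 * c₁ ^ 2) * ε * ψ x ^ 3) +
      2 * ∫⁻ t in Ico 0 (ψ x), ENNReal.ofReal (majorant f ψ β L (32 * c₂ ^ 2 * ε) x t) := by
  have hfx := h.pos x
  rcases hd0.eq_or_lt with h0 | hd0
  · rw [← h0]; simp
  set κ := 32 * c₂ ^ 2 with hκ
  have hκ1 : 1 ≤ κ := by nlinarith
  have hκ0 : 0 < κ := by linarith
  -- `H = q ^ (1/3)` is the width at which the stochastic term for `b = H / 2` equals exactly `d /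
  -- 2`; this explains `κ = 32 * c₂ ^ 2`. The width depends on the unknown error itself.
  set q := κ * ε / (f x * d ^ 2) with hq
  have hq0 : 0 < q := by positivity
  set H := q ^ (1 / 3 : ℝ) with hH
  have hH0 : 0 < H := Real.rpow_pos_of_pos hq0 _
  have hH3 : H ^ 3 = q := by
    rw [hH, ← Real.rpow_natCast, ← Real.rpow_mul hq0.le]; norm_num
  have hH3' : H ^ 3 * (f x * d ^ 2) = κ * ε := by rw [hH3, hq]; field_simp
  have hd3 : d ^ 2 * d ≤ ψ x ^ 3 := by
    calc d ^ 2 * d = d ^ 3 := by ring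
      _ ≤ _ := by gcongr
  -- Window too wide for the hypothesis: `κ ε = H ^ 3 * f x * d ^ 2` then gives `d ^ 2 * f x ≤ κ ε ψ
  -- x ^ 3` at once.
  by_cases h1 : 1 < H * ψ x
  · refine le_add_right (ENNReal.ofReal_le_ofReal ?_)
    have h2 : 1 ≤ (H * ψ x) ^ 3 := one_le_pow₀ h1.le
    have h3 : d ^ 2 * f x * 1 ≤ d ^ 2 * f x * (H * ψ x) ^ 3 :=
      mul_le_mul_of_nonneg_left h2 (by positivity)
    have h4 : d ^ 2 * f x * (H * ψ x) ^ 3 = κ * ε * ψ x ^ 3 := by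
      rw [← hH3']; ring
    have : 0 ≤ 3 * c₁ ^ 2 * ε * ψ x ^ 3 := by positivity
    linarith
  push Not at h1
  -- Window with too little mass: eliminating `H` gives `f x ≤ 3 * c₁ ^ 2 * ε * d`, which is again a
  -- cubic term because `d ≤ ψ x`.
  by_cases h2 : H / 2 * f x < c₁ * ε
  · refine le_add_right (ENNReal.ofReal_le_ofReal ?_)
    have h3 : (H / 2 * f x) ^ 3 ≤ (c₁ * ε) ^ 3 := by gcongr
    have h4 : f x ^ 2 ≤ (3 * c₁ ^ 2 * ε * d) ^ 2 := by
      have e : (H / 2 * f x) ^ 3 * (8 * d ^ 2) = κ * ε * f x ^ 2 := by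
        rw [← hH3']; ring
      have h5 : κ * ε * f x ^ 2 ≤ (c₁ * ε) ^ 3 * (8 * d ^ 2) := by
        rw [← e]; gcongr
      have h6 : 1 * ε * f x ^ 2 ≤ κ * ε * f x ^ 2 := by gcongr
      have h7 : (c₁ * ε) ^ 3 * (8 * d ^ 2) ≤ ε * (3 * c₁ ^ 2 * ε * d) ^ 2 := by
        have : 0 ≤ c₁ ^ 3 * ε ^ 3 * d ^ 2 * (9 * c₁ - 8) :=
          mul_nonneg (by positivity) (by linarith)
        nlinarith
      have h8 : ε * f x ^ 2 ≤ ε * (3 * c₁ ^ 2 * ε * d) ^ 2 := by linarith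
      exact le_of_mul_le_mul_left h8 hε
    have h5 : f x ≤ 3 * c₁ ^ 2 * ε * d := 
      (pow_le_pow_iff_left₀ hfx.le (by positivity) two_ne_zero).1 h4
    calc d ^ 2 * f x ≤ d ^ 2 * (3 * c₁ ^ 2 * ε * d) := by gcongr
      _ = 3 * c₁ ^ 2 * ε * (d ^ 2 * d) := by ring
      _ ≤ 3 * c₁ ^ 2 * ε * ψ x ^ 3 := by gcongr
      _ ≤ _ := by
        have : 0 ≤ κ * ε * ψ x ^ 3 := by positivity
        linarith
  push Not at h2
  refine le_add_left ?_
  set m := max (ψ (x + H)) 0 with hm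
  have hstoch : c₂ * √(ε / (f x * (H / 2) ^ 3)) = d / 2 := by
    have e : ε / (f x * (H / 2) ^ 3) = (d / (2 * c₂)) ^ 2 := by
      have : f x * (H / 2) ^ 3 = κ * ε / (8 * d ^ 2) := by rw [← hH3']; field_simp; norm_num
      rw [this, hκ]; field_simp; norm_num
    rw [e, Real.sqrt_sq (by positivity)]; field_simp
  -- The bias has to account for the other half of the error. If the score is negative at `x + H`,
  -- then `m = 0` and `d ≤ ψ x` suffices.
  have hbias : d / 2 ≤ ψ x - m := by
    rcases le_total 0 (ψ (x + H)) with h3 | h3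
    · have h4 := hband (H / 2) (by positivity) (by linarith) (by
        rw [mul_div_cancel₀ _ (two_ne_zero)]; exact h3) h2
      rw [hstoch, mul_div_cancel₀ _ (two_ne_zero)] at h4
      rw [hm, max_eq_left h3]; linarith
    · rw [hm, max_eq_right h3]; linarith
  have hholder : d ≤ 2 * (L * H ^ (β - 1)) := by
    have h3 := (abs_le.1 (h.holder x (x + H))).2
    rw [sub_add_cancel_left, abs_neg, abs_of_pos hH0] at h3
    have : ψ (x + H) ≤ m := le_max_left _ _
    linarith
  -- The Hölder bound `d ≤ 2 L H ^ (β - 1)` forces `H` to be at least the minimal bandwidth at level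
  -- `f x`.
  have hwidth : κ * ε / (4 * L ^ 2 * f x) ≤ H ^ (2 * β + 1) := by
    have e : H ^ (2 * β + 1) = (H ^ (β - 1)) ^ 2 * H ^ 3 := by
      rw [← Real.rpow_natCast, ← Real.rpow_natCast, ← Real.rpow_mul hH0.le, ← Real.rpow_add hH0]
      congr 1; push_cast; ring
    rw [div_le_iff₀ (by positivity), e, ← hH3']
    have h3 : d ^ 2 ≤ (2 * (L * H ^ (β - 1))) ^ 2 := by gcongr
    calc H ^ 3 * (f x * d ^ 2) ≤ H ^ 3 * (f x * (2 * (L * H ^ (β - 1))) ^ 2) := by gcongr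
      _ = _ := by ring
  have hdf : d * f x = √(κ * ε * f x) * H ^ (-3 / 2 : ℝ) := by
    have e1 : H ^ (-3 / 2 : ℝ) = (√(H ^ 3))⁻¹ := by
      rw [Real.sqrt_eq_rpow, ← Real.rpow_natCast, ← Real.rpow_mul hH0.le, ← Real.rpow_neg hH0.le]
      norm_num
    rw [e1, ← hH3', show H ^ 3 * (f x * d ^ 2) * f x = (d * f x) ^ 2 * H ^ 3 by ring,
      Real.sqrt_mul (by positivity), Real.sqrt_sq (by positivity)]
    have : 0 < √(H ^ 3) := Real.sqrt_pos.2 (by positivity)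
    field_simp
  -- For these levels the endpoint `edge ψ t` lies in `[x, x + H]` and has density at least `f x`.
  -- The distance to it and the minimal width there are both at most `H`, so their mean may replace
  -- `H` in `H ^ (-3/2)`.
  have hmaj : ∀ t ∈ Ico m (ψ x), d * f x ≤ majorant f ψ β L (κ * ε) x t := by
    intro t ht
    have ht0 : 0 ≤ t := (le_max_right _ _).trans ht.1
    have hxe := h.le_edge ht0 ht.2
    have hex : edge ψ t ≤ x + H := h.edge_le ht0 ht.2 ((le_max_left _ _).trans ht.1)
    have hfe := h.le_f_edge ht0 ht.2
    have hw : minWidth β L (κ * ε) (f (edge ψ t)) ≤ H := by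
      have h2β : 0 < 2 * β + 1 := by linarith
      calc minWidth β L (κ * ε) (f (edge ψ t)) ≤ (H ^ (2 * β + 1)) ^ (1 / (2 * β + 1)) := by
            refine Real.rpow_le_rpow (by have := h.pos (edge ψ t); positivity)
              (le_trans ?_ hwidth) (by positivity)
            gcongr
        _ = H := by
          rw [← Real.rpow_mul hH0.le, mul_one_div_cancel h2β.ne', Real.rpow_one]
    have hw0 := minWidth_pos (β := β) hL (mul_pos hκ0 hε) (h.pos (edge ψ t))
    rw [hdf]
    unfold majorant
    refine mul_le_mul (Real.sqrt_le_sqrt (by gcongr))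
      (Real.rpow_le_rpow_of_nonpos (by linarith) (by linarith) (by norm_num))
      (Real.rpow_nonneg hH0.le _) (Real.sqrt_nonneg _)
  have hm0 : 0 ≤ m := le_max_right _ _
  calc ENNReal.ofReal (d ^ 2 * f x)
      = 2 * ENNReal.ofReal (d * f x * (d / 2)) := by
        rw [show (2 : ENNReal) = ENNReal.ofReal 2 by simp, ← ENNReal.ofReal_mul (by norm_num)]
        congr 1; ring
    _ ≤ 2 * ENNReal.ofReal (d * f x * (ψ x - m)) := by
        gcongr
    _ = 2 * ∫⁻ _ in Ico m (ψ x), ENNReal.ofReal (d * f x) := by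
        rw [setLIntegral_const, Real.volume_Ico, ENNReal.ofReal_mul (by positivity)]
    _ ≤ 2 * ∫⁻ t in Ico m (ψ x), ENNReal.ofReal (majorant f ψ β L (κ * ε) x t) := by
        gcongr 2 * ?_
        exact setLIntegral_mono' measurableSet_Ico fun t ht => ENNReal.ofReal_le_ofReal (hmaj t ht)
    _ ≤ _ := by
        gcongr 2 * ?_
        exact lintegral_mono_set (Ico_subset_Ico_left hm0)

theorem measurable_majorant (h : HolderScore f ψ β L) (v : ℝ) :
    Measurable fun p : ℝ × ℝ => majorant f ψ β L v p.1 p.2 := by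
  have h1 := h.measurable_edge
  have h2 := h.continuous.measurable
  unfold majorant minWidth
  have h3 : Measurable fun p : ℝ × ℝ => edge ψ p.2 := h1.comp measurable_snd
  have h4 : Measurable fun p : ℝ × ℝ => f (edge ψ p.2) := h2.comp h3
  fun_prop

/-- Integrating the majorant over positions and levels yields a weighted Fisher information. -/
theorem lintegral_majorant_le (h : HolderScore f ψ β L) (hβ : 1 ≤ β) (hL : 0 < L) {v : ℝ}
    (hv : 0 < v) :
    ∫⁻ x in {x | 0 < ψ x}, ∫⁻ t in Ico 0 (ψ x), ENNReal.ofReal (majorant f ψ β L v x t) ≤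
      ENNReal.ofReal (6 * √v * (4 * L ^ 2 / v) ^ (1 / (2 * (2 * β + 1)))) *
        ∫⁻ x in {x | 0 < ψ x},
          ENNReal.ofReal (ψ x * (ψ x * f x ^ ((β + 1) / (2 * β + 1)))) := by
  set γ := (β + 1) / (2 * β + 1) with hγ
  have h2β : 0 < 2 * β + 1 := by linarith
  have hγ0 : 0 < γ := by positivity
  have hγ1 : γ ≤ 1 := (div_le_one h2β).2 (by linarith)
  set A := 6 * √v * (4 * L ^ 2 / v) ^ (1 / (2 * (2 * β + 1))) with hA
  have hA0 : 0 ≤ A := by positivity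
  set D : Set (ℝ × ℝ) := {p | 0 ≤ p.2 ∧ p.2 < ψ p.1} with hD
  have hDm : MeasurableSet D :=
    (measurableSet_le measurable_const measurable_snd).inter
      (measurableSet_lt measurable_snd (h.measurable.comp measurable_fst))
  have hpm : MeasurableSet {x | 0 < ψ x} := measurableSet_lt measurable_const h.measurable
  set G : ℝ × ℝ → ENNReal := D.indicator fun p => ENNReal.ofReal (majorant f ψ β L v p.1 p.2)
  set R : ℝ × ℝ → ENNReal := D.indicator fun p => ENNReal.ofReal (A * (ψ p.1 * f p.1 ^ γ))
  have hGm : Measurable G := ((h.measurable_majorant v).ennreal_ofReal).indicator hDm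
  have hRm : Measurable R := by
    refine Measurable.indicator ?_ hDm
    have h1 : Measurable fun p : ℝ × ℝ => ψ p.1 := h.measurable.comp measurable_fst
    have h2 : Measurable fun p : ℝ × ℝ => f p.1 := h.continuous.measurable.comp measurable_fst
    exact (measurable_const.mul (h1.mul (h2.pow_const γ))).ennreal_ofReal
  have sec : ∀ (F : ℝ × ℝ → ENNReal) (x : ℝ),
      ∫⁻ t, D.indicator F (x, t) = ∫⁻ t in Ico 0 (ψ x), F (x, t) := by
    intro F x
    rw [← lintegral_indicator measurableSet_Ico]
    rfl
  -- At a fixed level the integral over positions is `A * f y ^ γ` at the endpoint `y`, up to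
  -- inequality. As `γ ≤ 1`, this is at most `A * f y ^ γ / γ`, which is the integral of `A ψ f ^ γ`
  -- over `{ψ > t}`. Integrating over `t` afterwards supplies the second factor `ψ`.
  have hmain : ∀ t, ∫⁻ x, G (x, t) ≤ ∫⁻ x, R (x, t) := by
    intro t
    by_cases hT : 0 ≤ t ∧ ∃ x, t < ψ x
    swap
    · have : ∀ x, G (x, t) = 0 := fun x =>
        indicator_of_notMem (fun hx : (x, t) ∈ D => hT ⟨hx.1, x, hx.2⟩) _
      simp [this]
    obtain ⟨ht, x₀, hx₀⟩ := hT
    have hS : MeasurableSet {x | t < ψ x} := measurableSet_lt measurable_const h.measurable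
    have eG : ∫⁻ x, G (x, t) = ∫⁻ x in {x | t < ψ x}, ENNReal.ofReal (majorant f ψ β L v x t) := by
      rw [← lintegral_indicator hS]
      refine lintegral_congr fun x => ?_
      simp only [G, hD, indicator, mem_ofPred_eq, ht, true_and]
    have eR : ∫⁻ x, R (x, t) = ∫⁻ x in {x | t < ψ x}, ENNReal.ofReal (A * (ψ x * f x ^ γ)) := by
      rw [← lintegral_indicator hS]
      refine lintegral_congr fun x => ?_
      simp only [R, hD, indicator, mem_ofPred_eq, ht, true_and]
    rw [eG, eR]
    set y := edge ψ t with hy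
    set w := minWidth β L v (f y) with hw
    have hfy := h.pos y
    have hw0 : 0 < w := minWidth_pos hL hv hfy
    have hpow : √(v * f y) * (6 * w ^ (-1 / 2 : ℝ)) = A * f y ^ γ := by
      have e1 : w ^ (-1 / 2 : ℝ) = (4 * L ^ 2 / v) ^ (1 / (2 * (2 * β + 1))) *
          f y ^ (1 / (2 * (2 * β + 1))) := by
        rw [hw, minWidth, ← Real.rpow_mul (by positivity), ← Real.mul_rpow (by positivity) hfy.le]
        rw [show 1 / (2 * β + 1) * (-1 / 2) = -(1 / (2 * (2 * β + 1))) by field_simp,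
          Real.rpow_neg (by positivity), ← Real.inv_rpow (by positivity)]
        congr 1; field_simp
      have e2 : f y ^ γ = √(f y) * f y ^ (1 / (2 * (2 * β + 1))) := by
        rw [Real.sqrt_eq_rpow, ← Real.rpow_add hfy]
        congr 1; rw [hγ]; field_simp; ring
      rw [e1, e2, Real.sqrt_mul hv.le, hA]; ring
    calc ∫⁻ x in {x | t < ψ x}, ENNReal.ofReal (majorant f ψ β L v x t)
        ≤ ∫⁻ x in Iic y, ENNReal.ofReal (majorant f ψ β L v x t) :=
          lintegral_mono_set fun x hx => h.le_edge ht hx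
      _ = ENNReal.ofReal √(v * f y) *
            ∫⁻ x in Iic y, ENNReal.ofReal (((y - x + w) / 2) ^ (-3 / 2 : ℝ)) := by
          rw [← lintegral_const_mul' _ _ ENNReal.ofReal_ne_top]
          simp only [majorant, ENNReal.ofReal_mul (Real.sqrt_nonneg _), ← hy, ← hw]
      _ ≤ ENNReal.ofReal √(v * f y) * ENNReal.ofReal (6 * w ^ (-1 / 2 : ℝ)) := by
          gcongr; exact lintegral_rpow_shift y hw0
      _ = ENNReal.ofReal (A * f y ^ γ) := by
          rw [← ENNReal.ofReal_mul (Real.sqrt_nonneg _), hpow]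
      _ ≤ ENNReal.ofReal (A * (f y ^ γ / γ)) := by
          gcongr
          exact le_div_self (Real.rpow_nonneg hfy.le _) hγ0 hγ1
      _ = ENNReal.ofReal A * ∫⁻ x in Iio y, ENNReal.ofReal (ψ x * f x ^ γ) := by
          rw [h.setLIntegral_Iio_score hγ0 fun x hx => ht.trans_lt (h.lt_of_lt_edge ht hx₀ hx),
            ENNReal.ofReal_mul hA0]
      _ ≤ ENNReal.ofReal A * ∫⁻ x in {x | t < ψ x}, ENNReal.ofReal (ψ x * f x ^ γ) := by
          gcongr ENNReal.ofReal A * ?_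
          exact lintegral_mono_set fun x hx => h.lt_of_lt_edge ht hx₀ hx
      _ = _ := by
          rw [← lintegral_const_mul' _ _ ENNReal.ofReal_ne_top]
          simp only [ENNReal.ofReal_mul hA0]
  calc ∫⁻ x in {x | 0 < ψ x}, ∫⁻ t in Ico 0 (ψ x), ENNReal.ofReal (majorant f ψ β L v x t)
      ≤ ∫⁻ x, ∫⁻ t in Ico 0 (ψ x), ENNReal.ofReal (majorant f ψ β L v x t) :=
        setLIntegral_le_lintegral _ _
    _ = ∫⁻ x, ∫⁻ t, G (x, t) := by simp only [G, sec]
    _ = ∫⁻ t, ∫⁻ x, G (x, t) := lintegral_lintegral_swap hGm.aemeasurable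
    _ ≤ ∫⁻ t, ∫⁻ x, R (x, t) := lintegral_mono hmain
    _ = ∫⁻ x, ∫⁻ t, R (x, t) := (lintegral_lintegral_swap (f := fun x t => R (x, t)) hRm.aemeasurable).symm
    _ = ∫⁻ x, {x | 0 < ψ x}.indicator
          (fun x => ENNReal.ofReal A * ENNReal.ofReal (ψ x * (ψ x * f x ^ γ))) x := by
        refine lintegral_congr fun x => ?_
        simp only [R, sec, setLIntegral_const, Real.volume_Ico, sub_zero]
        by_cases hx : 0 < ψ x
        · rw [indicator_of_mem (show x ∈ {x | 0 < ψ x} from hx),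
            ENNReal.ofReal_mul hA0, ENNReal.ofReal_mul hx.le (q := ψ x * f x ^ γ), mul_assoc,
            mul_comm (ENNReal.ofReal (ψ x))]
        · rw [indicator_of_notMem (show x ∉ {x | 0 < ψ x} from hx),
            ENNReal.ofReal_of_nonpos (not_lt.1 hx), mul_zero]
    _ = _ := by
        rw [lintegral_indicator hpm, lintegral_const_mul' _ _ ENNReal.ofReal_ne_top]

/-- The loss to the left of the mode of an error that is controlled at every bandwidth. -/
theorem loss_left_le (h : HolderScore f ψ β L) (hβ : 1 ≤ β) (hβ2 : β ≤ 2) (hL : 0 < L)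
    {ε c₁ c₂ s K : ℝ} (hε : 0 < ε) (hc₁ : 1 ≤ c₁) (hc₂ : 1 ≤ c₂) (hs : 0 < s) (hK : 0 ≤ K)
    (hF : ∫⁻ x in {x | 0 < ψ x}, ENNReal.ofReal (ψ x ^ 2 * f x) ≤ ENNReal.ofReal (K * s))
    {d : ℝ → ℝ} (hd0 : ∀ x, 0 < ψ x → 0 ≤ d x) (hd : ∀ x, 0 < ψ x → d x ≤ ψ x)
    (hband : ∀ x, 0 < ψ x → ∀ b, 0 < b → 2 * b * ψ x ≤ 1 → 0 ≤ ψ (x + 2 * b) →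
      c₁ * ε ≤ b * f x → d x ≤ ψ x - ψ (x + 2 * b) + c₂ * √(ε / (f x * b ^ 3))) :
    ∫⁻ x in {x | 0 < ψ x}, ENNReal.ofReal (d x ^ 2 * f x) ≤
      ENNReal.ofReal (12 * (L ^ (2 / β) * ε * logPlus (1 / ε))) +
      (ENNReal.ofReal ((32 * c₂ ^ 2 + 3 * c₁ ^ 2) * ε *
        (72 * (L ^ (2 / β) * logPlus (1 / ε) ^ (3 - 2 / β)))) +
      2 * ENNReal.ofReal (6 * √(32 * c₂ ^ 2 * ε) *
        (4 * L ^ 2 / (32 * c₂ ^ 2 * ε)) ^ (1 / (2 * (2 * β + 1))) * ((80 + K) * (s *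
        (s / (L ^ (1 / β) * logPlus (L ^ (2 / β) / s) ^ ((β - 1) / β))) ^
          ((β + 1) / (2 * β + 1) - 1))))) := by
  have h2β : 0 < 2 * β + 1 := by linarith
  set u := ε * L ^ (1 / β) with hu
  have hun : {x | 0 < ψ x} = {x | 0 < ψ x ∧ f x < u} ∪ {x | 0 < ψ x ∧ u ≤ f x} := by
    ext x
    simp only [mem_ofPred_eq, mem_union, ← and_or_left, lt_or_ge, and_true]
  -- In the far tail only the trivial bound `d ≤ ψ` is used.
  have hlow : ∫⁻ x in {x | 0 < ψ x ∧ f x < u}, ENNReal.ofReal (d x ^ 2 * f x) ≤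
      ENNReal.ofReal (12 * (L ^ (2 / β) * ε * logPlus (1 / ε))) := by
    refine le_trans (setLIntegral_mono' (h.measurableSet_sublevel u) fun x hx => ?_)
      (h.fisher_sublevel_le hβ hL hε)
    have h0 := hd0 x hx.1
    have h1 := hd x hx.1
    have h2 := h.pos x
    exact ENNReal.ofReal_le_ofReal (by gcongr)
  have hK0 : 0 ≤ (32 * c₂ ^ 2 + 3 * c₁ ^ 2) * ε := by positivity
  have hcube := setLIntegral_le_const_mul (h.measurableSet_superlevel u)
    (g := fun x => (32 * c₂ ^ 2 + 3 * c₁ ^ 2) * ε * ψ x ^ 3) hK0 (fun x _ => le_rfl)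
    (h.cube_superlevel_le hβ hL hε)
  have hγ : 3 / 5 ≤ (β + 1) / (2 * β + 1) := by
    rw [div_le_div_iff₀ (by norm_num) h2β]; linarith
  have hγ1 : (β + 1) / (2 * β + 1) ≤ 1 := (div_le_one h2β).2 (by linarith)
  have hw := h.weighted_fisher_le hβ hL hγ hγ1 hs hK hF
  have hmaj := h.lintegral_majorant_le hβ hL (v := 32 * c₂ ^ 2 * ε) (by positivity)
  nth_rw 1 [hun]
  refine (lintegral_union_le _ _ _).trans (add_le_add hlow ?_)
  calc ∫⁻ x in {x | 0 < ψ x ∧ u ≤ f x}, ENNReal.ofReal (d x ^ 2 * f x)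
      ≤ ∫⁻ x in {x | 0 < ψ x ∧ u ≤ f x},
          (ENNReal.ofReal ((32 * c₂ ^ 2 + 3 * c₁ ^ 2) * ε * ψ x ^ 3) +
          2 * ∫⁻ t in Ico 0 (ψ x), ENNReal.ofReal (majorant f ψ β L (32 * c₂ ^ 2 * ε) x t)) :=
        setLIntegral_mono' (h.measurableSet_superlevel u) fun x hx =>
          h.sq_error_le hβ hL hε hc₁ hc₂ (hd0 x hx.1) (hd x hx.1) hx.1 (hband x hx.1)
    _ = (∫⁻ x in {x | 0 < ψ x ∧ u ≤ f x},
          ENNReal.ofReal ((32 * c₂ ^ 2 + 3 * c₁ ^ 2) * ε * ψ x ^ 3)) +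
        2 * ∫⁻ x in {x | 0 < ψ x ∧ u ≤ f x}, ∫⁻ t in Ico 0 (ψ x),
          ENNReal.ofReal (majorant f ψ β L (32 * c₂ ^ 2 * ε) x t) := by
        rw [lintegral_add_left, lintegral_const_mul' _ _ (by simp)]
        have := h.measurable
        fun_prop
    _ ≤ _ := by
        refine add_le_add hcube ?_
        gcongr 2 * ?_
        refine (lintegral_mono_set fun x hx => hx.1).trans (hmaj.trans ?_)
        rw [ENNReal.ofReal_mul (p := 6 * √(32 * c₂ ^ 2 * ε) * _) (by positivity)]
        gcongr

end HolderScore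

end ScoreEstimation

namespace ScoreEstimation

open Set Filter Topology

/-! ### A Bernstein-type lower bound for the binary relative entropy -/

/-- Convexity: `1 / (p (1 - p))` lies above its tangent at `s`. -/
theorem inv_mul_one_sub_tangent {p s : ℝ} (hp : 0 < p) (hp1 : p < 1) (hs : 0 < s) (hs1 : s < 1) :
    0 ≤ 1 / (p * (1 - p)) - 1 / (s * (1 - s)) + (p - s) * (1 - 2 * s) / (s * (1 - s)) ^ 2 := by
  have h1 : 0 < 1 - p := by linarith
  have h2 : 0 < 1 - s := by linarith
  have e : 1 / (p * (1 - p)) - 1 / (s * (1 - s)) + (p - s) * (1 - 2 * s) / (s * (1 - s)) ^ 2 =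
      (p - s) ^ 2 * ((1 - s) ^ 2 - p * (1 - 2 * s)) / (p * (1 - p) * (s * (1 - s)) ^ 2) := by
    field_simp; ring
  rw [e]
  refine div_nonneg (mul_nonneg (sq_nonneg _) ?_) (by positivity)
  rcases le_total s (1 / 2) with h | h
  · nlinarith [sq_nonneg s]
  · nlinarith [sq_nonneg (1 - s)]

/-- With `s = (q + 2 p) / 3` the denominator is `9 s (1 - s)`. This `s` makes the derivative equal
to `p - q` times the convexity defect at `s`, hence of the sign of `p - q`. -/
theorem hasDerivAt_entropy_gap {q p : ℝ} (hp : 0 < p) (hp1 : p < 1) (hs : 0 < q + 2 * p)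
    (hs1 : q + 2 * p < 3) :
    HasDerivAt (fun p => -q * Real.log p - (1 - q) * Real.log (1 - p) -
      9 / 2 * ((p - q) ^ 2 / ((q + 2 * p) * (3 - (q + 2 * p)))))
      ((p - q) * (1 / (p * (1 - p)) - 1 / ((q + 2 * p) / 3 * (1 - (q + 2 * p) / 3)) +
        (p - (q + 2 * p) / 3) * (1 - 2 * ((q + 2 * p) / 3)) /
          ((q + 2 * p) / 3 * (1 - (q + 2 * p) / 3)) ^ 2)) p := by
  have h1 : 0 < 1 - p := by linarith
  have h2 : 0 < 3 - (q + 2 * p) := by linarith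
  have d1 : HasDerivAt (fun p : ℝ => -q * Real.log p) (-q * p⁻¹) p :=
    (Real.hasDerivAt_log hp.ne').const_mul _
  have d2 : HasDerivAt (fun p : ℝ => (1 - q) * Real.log (1 - p)) ((1 - q) * (-1 / (1 - p))) p :=
    (((hasDerivAt_id p).const_sub 1).log h1.ne').const_mul _
  have d3 : HasDerivAt (fun p : ℝ => (p - q) ^ 2) (2 * (p - q)) p := by
    have := ((hasDerivAt_id p).sub_const q).fun_pow 2
    simpa using this
  have d0 : HasDerivAt (fun p : ℝ => q + 2 * p) 2 p := by
    simpa using ((hasDerivAt_id p).const_mul 2).const_add q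
  have d4 : HasDerivAt (fun p : ℝ => (q + 2 * p) * (3 - (q + 2 * p)))
      (2 * (3 - (q + 2 * p)) + (q + 2 * p) * -2) p := d0.fun_mul (d0.const_sub 3)
  have d5 := (d3.fun_div d4 (mul_pos hs h2).ne').const_mul (9 / 2)
  refine ((d1.fun_sub d2).fun_sub d5).congr_deriv ?_
  have e1 : -q * p⁻¹ - (1 - q) * (-1 / (1 - p)) = (p - q) * (1 / (p * (1 - p))) := by
    have := hp.ne'
    have := h1.ne'
    field_simp; ring
  have e2 : ∀ A B : ℝ, A ≠ 0 → B ≠ 0 → B = 3 - A → q = A - 2 * p →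
      9 / 2 * ((2 * (p - q) * (A * B) - (p - q) ^ 2 * (2 * B + A * -2)) / (A * B) ^ 2) =
      (p - q) * (1 / (A / 3 * (B / 3)) -
        (p - A / 3) * (1 - 2 * (A / 3)) / (A / 3 * (B / 3)) ^ 2) := by
    intro A B hA hB hBA hqA
    rw [hqA]
    field_simp
    rw [hBA]
    ring
  have e3 : 1 - (q + 2 * p) / 3 = (3 - (q + 2 * p)) / 3 := by ring
  rw [e1, e2 _ _ hs.ne' h2.ne' rfl (by ring), e3]
  ring

theorem entropy_gap {q p : ℝ} (hq : 0 < q) (hq1 : q < 1) (hp : 0 < p) (hp1 : p < 1) :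
    9 / 2 * ((p - q) ^ 2 / ((q + 2 * p) * (3 - (q + 2 * p)))) ≤
      (-q * Real.log p - (1 - q) * Real.log (1 - p)) -
        (-q * Real.log q - (1 - q) * Real.log (1 - q)) := by
  set G : ℝ → ℝ := fun p => -q * Real.log p - (1 - q) * Real.log (1 - p) -
      9 / 2 * ((p - q) ^ 2 / ((q + 2 * p) * (3 - (q + 2 * p)))) with hG
  have hd : ∀ x, 0 < x → x < 1 → HasDerivAt G _ x := fun x hx hx1 =>
    hasDerivAt_entropy_gap (q := q) hx hx1 (by linarith) (by linarith)
  have hbr : ∀ x, 0 < x → x < 1 → 0 ≤ 1 / (x * (1 - x)) -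
      1 / ((q + 2 * x) / 3 * (1 - (q + 2 * x) / 3)) +
        (x - (q + 2 * x) / 3) * (1 - 2 * ((q + 2 * x) / 3)) /
          ((q + 2 * x) / 3 * (1 - (q + 2 * x) / 3)) ^ 2 := fun x hx hx1 =>
    inv_mul_one_sub_tangent hx hx1 (by linarith) (by linarith)
  have key : G q ≤ G p := by
    rcases le_total q p with h | h
    · refine monotoneOn_of_deriv_nonneg (convex_Icc q p) ?_ ?_ ?_ ⟨le_rfl, h⟩ ⟨h, le_rfl⟩ h
      · exact fun x hx =>
          (hd x (hq.trans_le hx.1) (hx.2.trans_lt hp1)).continuousAt.continuousWithinAt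
      · intro x hx
        rw [interior_Icc] at hx
        exact (hd x (hq.trans hx.1) (hx.2.trans hp1)).differentiableAt.differentiableWithinAt
      · intro x hx
        rw [interior_Icc] at hx
        rw [(hd x (hq.trans hx.1) (hx.2.trans hp1)).deriv]
        exact mul_nonneg (by linarith [hx.1]) (hbr x (hq.trans hx.1) (hx.2.trans hp1))
    · refine antitoneOn_of_deriv_nonpos (convex_Icc p q) ?_ ?_ ?_ ⟨le_rfl, h⟩ ⟨h, le_rfl⟩ h
      · exact fun x hx =>
          (hd x (hp.trans_le hx.1) (hx.2.trans_lt hq1)).continuousAt.continuousWithinAt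
      · intro x hx
        rw [interior_Icc] at hx
        exact (hd x (hp.trans hx.1) (hx.2.trans hq1)).differentiableAt.differentiableWithinAt
      · intro x hx
        rw [interior_Icc] at hx
        rw [(hd x (hp.trans hx.1) (hx.2.trans hq1)).deriv]
        exact mul_nonpos_of_nonpos_of_nonneg (by linarith [hx.2])
          (hbr x (hp.trans hx.1) (hx.2.trans hq1))
  simp only [hG, sub_self] at key
  norm_num at key
  linarith

/-- The case of no successes, as a limit from `q > 0`. -/
theorem entropy_gap_zero {p : ℝ} (hp : 0 < p) (hp1 : p < 1) :
    9 / 2 * (p ^ 2 / ((2 * p) * (3 - 2 * p))) ≤ -Real.log (1 - p) := by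
  have hlim : Tendsto (fun q : ℝ => (-q * Real.log p - (1 - q) * Real.log (1 - p)) -
        (-(q * Real.log q) - (1 - q) * Real.log (1 - q))) (𝓝[>] 0)
      (𝓝 ((-0 * Real.log p - (1 - 0) * Real.log (1 - p)) -
        (-((0 : ℝ) * Real.log 0) - (1 - 0) * Real.log (1 - 0)))) := by
    refine ContinuousAt.continuousWithinAt ?_
    have h1 : ContinuousAt (fun q : ℝ => q * Real.log q) 0 :=
      Real.continuous_mul_log.continuousAt
    have h2 : ContinuousAt (fun q : ℝ => Real.log (1 - q)) 0 :=
      ContinuousAt.log (by fun_prop) (by norm_num)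
    fun_prop
  have hlim2 : Tendsto (fun q : ℝ => 9 / 2 * ((p - q) ^ 2 / ((q + 2 * p) * (3 - (q + 2 * p)))))
      (𝓝[>] 0) (𝓝 (9 / 2 * ((p - 0) ^ 2 / ((0 + 2 * p) * (3 - (0 + 2 * p)))))) := by
    refine ContinuousAt.continuousWithinAt ?_
    refine ContinuousAt.mul (by fun_prop) (ContinuousAt.div (by fun_prop) (by fun_prop) ?_)
    have : 0 < 3 - (0 + 2 * p) := by linarith
    positivity
  have h := le_of_tendsto_of_tendsto hlim2 hlim (by
    filter_upwards [Ioo_mem_nhdsGT (show (0 : ℝ) < 1 by norm_num)] with q hq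
    have := entropy_gap hq.1 hq.2 hp hp1
    simpa [neg_mul] using this)
  simpa using h

/-- The exponential bound obtained from Chernoff's method, for `m` successes in `n` trials. -/
theorem chernoff_factor_le {n m : ℕ} (hmn : m < n) {g ε : ℝ} (hg : 0 < g) (hg1 : g < 1)
    (h : ε * ((m / n + 2 * g) * (3 - (m / n + 2 * g))) ≤ 9 / 2 * (g - m / n) ^ 2) :
    (g / (m / n : ℝ)) ^ m * ((1 - g) / (1 - m / n)) ^ (n - m) ≤ Real.exp (-(n * ε)) := by
  have hn : (0 : ℝ) < n := by exact_mod_cast (Nat.zero_le m).trans_lt hmn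
  have hmn' : (m : ℝ) < n := by exact_mod_cast hmn
  set q : ℝ := m / n with hq
  have hq1 : q < 1 := (div_lt_one hn).2 hmn'
  have hq0 : 0 ≤ q := by positivity
  have hg1' : 0 < 1 - g := by linarith
  have hq1' : 0 < 1 - q := by linarith
  have hden : 0 < (q + 2 * g) * (3 - (q + 2 * g)) := mul_pos (by linarith) (by linarith)
  have h' : ε ≤ 9 / 2 * ((g - q) ^ 2 / ((q + 2 * g) * (3 - (q + 2 * g)))) := by
    rw [← mul_div_assoc, le_div_iff₀ hden]; exact h
  have hnm : ((n - m : ℕ) : ℝ) = n * (1 - q) := by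
    rw [Nat.cast_sub hmn.le, hq]; field_simp
  have hm : (m : ℝ) = n * q := by rw [hq]; field_simp
  rcases Nat.eq_zero_or_pos m with hm0 | hm0
  · have hq00 : q = 0 := by rw [hq, hm0]; simp
    subst hm0
    have h1 := entropy_gap_zero hg hg1
    rw [hq00] at h'
    simp only [sub_zero, zero_add] at h'
    rw [pow_zero, one_mul, hq00, sub_zero, div_one, Nat.sub_zero]
    rw [← Real.exp_log hg1', ← Real.exp_nat_mul]
    refine Real.exp_le_exp.2 ?_
    nlinarith
  · have hq0 : 0 < q := by
      have : (0 : ℝ) < m := by exact_mod_cast hm0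
      positivity
    have h1 := entropy_gap hq0 hq1 hg hg1
    have e1 : (g / q) ^ m = Real.exp (m * (Real.log g - Real.log q)) := by
      rw [Real.exp_nat_mul, ← Real.log_div hg.ne' hq0.ne', Real.exp_log (by positivity)]
    have e2 : ((1 - g) / (1 - q)) ^ (n - m) =
        Real.exp ((n - m : ℕ) * (Real.log (1 - g) - Real.log (1 - q))) := by
      rw [Real.exp_nat_mul, ← Real.log_div hg1'.ne' hq1'.ne', Real.exp_log (by positivity)]
    rw [e1, e2, ← Real.exp_add, hnm, hm]
    refine Real.exp_le_exp.2 ?_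
    nlinarith

/-- The confidence limits for a binomial proportion with observed frequency `q`:
`σ = 1` for the upper and `σ = -1` for the lower one. -/
noncomputable def propLimit (e q σ : ℝ) : ℝ :=
  ((1 - 2 * e) * q + 3 * e + σ * (3 * √(e * q * (1 - q) + e ^ 2))) / (1 + 4 * e)

/-- The limits are the two roots of the quadratic equation stating equality in the hypothesis of
`chernoff_factor_le`; this is where `e = 2 ε / 9` originates. -/
theorem propLimit_spec {e q σ : ℝ} (he : 0 < e) (hq : 0 ≤ q) (hq1 : q ≤ 1) (hσ : σ ^ 2 = 1) :
    2 * e * ((q + 2 * propLimit e q σ) * (3 - (q + 2 * propLimit e q σ))) =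
      2 * (propLimit e q σ - q) ^ 2 := by
  have hS : √(e * q * (1 - q) + e ^ 2) ^ 2 = e * q * (1 - q) + e ^ 2 :=
    Real.sq_sqrt (by have : 0 ≤ 1 - q := by linarith
                     positivity)
  unfold propLimit
  set S := √(e * q * (1 - q) + e ^ 2)
  have : 0 < 1 + 4 * e := by linarith
  field_simp
  have : σ ^ 2 * S ^ 2 = e * q * (1 - q) + e ^ 2 := by rw [hS, hσ, one_mul]
  ring_nf at this ⊢
  linear_combination (-9 - 36 * e) * this

theorem propLimit_factor_le {n m : ℕ} (hmn : m < n) {ε σ : ℝ} (hε : 0 < ε) (hσ : σ ^ 2 = 1)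
    (hg : 0 < propLimit (2 * ε / 9) (m / n) σ) (hg1 : propLimit (2 * ε / 9) (m / n) σ < 1) :
    (propLimit (2 * ε / 9) (m / n) σ / (m / n : ℝ)) ^ m *
      ((1 - propLimit (2 * ε / 9) (m / n) σ) / (1 - m / n)) ^ (n - m) ≤ Real.exp (-(n * ε)) := by
  have hn : (0 : ℝ) < n := by exact_mod_cast (Nat.zero_le m).trans_lt hmn
  have hmn' : (m : ℝ) < n := by exact_mod_cast hmn
  refine chernoff_factor_le hmn hg hg1 ?_
  have := propLimit_spec (e := 2 * ε / 9) (q := m / n) (by positivity) (by positivity)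
    ((div_le_one hn).2 hmn'.le) hσ
  linarith

theorem lt_propLimit_upper {e q : ℝ} (he : 0 < e) (hq : 0 ≤ q) (hq1 : q < 1) :
    q < propLimit e q 1 := by
  have hS : e ≤ √(e * q * (1 - q) + e ^ 2) := by
    refine Real.le_sqrt_of_sq_le ?_
    have : 0 ≤ e * q * (1 - q) := mul_nonneg (by positivity) (by linarith)
    linarith
  unfold propLimit
  rw [lt_div_iff₀ (by linarith)]
  have : 0 < e * (1 - q) := mul_pos he (by linarith)
  nlinarith

theorem propLimit_lower_le {e q : ℝ} (he : 0 < e) (hq : 0 ≤ q) (hq1 : q ≤ 1) :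
    propLimit e q (-1) ≤ q := by
  unfold propLimit
  rw [div_le_iff₀ (by linarith)]
  rcases le_total (3 * e * (1 - 2 * q)) 0 with h | h
  · have := Real.sqrt_nonneg (e * q * (1 - q) + e ^ 2)
    nlinarith
  · have hS : e * (1 - 2 * q) ≤ √(e * q * (1 - q) + e ^ 2) := by
      refine Real.le_sqrt_of_sq_le ?_
      have : 0 ≤ q * (1 - q) := mul_nonneg hq (by linarith)
      have : 0 ≤ e * (q * (1 - q)) := by positivity
      have : 0 ≤ e ^ 2 * (q * (1 - q)) := by positivity
      nlinarith
    nlinarith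

end ScoreEstimation

namespace ScoreEstimation

open Set Filter Topology

/-! ### Chernoff bounds under a product measure -/

/-- Conditioning on the observation `X a`, from which the random interval starts. -/
theorem lintegral_pi_succAbove {n : ℕ} (μ : Measure ℝ) [IsProbabilityMeasure μ] (a : Fin (n + 1))
    {H : ℝ → ENNReal} {k : ℝ → ℝ → ENNReal} (hH : Measurable H)
    (hk : Measurable (Function.uncurry k)) :
    ∫⁻ X, H (X a) * ∏ j, k (X a) (X (a.succAbove j)) ∂(Measure.pi fun _ : Fin (n + 1) => μ) =
      ∫⁻ x, H x * ∫⁻ Y, ∏ j, k x (Y j) ∂(Measure.pi fun _ : Fin n => μ) ∂μ := by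
  have hmp := measurePreserving_piFinSuccAbove (fun _ : Fin (n + 1) => μ) a
  have hm : Measurable fun p : ℝ × (Fin n → ℝ) => H p.1 * ∏ j, k p.1 (p.2 j) := by
    refine (hH.comp measurable_fst).mul (Finset.measurable_prod _ fun j _ => ?_)
    exact hk.comp (measurable_fst.prodMk ((measurable_pi_apply j).comp measurable_snd))
  have h1 := hmp.lintegral_comp hm
  rw [lintegral_prod _ hm.aemeasurable] at h1
  refine Eq.trans ?_ (h1.trans (lintegral_congr fun x => ?_))
  · rfl
  · refine lintegral_const_mul (H x) (Finset.measurable_prod _ fun j _ => ?_)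
    exact hk.comp (measurable_const.prodMk (measurable_pi_apply j))

theorem lintegral_pi_prod (μ : Measure ℝ) [IsProbabilityMeasure μ] {k : ℝ → ENNReal}
    (hk : Measurable k) (n : ℕ) :
    ∫⁻ X, ∏ i, k (X i) ∂(Measure.pi fun _ : Fin n => μ) = (∫⁻ x, k x ∂μ) ^ n := by
  induction n with
  | zero => simp
  | succ n ih =>
    have h := lintegral_pi_succAbove (n := n) μ 0 hk (k := fun _ u => k u) (hk.comp measurable_snd)
    simp only [Fin.prod_univ_succAbove _ (0 : Fin (n + 1))]
    rw [h, ih, lintegral_mul_const _ hk, pow_succ, mul_comm]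

theorem lintegral_weight {μ : Measure ℝ} [IsProbabilityMeasure μ] {A : Set ℝ} (hA : MeasurableSet A)
    {g t : ℝ} (hg0 : 0 ≤ g) (hg1 : g ≤ 1) (ht : 0 ≤ t) (hμ : μ A = ENNReal.ofReal g) :
    ∫⁻ u, A.indicator (fun _ => ENNReal.ofReal t) u + Aᶜ.indicator (fun _ => 1) u ∂μ =
      ENNReal.ofReal (1 - g + t * g) := by
  rw [lintegral_add_left (measurable_const.indicator hA), lintegral_indicator_const hA,
    lintegral_indicator_const hA.compl, prob_compl_eq_one_sub hA, hμ, one_mul,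
    ← ENNReal.ofReal_one, ← ENNReal.ofReal_sub _ hg0, ← ENNReal.ofReal_mul ht,
    ← ENNReal.ofReal_add (by positivity) (by linarith)]
  congr 1; ring

theorem weight_eq {A : Set ℝ} [DecidablePred (· ∈ A)] (t u : ℝ) :
    A.indicator (fun _ => ENNReal.ofReal t) u + Aᶜ.indicator (fun _ => 1) u =
      ENNReal.ofReal (if u ∈ A then t else 1) := by
  by_cases h : u ∈ A <;> simp [h]

-- Markov's inequality for `t` raised to the number of observations in `A`. Taking `t ≤ 1` controls
-- small counts and `t ≥ 1` large ones.
open scoped Classical in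
theorem measure_pi_prod_ge_le {n : ℕ} {μ : Measure ℝ} [IsProbabilityMeasure μ] {A : Set ℝ}
    (hA : MeasurableSet A) {g t τ : ℝ} (hg0 : 0 ≤ g) (hg1 : g ≤ 1) (ht : 0 ≤ t) (hτ : 0 < τ)
    (hμ : μ A = ENNReal.ofReal g) :
    (Measure.pi fun _ : Fin n => μ) {X | τ ≤ ∏ i, if X i ∈ A then t else 1} ≤
      ENNReal.ofReal ((1 - g + t * g) ^ n / τ) := by
  set k : ℝ → ENNReal := fun u =>
    A.indicator (fun _ => ENNReal.ofReal t) u + Aᶜ.indicator (fun _ => 1) u with hk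
  have hkm : Measurable k :=
    (measurable_const.indicator hA).add (measurable_const.indicator hA.compl)
  have hbase : 0 ≤ 1 - g + t * g := by have := mul_nonneg ht hg0; linarith
  have h1 : ∫⁻ X, ∏ i, k (X i) ∂(Measure.pi fun _ : Fin n => μ) =
      ENNReal.ofReal ((1 - g + t * g) ^ n) := by
    rw [lintegral_pi_prod μ hkm, lintegral_weight hA hg0 hg1 ht hμ, ENNReal.ofReal_pow hbase]
  have h2 : {X : Fin n → ℝ | τ ≤ ∏ i, if X i ∈ A then t else 1} ⊆
      {X | ENNReal.ofReal τ ≤ ∏ i, k (X i)} := by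
    intro X hX
    simp only [mem_ofPred_eq, hk, weight_eq] at hX ⊢
    rw [← ENNReal.ofReal_prod_of_nonneg fun i _ => by split_ifs <;> linarith]
    exact ENNReal.ofReal_le_ofReal hX
  refine (measure_mono h2).trans ?_
  rw [ENNReal.ofReal_div_of_pos hτ, ← h1]
  exact meas_ge_le_lintegral_div (Finset.measurable_prod _ fun i _ =>
    hkm.comp (measurable_pi_apply i)).aemeasurable (by simpa using hτ) ENNReal.ofReal_ne_top

-- The same bound for an interval attached to `X a`: given `X a ∈ B`, the others fall into it
-- independently with probability `g`. The saved factor `1 - g` matters for the union bound.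
open scoped Classical in
theorem measure_pi_lead_prod_ge_le {n : ℕ} {μ : Measure ℝ} [IsProbabilityMeasure μ] {B : Set ℝ}
    {R : Set (ℝ × ℝ)} (hB : MeasurableSet B) (hR : MeasurableSet R) {g t τ : ℝ} (hg0 : 0 ≤ g)
    (hg1 : g ≤ 1) (ht : 0 ≤ t) (hτ : 0 < τ) (hμB : μ B = ENNReal.ofReal (1 - g))
    (hμR : ∀ x ∈ B, μ {u | (x, u) ∈ R} = ENNReal.ofReal g) (a : Fin (n + 1)) :
    (Measure.pi fun _ : Fin (n + 1) => μ)
      {X | X a ∈ B ∧ τ ≤ ∏ j, if (X a, X (a.succAbove j)) ∈ R then t else 1} ≤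
      ENNReal.ofReal ((1 - g) * (1 - g + t * g) ^ n / τ) := by
  set k : ℝ → ℝ → ENNReal := fun x u => {u | (x, u) ∈ R}.indicator (fun _ => ENNReal.ofReal t) u +
    {u | (x, u) ∈ R}ᶜ.indicator (fun _ => 1) u with hk
  have hkm : Measurable (Function.uncurry k) := by
    have h1 : Measurable (R.indicator fun _ => ENNReal.ofReal t) := measurable_const.indicator hR
    have h2 : Measurable (Rᶜ.indicator fun _ => (1 : ENNReal)) :=
      measurable_const.indicator hR.compl
    exact h1.add h2
  have hbase : 0 ≤ 1 - g + t * g := by have := mul_nonneg ht hg0; linarith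
  have h1 : ∫⁻ X, B.indicator 1 (X a) * ∏ j, k (X a) (X (a.succAbove j))
      ∂(Measure.pi fun _ : Fin (n + 1) => μ) =
      ENNReal.ofReal ((1 - g) * (1 - g + t * g) ^ n) := by
    rw [lintegral_pi_succAbove μ a (measurable_one.indicator hB) hkm]
    have : ∀ x, B.indicator 1 x * ∫⁻ Y, ∏ j, k x (Y j) ∂(Measure.pi fun _ : Fin n => μ) =
        B.indicator (fun _ => ENNReal.ofReal ((1 - g + t * g) ^ n)) x := by
      intro x
      by_cases hx : x ∈ B
      · have h3 := lintegral_weight (measurable_prodMk_left hR) hg0 hg1 ht (hμR x hx)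
        have h4 := lintegral_pi_prod μ (k := k x)
          (hkm.comp (measurable_const.prodMk measurable_id)) n
        rw [indicator_of_mem hx, indicator_of_mem hx, Pi.one_apply, one_mul, h4,
          ENNReal.ofReal_pow hbase, ← h3]
        rfl
      · rw [indicator_of_notMem hx, indicator_of_notMem hx, zero_mul]
    rw [lintegral_congr this, lintegral_indicator_const hB, hμB,
      ← ENNReal.ofReal_mul (by positivity), mul_comm]
  have h2 : {X : Fin (n + 1) → ℝ | X a ∈ B ∧
      τ ≤ ∏ j, if (X a, X (a.succAbove j)) ∈ R then t else 1} ⊆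
      {X | ENNReal.ofReal τ ≤ B.indicator 1 (X a) * ∏ j, k (X a) (X (a.succAbove j))} := by
    rintro X ⟨hXa, hX⟩
    have e : ∀ j, k (X a) (X (a.succAbove j)) =
        ENNReal.ofReal (if (X a, X (a.succAbove j)) ∈ R then t else 1) := fun j => weight_eq t _
    simp only [mem_ofPred_eq, e, indicator_of_mem hXa, Pi.one_apply, one_mul]
    rw [← ENNReal.ofReal_prod_of_nonneg fun i _ => by split_ifs <;> linarith]
    exact ENNReal.ofReal_le_ofReal hX
  refine (measure_mono h2).trans ?_
  rw [ENNReal.ofReal_div_of_pos hτ, ← h1]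
  refine meas_ge_le_lintegral_div (Measurable.aemeasurable ?_) (by simpa using hτ)
    ENNReal.ofReal_ne_top
  refine ((measurable_one.indicator hB).comp (measurable_pi_apply a)).mul
    (Finset.measurable_prod _ fun j _ => ?_)
  have h3 : Measurable fun X : Fin (n + 1) → ℝ => (X a, X (a.succAbove j)) :=
    (measurable_pi_apply a).prodMk (measurable_pi_apply (a.succAbove j))
  exact hkm.comp h3

/-! ### Distribution functions without atoms or gaps -/

/-- A probability law on `ℝ` without atoms whose support is the whole line. -/
class FullLaw (μ : Measure ℝ) : Prop extends IsProbabilityMeasure μ, NullSingletonClass μ where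
  pos : ∀ a b, a < b → 0 < μ (Ioc a b)

namespace FullLaw

open ProbabilityTheory

variable (μ : Measure ℝ) [FullLaw μ]

theorem measure_Ioc (a b : ℝ) : μ (Ioc a b) = ENNReal.ofReal (cdf μ b - cdf μ a) := by
  conv_lhs => rw [← measure_cdf μ]
  exact StieltjesFunction.measure_Ioc _ a b

theorem strictMono_cdf : StrictMono (cdf μ) := by
  intro a b hab
  have h := FullLaw.pos (μ := μ) a b hab
  rw [measure_Ioc, ENNReal.ofReal_pos] at h
  linarith

theorem continuous_cdf : Continuous (cdf μ) := by
  refine continuous_iff_continuousAt.2 fun x => ?_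
  rw [(monotone_cdf μ).continuousAt_iff_leftLim_eq_rightLim, StieltjesFunction.rightLim_eq]
  have h : (cdf μ).measure {x} = 0 := by rw [measure_cdf]; exact measure_singleton x
  rw [StieltjesFunction.measure_singleton, ENNReal.ofReal_eq_zero] at h
  exact le_antisymm ((monotone_cdf μ).leftLim_le le_rfl) (by linarith)

theorem exists_cdf_eq {p : ℝ} (hp : 0 < p) (hp1 : p < 1) : ∃ y, cdf μ y = p := by
  obtain ⟨a, ha⟩ := ((tendsto_cdf_atBot μ).eventually_lt_const hp).exists
  obtain ⟨b, hb⟩ := ((tendsto_cdf_atTop μ).eventually_const_lt hp1).exists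
  have hab : a ≤ b := (strictMono_cdf μ).le_iff_le.1 (ha.trans hb).le
  obtain ⟨y, _, hy⟩ := intermediate_value_Icc hab (continuous_cdf μ).continuousOn
    ⟨ha.le, hb.le⟩
  exact ⟨y, hy⟩

theorem cdf_lt_one (x : ℝ) : cdf μ x < 1 :=
  (strictMono_cdf μ (lt_add_one x)).trans_le (cdf_le_one μ _)

theorem measure_cdf_lt {p : ℝ} (hp : 0 < p) (hp1 : p < 1) :
    μ {u | cdf μ u < p} = ENNReal.ofReal p := by
  obtain ⟨y, hy⟩ := exists_cdf_eq μ hp hp1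
  have : {u | cdf μ u < p} = Iio y := by
    ext u; simp only [mem_ofPred_eq, mem_Iio, ← hy, (strictMono_cdf μ).lt_iff_lt]
  rw [this, measure_congr Iio_ae_eq_Iic, ← ofReal_cdf, hy]

theorem measure_le_cdf {p : ℝ} (hp : 0 < p) (hp1 : p < 1) :
    μ {u | 1 - p ≤ cdf μ u} = ENNReal.ofReal p := by
  have h := measure_cdf_lt μ (p := 1 - p) (by linarith) (by linarith)
  have e : {u | 1 - p ≤ cdf μ u} = {u | cdf μ u < 1 - p}ᶜ := by ext u; simp
  rw [e, prob_compl_eq_one_sub (measurableSet_lt (continuous_cdf μ).measurable measurable_const), h,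
    ← ENNReal.ofReal_one, ← ENNReal.ofReal_sub _ (by linarith)]
  congr 1; ring

theorem measure_lt_and_cdf_lt {x g : ℝ} (hg : 0 < g) (hx : cdf μ x + g < 1) :
    μ {u | x < u ∧ cdf μ u < cdf μ x + g} = ENNReal.ofReal g := by
  obtain ⟨y, hy⟩ := exists_cdf_eq μ (p := cdf μ x + g)
    (by have := cdf_nonneg μ x; linarith) hx
  have : {u | x < u ∧ cdf μ u < cdf μ x + g} = Ioo x y := by
    ext u; simp only [mem_ofPred_eq, mem_Ioo, ← hy, (strictMono_cdf μ).lt_iff_lt]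
  rw [this, measure_congr Ioo_ae_eq_Ioc, measure_Ioc, hy]
  congr 1; ring

theorem measure_le_and_cdf_lt {x g : ℝ} (hg : 0 < g) (hx : cdf μ x + g < 1) :
    μ {u | x ≤ u ∧ cdf μ u < cdf μ x + g} = ENNReal.ofReal g := by
  obtain ⟨y, hy⟩ := exists_cdf_eq μ (p := cdf μ x + g)
    (by have := cdf_nonneg μ x; linarith) hx
  have : {u | x ≤ u ∧ cdf μ u < cdf μ x + g} = Ico x y := by
    ext u; simp only [mem_ofPred_eq, mem_Ico, ← hy, (strictMono_cdf μ).lt_iff_lt]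
  rw [this, measure_congr Ico_ae_eq_Ioc, measure_Ioc, hy]
  congr 1; ring

end FullLaw

/-! ### Spacings -/

section Spacings

open ProbabilityTheory FullLaw

/-- Some interval of mass `g` that starts at a data point, or at `-∞`, has at most `m` points. -/
def sparseEvent (μ : Measure ℝ) (n m : ℕ) (g : ℝ) : Set (Fin n → ℝ) :=
  {X | (∃ a, cdf μ (X a) + g < 1 ∧
      (Finset.univ.filter fun b => X a < X b ∧ cdf μ (X b) < cdf μ (X a) + g).card ≤ m) ∨
    (Finset.univ.filter fun b => cdf μ (X b) < g).card ≤ m}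

/-- Some interval of mass `g` that starts at a data point has more than `m` points, or the right
tail of mass `g` has at least `m` points. -/
def denseEvent (μ : Measure ℝ) (n m : ℕ) (g : ℝ) : Set (Fin n → ℝ) :=
  {X | (∃ a, cdf μ (X a) + g < 1 ∧
      m + 1 ≤ (Finset.univ.filter fun b => X a ≤ X b ∧ cdf μ (X b) < cdf μ (X a) + g).card) ∨
    m ≤ (Finset.univ.filter fun b => 1 - g ≤ cdf μ (X b)).card}

/-- At the optimal tilt the base is `r = (1 - g) / (1 - q)`, and `n (1 - g) = n (1 - q) r = (n - m)
r`. The factor `1 - g` thus restores the missing power of `r`, and the union over `n` starting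
points costs only `n - m`; the interval at the boundary adds one. -/
theorem chernoff_sum_eq {n m : ℕ} (hmn : m < n) {g : ℝ} (hg : 0 < g) (hg1 : g < 1) :
    (n : ℝ) * ((1 - g) * (1 - g + (m / n : ℝ) * (1 - g) / (g * (1 - m / n)) * g) ^ (n - 1) /
        ((m / n : ℝ) * (1 - g) / (g * (1 - m / n))) ^ m) +
      (1 - g + (m / n : ℝ) * (1 - g) / (g * (1 - m / n)) * g) ^ n /
        ((m / n : ℝ) * (1 - g) / (g * (1 - m / n))) ^ m =
    (n - m + 1) * ((g / (m / n : ℝ)) ^ m * ((1 - g) / (1 - m / n)) ^ (n - m)) := by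
  have hn : (0 : ℝ) < n := by exact_mod_cast (Nat.zero_le m).trans_lt hmn
  have hmn' : (m : ℝ) < n := by exact_mod_cast hmn
  set q : ℝ := m / n with hq
  have hq1 : q < 1 := (div_lt_one hn).2 hmn'
  have h1 : 0 < 1 - g := by linarith
  have h2 : 0 < 1 - q := by linarith
  have e1 : 1 - g + q * (1 - g) / (g * (1 - q)) * g = (1 - g) / (1 - q) := by
    field_simp; ring
  have hm : (n : ℝ) - m = n * (1 - q) := by rw [hq]; field_simp
  set r := (1 - g) / (1 - q) with hr
  have hr' : 1 - g = (1 - q) * r := by rw [hr]; field_simp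
  have e2 : (1 - g) * r ^ (n - 1) = (1 - q) * r ^ n := by
    rw [hr', mul_assoc, ← pow_succ', Nat.sub_add_cancel (by omega)]
  have e3 : r ^ n / (q * (1 - g) / (g * (1 - q))) ^ m = (g / q) ^ m * r ^ (n - m) := by
    have h3 : q * (1 - g) / (g * (1 - q)) = (g / q)⁻¹ * r := by
      rw [hr, inv_div]; field_simp
    have h4 : r ^ n = r ^ m * r ^ (n - m) := by rw [← pow_add, Nat.add_sub_cancel' hmn.le]
    have hr0 : 0 < r := div_pos h1 h2
    rw [h3, mul_pow, h4, inv_pow]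
    rcases Nat.eq_zero_or_pos m with h0 | h0
    · subst h0; simp
    · have hq0 : 0 < q := by
        have : (0 : ℝ) < m := by exact_mod_cast h0
        positivity
      field_simp
  rw [e1, e2, mul_div_assoc, e3, ← mul_assoc, ← hm]
  ring

theorem prod_ite_eq_pow_card {n : ℕ} (P : Fin n → Prop) [DecidablePred P] (t : ℝ) :
    ∏ i, (if P i then t else 1) = t ^ (Finset.univ.filter P).card := by
  rw [Finset.prod_ite, Finset.prod_const, Finset.prod_const_one, mul_one]

theorem measure_biUnion_add_le {n : ℕ} {ν : Measure (Fin n → ℝ)} {S : Fin n → Set (Fin n → ℝ)}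
    {T U : Set (Fin n → ℝ)} {x y : ℝ} (hx : 0 ≤ x) (hy : 0 ≤ y) (hS : ∀ a, ν (S a) ≤ ENNReal.ofReal x)
    (hT : ν T ≤ ENNReal.ofReal y) (hU : U ⊆ (⋃ a, S a) ∪ T) :
    ν U ≤ ENNReal.ofReal (n * x + y) := by
  calc ν U ≤ ν (⋃ a, S a) + ν T := (measure_mono hU).trans (measure_union_le _ _)
    _ ≤ ∑ a, ν (S a) + ν T := by gcongr; exact measure_iUnion_fintype_le _ _
    _ ≤ ∑ _a : Fin n, ENNReal.ofReal x + ENNReal.ofReal y := by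
        gcongr with a; exact hS a
    _ = _ := by
        rw [Finset.sum_const, Finset.card_univ, Fintype.card_fin, nsmul_eq_mul,
          ENNReal.ofReal_add (by positivity) hy, ENNReal.ofReal_mul (by positivity),
          ENNReal.ofReal_natCast]

variable (μ : Measure ℝ) [FullLaw μ]

theorem measurable_cdf : Measurable (cdf μ) := (continuous_cdf μ).measurable

theorem measure_sparseEvent_le {n m : ℕ} (hmn : m < n) {g : ℝ} (hg : 0 < g) (hg1 : g < 1)
    (hq : (m : ℝ) / n ≤ g) :
    (Measure.pi fun _ : Fin n => μ) (sparseEvent μ n m g) ≤ ENNReal.ofReal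
      ((n - m + 1) * ((g / (m / n : ℝ)) ^ m * ((1 - g) / (1 - m / n)) ^ (n - m))) := by
  classical
  obtain ⟨n, rfl⟩ : ∃ k, n = k + 1 := ⟨n - 1, by omega⟩
  have hn : (0 : ℝ) < (n + 1 : ℕ) := by positivity
  have hmn' : (m : ℝ) < (n + 1 : ℕ) := by exact_mod_cast hmn
  rw [← chernoff_sum_eq hmn hg hg1]
  set q : ℝ := m / (n + 1 : ℕ) with hqdef
  have hq1 : q < 1 := (div_lt_one hn).2 hmn'
  have hq0 : 0 ≤ q := by positivity
  have h1 : 0 < 1 - g := by linarith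
  have h2 : 0 < 1 - q := by linarith
  set t : ℝ := q * (1 - g) / (g * (1 - q)) with ht
  have ht0 : 0 ≤ t := by positivity
  have ht1 : t ≤ 1 := by rw [ht, div_le_one (by positivity)]; nlinarith
  have hτ : 0 < t ^ m := by
    rcases Nat.eq_zero_or_pos m with h0 | h0
    · subst h0; simp
    · have hq0 : 0 < q := by
        have : (0 : ℝ) < m := by exact_mod_cast h0
        positivity
      positivity
  have hbase : 0 ≤ 1 - g + t * g := by positivity
  have hF := measurable_cdf μ
  set B : Set ℝ := {x | cdf μ x + g < 1} with hB
  set R : Set (ℝ × ℝ) := {p | p.1 < p.2 ∧ cdf μ p.2 < cdf μ p.1 + g} with hR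
  have hBm : MeasurableSet B := measurableSet_lt (hF.add_const g) measurable_const
  have hRm : MeasurableSet R :=
    (measurableSet_lt measurable_fst measurable_snd).inter
      (measurableSet_lt (hF.comp measurable_snd) ((hF.comp measurable_fst).add_const g))
  have hμB : μ B = ENNReal.ofReal (1 - g) := by
    rw [← measure_cdf_lt μ h1 (by linarith)]
    congr 1; ext x; simp only [hB, mem_ofPred_eq]; constructor <;> intro h <;> linarith
  refine measure_biUnion_add_le (by positivity) (by positivity)
    (fun a => measure_pi_lead_prod_ge_le hBm hRm hg.le hg1.le ht0 hτ hμB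
      (fun x hx => measure_lt_and_cdf_lt μ hg hx) a)
    (measure_pi_prod_ge_le (measurableSet_lt hF measurable_const) hg.le hg1.le ht0 hτ
      (measure_cdf_lt μ hg hg1)) ?_
  rintro X (⟨a, ha, hcard⟩ | hcard)
  · refine Or.inl (mem_iUnion.2 ⟨a, ha, ?_⟩)
    have e := Fin.prod_univ_succAbove (fun b => if (X a, X b) ∈ R then t else 1) a
    -- The starting point is not counted here, so the whole count belongs to the other observations.
    have e0 : (X a, X a) ∉ R := fun h => lt_irrefl _ h.1
    rw [if_neg e0, one_mul] at e
    have h3 : t ^ m ≤ ∏ j, (if (X a, X (a.succAbove j)) ∈ R then t else 1) := by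
      rw [← e, prod_ite_eq_pow_card]
      exact pow_le_pow_of_le_one ht0 ht1 (by simpa [hR] using hcard)
    convert h3
  · refine Or.inr ?_
    rw [mem_ofPred_eq, prod_ite_eq_pow_card]
    exact pow_le_pow_of_le_one ht0 ht1 (by simpa using hcard)

theorem measure_denseEvent_le {n m : ℕ} (hmn : m < n) {g : ℝ} (hg : 0 < g) (hg1 : g < 1)
    (hq : g ≤ (m : ℝ) / n) :
    (Measure.pi fun _ : Fin n => μ) (denseEvent μ n m g) ≤ ENNReal.ofReal
      ((n - m + 1) * ((g / (m / n : ℝ)) ^ m * ((1 - g) / (1 - m / n)) ^ (n - m))) := by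
  classical
  obtain ⟨n, rfl⟩ : ∃ k, n = k + 1 := ⟨n - 1, by omega⟩
  have hn : (0 : ℝ) < (n + 1 : ℕ) := by positivity
  have hmn' : (m : ℝ) < (n + 1 : ℕ) := by exact_mod_cast hmn
  rw [← chernoff_sum_eq hmn hg hg1]
  set q : ℝ := m / (n + 1 : ℕ) with hqdef
  have hq1 : q < 1 := (div_lt_one hn).2 hmn'
  have hq0 : 0 < q := hg.trans_le hq
  have h1 : 0 < 1 - g := by linarith
  have h2 : 0 < 1 - q := by linarith
  set t : ℝ := q * (1 - g) / (g * (1 - q)) with ht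
  have ht1 : 1 ≤ t := by rw [ht, one_le_div (by positivity)]; nlinarith
  have ht0 : 0 < t := by linarith
  have hτ : 0 < t ^ m := by positivity
  have hbase : 0 ≤ 1 - g + t * g := by positivity
  have hF := measurable_cdf μ
  set B : Set ℝ := {x | cdf μ x + g < 1} with hB
  set R : Set (ℝ × ℝ) := {p | p.1 ≤ p.2 ∧ cdf μ p.2 < cdf μ p.1 + g} with hR
  have hBm : MeasurableSet B := measurableSet_lt (hF.add_const g) measurable_const
  have hRm : MeasurableSet R :=
    (measurableSet_le measurable_fst measurable_snd).inter
      (measurableSet_lt (hF.comp measurable_snd) ((hF.comp measurable_fst).add_const g))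
  have hμB : μ B = ENNReal.ofReal (1 - g) := by
    rw [← measure_cdf_lt μ h1 (by linarith)]
    congr 1; ext x; simp only [hB, mem_ofPred_eq]; constructor <;> intro h <;> linarith
  refine measure_biUnion_add_le (by positivity) (by positivity)
    (fun a => measure_pi_lead_prod_ge_le hBm hRm hg.le hg1.le ht0.le hτ hμB
      (fun x hx => measure_le_and_cdf_lt μ hg hx) a)
    (measure_pi_prod_ge_le (measurableSet_le measurable_const hF) hg.le hg1.le ht0.le hτ
      (measure_le_cdf μ hg hg1)) ?_
  rintro X (⟨a, ha, hcard⟩ | hcard)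
  · refine Or.inl (mem_iUnion.2 ⟨a, ha, ?_⟩)
    have e := Fin.prod_univ_succAbove (fun b => if (X a, X b) ∈ R then t else 1) a
    -- Now the starting point counts itself: `m + 1` points in the interval mean `m` among the
    -- others.
    have e0 : (X a, X a) ∈ R := ⟨le_rfl, by simpa using hg⟩
    rw [if_pos e0, prod_ite_eq_pow_card] at e
    have h3 : t ^ (m + 1) ≤ t * ∏ j, (if (X a, X (a.succAbove j)) ∈ R then t else 1) := by
      rw [← e]
      exact pow_le_pow_right₀ ht1 (by simpa [hR] using hcard)
    rw [pow_succ'] at h3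
    have h4 : t ^ m ≤ ∏ j, (if (X a, X (a.succAbove j)) ∈ R then t else 1) :=
      le_of_mul_le_mul_left h3 ht0
    convert h4
  · refine Or.inr ?_
    rw [mem_ofPred_eq, prod_ite_eq_pow_card]
    exact pow_le_pow_right₀ ht1 (by simpa using hcard)

end Spacings

end ScoreEstimation

namespace ScoreEstimation

open Set Filter Topology

open ProbabilityTheory FullLaw

/-! ### Simultaneous confidence bounds for the masses of all intervals -/

/-- The masses of all intervals are within the confidence limits computed from their counts. -/
def IntervalBounds {n : ℕ} (μ : Measure ℝ) (δ : ℝ) (X : Fin n → ℝ) : Prop :=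
  ∀ (a b : ℝ) (I : Set ℝ), Ioo a b ⊆ I → I ⊆ Icc a b → a ≤ b →
    (1 + 4 * epsBand n δ) * (cdf μ b - cdf μ a) ≤
      (1 - 2 * epsBand n δ) * empirical X I + 3 * epsBand n δ +
        3 * √(epsBand n δ * empirical X I + epsBand n δ ^ 2) ∧
    (1 - 2 * epsBand n δ) * empirical X I + 3 * epsBand n δ -
        3 * √(epsBand n δ * empirical X I + epsBand n δ ^ 2) - 2 * (1 + 4 * epsBand n δ) / n ≤
      (1 + 4 * epsBand n δ) * (cdf μ b - cdf μ a)

open scoped Classical in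
theorem empirical_eq_card {n : ℕ} (X : Fin n → ℝ) (I : Set ℝ) :
    empirical X I = ((Finset.univ.filter fun i => X i ∈ I).card : ℝ) / n := by
  simp [empirical, indicator]

/-- The upper bound for intervals, outside the event of a sparse interval. -/
theorem interval_mass_le {n k : ℕ} {μ : Measure ℝ} [FullLaw μ] {X : Fin n → ℝ} {a b g : ℝ}
    (hX : X ∉ sparseEvent μ n k g)
    (hk : (Finset.univ.filter fun i => X i ∈ Ioo a b).card ≤ k) : cdf μ b - cdf μ a ≤ g := by
  by_contra! hlt
  apply hX
  have hmono := strictMono_cdf μ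
  have hFa := cdf_nonneg μ a
  have hb1 := cdf_lt_one μ b
  by_cases hne : (Finset.univ.filter fun i => X i ≤ a).Nonempty
  -- Sliding left to the last observation at or before `a` adds no observation; mass `g` from there
  -- is exhausted before `b`.
  · obtain ⟨i, hi, hmax⟩ := Finset.exists_max_image _ X hne
    simp only [Finset.mem_filter, Finset.mem_univ, true_and] at hi hmax
    have hFi := hmono.monotone hi
    refine Or.inl ⟨i, by linarith, le_trans (Finset.card_le_card fun j hj => ?_) hk⟩
    simp only [Finset.mem_filter, Finset.mem_univ, true_and] at hj ⊢
    refine ⟨lt_of_not_ge fun h => absurd (hmax j h) (not_le.2 hj.1), ?_⟩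
    exact hmono.lt_iff_lt.1 (by linarith [hj.2])
  · refine Or.inr (le_trans (Finset.card_le_card fun j hj => ?_) hk)
    simp only [Finset.mem_filter, Finset.mem_univ, true_and] at hj ⊢
    refine ⟨lt_of_not_ge fun h => hne ⟨j, by simpa using h⟩, ?_⟩
    exact hmono.lt_iff_lt.1 (by linarith)

open scoped Classical in
/-- The lower bound for intervals, outside the event of a dense interval. -/
theorem le_interval_mass {n m : ℕ} {μ : Measure ℝ} [FullLaw μ] {X : Fin n → ℝ} {a b g : ℝ}
    {I : Set ℝ} (hI : I ⊆ Icc a b) (hX : X ∉ denseEvent μ n m g)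
    (hk : m + 1 ≤ (Finset.univ.filter fun i => X i ∈ I).card) : g ≤ cdf μ b - cdf μ a := by
  by_contra! hlt
  apply hX
  have hmono := strictMono_cdf μ
  have hne : (Finset.univ.filter fun i => X i ∈ I).Nonempty := Finset.card_pos.1 (by omega)
  obtain ⟨i, hi, hmin⟩ := Finset.exists_min_image _ X hne
  simp only [Finset.mem_filter, Finset.mem_univ, true_and] at hi hmin
  have hFi := hmono.monotone (hI hi).1
  -- If less than mass `g` remains to the right of the first point of `I`, all points of `I` lie in
  -- the right tail of mass `g`.
  by_cases h1 : cdf μ (X i) + g < 1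
  · refine Or.inl ⟨i, h1, hk.trans (Finset.card_le_card fun j hj => ?_)⟩
    simp only [Finset.mem_filter, Finset.mem_univ, true_and] at hj ⊢
    have := hmono.monotone (hI hj).2
    exact ⟨hmin j hj, by linarith⟩
  · refine Or.inr (((Nat.le_succ m).trans hk).trans (Finset.card_le_card fun j hj => ?_))
    simp only [Finset.mem_filter, Finset.mem_univ, true_and] at hj ⊢
    have := hmono.monotone (hmin j hj)
    linarith

theorem propLimit_mul_le {e q : ℝ} (he : 0 < e) (hq : 0 ≤ q) :
    (1 + 4 * e) * propLimit e q 1 ≤ (1 - 2 * e) * q + 3 * e + 3 * √(e * q + e ^ 2) := by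
  unfold propLimit
  rw [mul_div_cancel₀ _ (by positivity), one_mul]
  have : √(e * q * (1 - q) + e ^ 2) ≤ √(e * q + e ^ 2) := Real.sqrt_le_sqrt (by
    have : 0 ≤ e * q * q := by positivity
    linarith)
  linarith

theorem le_propLimit_mul {e q : ℝ} (he : 0 < e) (hq : 0 ≤ q) :
    (1 - 2 * e) * q + 3 * e - 3 * √(e * q + e ^ 2) ≤ (1 + 4 * e) * propLimit e q (-1) := by
  unfold propLimit
  rw [mul_div_cancel₀ _ (by positivity)]
  have : √(e * q * (1 - q) + e ^ 2) ≤ √(e * q + e ^ 2) := Real.sqrt_le_sqrt (by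
    have : 0 ≤ e * q * q := by positivity
    linarith)
  linarith

theorem two_le_log_sq_div {n : ℕ} (hn : 3 ≤ n) {δ : ℝ} (hδ : δ ∈ Ioo (0 : ℝ) 1) :
    2 ≤ Real.log ((n : ℝ) ^ 2 / δ) := by
  have hn' : (3 : ℝ) ≤ n := by exact_mod_cast hn
  rw [Real.le_log_iff_exp_le (by have := hδ.1; positivity)]
  have h1 : Real.exp 2 = Real.exp 1 * Real.exp 1 := by rw [← Real.exp_add]; norm_num
  have h2 := Real.exp_one_lt_d9
  have h3 := Real.exp_pos 1
  rw [h1, le_div_iff₀ hδ.1]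
  have : Real.exp 1 * Real.exp 1 ≤ 9 := by nlinarith
  have h4 : (9 : ℝ) ≤ n ^ 2 := by nlinarith
  have := hδ.2
  have := hδ.1
  nlinarith

theorem two_div_le_eps {n : ℕ} (hn : 3 ≤ n) {δ : ℝ} (hδ : δ ∈ Ioo (0 : ℝ) 1) :
    2 / n ≤ eps n δ := by
  unfold eps
  gcongr
  exact two_le_log_sq_div hn hδ

theorem eps_pos {n : ℕ} (hn : 3 ≤ n) {δ : ℝ} (hδ : δ ∈ Ioo (0 : ℝ) 1) : 0 < eps n δ := by
  refine lt_of_lt_of_le ?_ (two_div_le_eps hn hδ)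
  have : (0 : ℝ) < n := by exact_mod_cast (by omega : 0 < n)
  positivity

theorem exp_neg_mul_eps {n : ℕ} (hn : 3 ≤ n) {δ : ℝ} (hδ : δ ∈ Ioo (0 : ℝ) 1) :
    Real.exp (-(n * eps n δ)) = δ / n ^ 2 := by
  have hn0 : (0 : ℝ) < n := by exact_mod_cast (by omega : 0 < n)
  have := hδ.1
  rw [eps, mul_div_cancel₀ _ hn0.ne', Real.exp_neg, Real.exp_log (by positivity), inv_div]

/-- The union of all events on which some interval bound may fail. -/
def badEvent (μ : Measure ℝ) (n : ℕ) (δ : ℝ) : Set (Fin n → ℝ) :=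
  (⋃ m ∈ Finset.range n, {X | propLimit (epsBand n δ) (m / n) 1 < 1 ∧
      X ∈ sparseEvent μ n m (propLimit (epsBand n δ) (m / n) 1)}) ∪
  (⋃ m ∈ Finset.Ico 3 n, {X | 0 < propLimit (epsBand n δ) (m / n) (-1) ∧
      X ∈ denseEvent μ n m (propLimit (epsBand n δ) (m / n) (-1))})

theorem sum_range_sub (c : ℝ) (N : ℕ) :
    ∑ m ∈ Finset.range N, (c - m) = c * N - N * (N - 1) / 2 := by
  induction N with
  | zero => simp
  | succ N ih => rw [Finset.sum_range_succ, ih]; push_cast; ring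

/-- Omitting `m = 0, 1, 2` from the lower limits removes `3 n`, exactly the excess over `n ^ 2`. -/
theorem sum_pairs_eq {n : ℕ} (hn : 3 ≤ n) :
    ∑ m ∈ Finset.range n, ((n : ℝ) - m + 1) + ∑ m ∈ Finset.Ico 3 n, ((n : ℝ) - m + 1) = n ^ 2 := by
  have e : ∀ m : ℕ, (n : ℝ) - m + 1 = (n + 1) - m := fun m => by ring
  rw [Finset.sum_Ico_eq_sub _ hn]
  simp only [e, sum_range_sub]
  push_cast
  ring

theorem measure_badEvent_le (μ : Measure ℝ) [FullLaw μ] {n : ℕ} (hn : 3 ≤ n) {δ : ℝ}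
    (hδ : δ ∈ Ioo (0 : ℝ) 1) :
    (Measure.pi fun _ : Fin n => μ) (badEvent μ n δ) ≤ ENNReal.ofReal δ := by
  have hn0 : (0 : ℝ) < n := by exact_mod_cast (by omega : 0 < n)
  have hε := eps_pos hn hδ
  have he : 0 < epsBand n δ := by unfold epsBand; positivity
  have hδ0 := hδ.1
  have hup : ∀ m ∈ Finset.range n, (Measure.pi fun _ : Fin n => μ)
      {X | propLimit (epsBand n δ) (m / n) 1 < 1 ∧
        X ∈ sparseEvent μ n m (propLimit (epsBand n δ) (m / n) 1)} ≤
      ENNReal.ofReal (((n : ℝ) - m + 1) * (δ / n ^ 2)) := by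
    intro m hm
    have hmn := Finset.mem_range.1 hm
    have hmn' : (m : ℝ) < n := by exact_mod_cast hmn
    have hq0 : (0 : ℝ) ≤ m / n := by positivity
    have hlt := lt_propLimit_upper he hq0 ((div_lt_one hn0).2 hmn')
    by_cases h1 : propLimit (epsBand n δ) (m / n) 1 < 1
    · simp only [h1, true_and, ofPred_mem_eq]
      refine (measure_sparseEvent_le μ hmn (hq0.trans_lt hlt) h1 hlt.le).trans
        (ENNReal.ofReal_le_ofReal ?_)
      have := propLimit_factor_le hmn hε (one_pow 2) (hq0.trans_lt hlt) h1
      rw [exp_neg_mul_eps hn hδ] at this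
      exact mul_le_mul_of_nonneg_left this (by linarith)
    · simp [h1]
  have hlow : ∀ m ∈ Finset.Ico 3 n, (Measure.pi fun _ : Fin n => μ)
      {X | 0 < propLimit (epsBand n δ) (m / n) (-1) ∧
        X ∈ denseEvent μ n m (propLimit (epsBand n δ) (m / n) (-1))} ≤
      ENNReal.ofReal (((n : ℝ) - m + 1) * (δ / n ^ 2)) := by
    intro m hm
    have hmn := (Finset.mem_Ico.1 hm).2
    have hmn' : (m : ℝ) < n := by exact_mod_cast hmn
    have hq0 : (0 : ℝ) ≤ m / n := by positivity
    have hq1 := (div_lt_one hn0).2 hmn'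
    have hle := propLimit_lower_le he hq0 hq1.le
    by_cases h1 : 0 < propLimit (epsBand n δ) (m / n) (-1)
    · simp only [h1, true_and, ofPred_mem_eq]
      refine (measure_denseEvent_le μ hmn h1 (hle.trans_lt hq1) hle).trans
        (ENNReal.ofReal_le_ofReal ?_)
      have := propLimit_factor_le hmn hε (by norm_num) h1 (hle.trans_lt hq1)
      rw [exp_neg_mul_eps hn hδ] at this
      exact mul_le_mul_of_nonneg_left this (by linarith)
    · simp [h1]
  have hnn : ∀ m ≤ n, 0 ≤ ((n : ℝ) - m + 1) * (δ / n ^ 2) := by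
    intro m hm
    have : (m : ℝ) ≤ n := by exact_mod_cast hm
    have : 0 ≤ (n : ℝ) - m + 1 := by linarith
    positivity
  calc (Measure.pi fun _ : Fin n => μ) (badEvent μ n δ)
      ≤ ∑ m ∈ Finset.range n, ENNReal.ofReal (((n : ℝ) - m + 1) * (δ / n ^ 2)) +
        ∑ m ∈ Finset.Ico 3 n, ENNReal.ofReal (((n : ℝ) - m + 1) * (δ / n ^ 2)) :=
        (measure_union_le _ _).trans (add_le_add
          ((measure_biUnion_finset_le _ _).trans (Finset.sum_le_sum hup))
          ((measure_biUnion_finset_le _ _).trans (Finset.sum_le_sum hlow)))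
    _ = ENNReal.ofReal δ := by
        have h1 : ∀ m ∈ Finset.range n, 0 ≤ ((n : ℝ) - m + 1) * (δ / n ^ 2) :=
          fun m hm => hnn m (Finset.mem_range.1 hm).le
        have h2 : ∀ m ∈ Finset.Ico 3 n, 0 ≤ ((n : ℝ) - m + 1) * (δ / n ^ 2) :=
          fun m hm => hnn m (Finset.mem_Ico.1 hm).2.le
        rw [← ENNReal.ofReal_sum_of_nonneg h1, ← ENNReal.ofReal_sum_of_nonneg h2,
          ← ENNReal.ofReal_add (Finset.sum_nonneg h1) (Finset.sum_nonneg h2),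
          ← Finset.sum_mul, ← Finset.sum_mul, ← add_mul, sum_pairs_eq hn]
        congr 1
        field_simp

theorem intervalBounds_of_notMem {μ : Measure ℝ} [FullLaw μ] {n : ℕ} (hn : 3 ≤ n) {δ : ℝ}
    (hδ : δ ∈ Ioo (0 : ℝ) 1) {X : Fin n → ℝ} (hX : X ∉ badEvent μ n δ) : IntervalBounds μ δ X := by
  classical
  have hn0 : (0 : ℝ) < n := by exact_mod_cast (by omega : 0 < n)
  have hε := eps_pos hn hδ
  have he : 0 < epsBand n δ := by unfold epsBand; positivity
  -- The constant `21` is what a count of three requires below: `((1/n + 3 e) / 3) ^ 2 ≤ 3 e / n + e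
  -- ^ 2`.
  have hne : 1 / n ≤ 21 * epsBand n δ := by
    have h1 := two_div_le_eps hn hδ
    have h2 : (1 : ℝ) / n = 2 / n / 2 := by ring
    unfold epsBand
    linarith
  simp only [badEvent, mem_union, mem_iUnion, not_or, not_exists] at hX
  obtain ⟨hXu, hXl⟩ := hX
  intro a b I hI1 hI2 hab
  set e := epsBand n δ with hedef
  rw [empirical_eq_card]
  set k := (Finset.univ.filter fun i => X i ∈ I).card with hk
  have hkn : k ≤ n := by
    simpa using Finset.card_filter_le (Finset.univ : Finset (Fin n)) fun i => X i ∈ I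
  have hkn' : (k : ℝ) ≤ n := by exact_mod_cast hkn
  have hq0 : (0 : ℝ) ≤ k / n := by positivity
  have hmass : 0 ≤ cdf μ b - cdf μ a := sub_nonneg.2 (monotone_cdf μ hab)
  have hmass1 : cdf μ b - cdf μ a ≤ 1 := by linarith [cdf_le_one μ b, cdf_nonneg μ a]
  have hc : 0 < 1 + 4 * e := by positivity
  constructor
  · rcases hkn.lt_or_eq with hlt | heq
    · have hlt' : (k : ℝ) < n := by exact_mod_cast hlt
      refine le_trans ?_ (propLimit_mul_le he hq0)
      refine mul_le_mul_of_nonneg_left ?_ hc.le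
      by_cases h1 : propLimit e (k / n) 1 < 1
      · refine interval_mass_le (X := X)
          (fun h => hXu k (Finset.mem_range.2 hlt) ⟨h1, h⟩) (Finset.card_le_card fun i hi => ?_)
        simp only [Finset.mem_filter, Finset.mem_univ, true_and] at hi ⊢
        exact hI1 hi
      · exact hmass1.trans (not_lt.1 h1)
    · have e1 : (k : ℝ) / n = 1 := by rw [heq]; field_simp
      have h2 : e ≤ √(e * 1 + e ^ 2) := Real.le_sqrt_of_sq_le (by nlinarith)
      rw [e1]
      nlinarith
  -- A count `k` is handled by the dense event with `m = k - 1`, available only for `m ≥ 3`. For `k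
  -- ≤ 3` the lower limit is not positive, and nothing has to be proved about the law.
  · rcases le_or_gt k 3 with h3 | h3
    · have hk3 : (k : ℝ) ≤ 3 := by exact_mod_cast h3
      have h4 : 0 ≤ (1 + 4 * e) * (cdf μ b - cdf μ a) := by positivity
      have h5 : (1 - 2 * e) * (k / n) - 2 * (1 + 4 * e) / n ≤ (k - 2) / n := by
        have : 0 ≤ 2 * e * (k / n) := by positivity
        have : 0 ≤ 8 * e / n := by positivity
        have e1 : (1 - 2 * e) * (k / n) - 2 * (1 + 4 * e) / n =
          (k - 2) / n - 2 * e * (k / n) - 8 * e / n := by ring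
        linarith
      have h6 : (k - 2) / n + 3 * e ≤ 3 * √(e * (k / n) + e ^ 2) := by
        rcases le_or_gt k 2 with h2 | h2
        · have hk2 : (k : ℝ) ≤ 2 := by exact_mod_cast h2
          have h7 : ((k : ℝ) - 2) / n ≤ 0 := div_nonpos_of_nonpos_of_nonneg (by linarith) hn0.le
          have h8 : e ≤ √(e * (k / n) + e ^ 2) := Real.le_sqrt_of_sq_le (by
            have : 0 ≤ e * (k / n) := by positivity
            linarith)
          linarith
        · have hk3 : (k : ℝ) = 3 := by exact_mod_cast (by omega : k = 3)
          have h8 : (1 / n + 3 * e) / 3 ≤ √(e * (k / n) + e ^ 2) := Real.le_sqrt_of_sq_le (by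
            rw [hk3]
            set v : ℝ := 1 / n with hv
            have hv0 : 0 < v := by positivity
            have e3 : (3 : ℝ) / n = 3 * v := by rw [hv]; ring
            rw [e3]
            nlinarith)
          have e2 : ((k : ℝ) - 2) / n = 1 / n := by rw [hk3]; norm_num
          rw [e2]
          linarith
      linarith
    · obtain ⟨m, hm⟩ : ∃ m, k = m + 1 := ⟨k - 1, by omega⟩
      have hmn : m < n := by omega
      have hkm : (k : ℝ) / n = m / n + 1 / n := by rw [hm]; push_cast; ring
      have hqm : (0 : ℝ) ≤ m / n := by positivity
      have h1n : (0 : ℝ) < 1 / n := by positivity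
      have h1 : propLimit e (m / n) (-1) ≤ cdf μ b - cdf μ a := by
        by_cases h0 : 0 < propLimit e (m / n) (-1)
        · exact le_interval_mass hI2
            (fun h => hXl m (Finset.mem_Ico.2 ⟨by omega, hmn⟩) ⟨h0, h⟩) hm.ge
        · exact (not_lt.1 h0).trans hmass
      have h2 := mul_le_mul_of_nonneg_left h1 hc.le
      have h4 := le_propLimit_mul he hqm
      have h5 : √(e * (m / n) + e ^ 2) ≤ √(e * (k / n) + e ^ 2) :=
        Real.sqrt_le_sqrt (by rw [hkm]; nlinarith)
      have e1 : 2 * (1 + 4 * e) / n = 2 * (1 + 4 * e) * (1 / n) := by ring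
      rw [e1, hkm] at *
      nlinarith

/-- Subadditivity of the outer measure suffices, so neither event has to be shown measurable. -/
theorem ofReal_le_measure_intervalBounds (μ : Measure ℝ) [FullLaw μ] {n : ℕ} (hn : 3 ≤ n) {δ : ℝ}
    (hδ : δ ∈ Ioo (0 : ℝ) 1) :
    ENNReal.ofReal (1 - δ) ≤ (Measure.pi fun _ : Fin n => μ) {X | IntervalBounds μ δ X} := by
  have h1 : (1 : ENNReal) ≤ (Measure.pi fun _ : Fin n => μ) {X | IntervalBounds μ δ X} +
      ENNReal.ofReal δ := by
    calc (1 : ENNReal) = (Measure.pi fun _ : Fin n => μ) univ := measure_univ.symm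
      _ ≤ (Measure.pi fun _ : Fin n => μ) ({X | IntervalBounds μ δ X} ∪ badEvent μ n δ) :=
          measure_mono fun X _ => by
            by_cases h : X ∈ badEvent μ n δ
            · exact Or.inr h
            · exact Or.inl (intervalBounds_of_notMem hn hδ h)
      _ ≤ _ := (measure_union_le _ _).trans (by gcongr; exact measure_badEvent_le μ hn hδ)
  rw [ENNReal.ofReal_sub _ hδ.1.le, ENNReal.ofReal_one]
  exact tsub_le_iff_right.2 h1

end ScoreEstimation

namespace ScoreEstimation

open Set Filter Topology

open ProbabilityTheory FullLaw

/-! ### The population quantities behind the confidence band -/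

/-- The law with density `f`. -/
noncomputable abbrev densityLaw (f : ℝ → ℝ) : Measure ℝ :=
  (volume : Measure ℝ).withDensity fun x => ENNReal.ofReal (f x)

/-- `h² (f * K_h)'(z)` for the triangular kernel `K`. -/
noncomputable def massDiff (f : ℝ → ℝ) (h z : ℝ) : ℝ :=
  (cdf (densityLaw f) (z + h) - cdf (densityLaw f) z) -
    (cdf (densityLaw f) z - cdf (densityLaw f) (z - h))

/-- `h² (f * K_h)(z)` for the triangular kernel `K`. -/
noncomputable def massMean (f : ℝ → ℝ) (h z : ℝ) : ℝ :=
  ∫ v in (0 : ℝ)..h, (cdf (densityLaw f) (z + v) - cdf (densityLaw f) (z - v))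

namespace HolderScore

variable {f ψ : ℝ → ℝ} {β L : ℝ}

theorem fullLaw (hs : HolderScore f ψ β L) : FullLaw (densityLaw f) := by
  have : IsProbabilityMeasure (densityLaw f) := ⟨by
    rw [withDensity_apply _ MeasurableSet.univ, Measure.restrict_univ, hs.lintegral_eq_one]⟩
  have : NullSingletonClass (densityLaw f) := ⟨fun x => by
    rw [withDensity_apply _ (measurableSet_singleton x)]
    exact setLIntegral_measure_zero _ _ (measure_singleton x)⟩
  refine ⟨fun a b hab => ?_⟩
  rw [withDensity_apply _ measurableSet_Ioc, setLIntegral_pos_iff]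
  · have : (Function.support fun x => ENNReal.ofReal (f x)) = univ := by
      ext x; simpa using hs.pos x
    rw [this, univ_inter, Real.volume_Ioc]
    simpa using hab
  · exact hs.continuous.measurable.ennreal_ofReal

theorem cdf_sub (hs : HolderScore f ψ β L) (a b : ℝ) :
    cdf (densityLaw f) b - cdf (densityLaw f) a = ∫ x in a..b, f x := by
  have := hs.fullLaw
  wlog hab : a ≤ b generalizing a b
  · rw [intervalIntegral.integral_symm, ← this b a (le_of_not_ge hab)]; ring
  have h1 := measure_Ioc (densityLaw f) a b
  have hint : IntegrableOn f (Ioc a b) := (hs.continuous.integrableOn_Icc).mono_set Ioc_subset_Icc_self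
  rw [withDensity_apply _ measurableSet_Ioc,
    ← ofReal_integral_eq_lintegral_ofReal hint (Eventually.of_forall fun x => (hs.pos x).le)] at h1
  rw [intervalIntegral.integral_of_le hab]
  exact ((ENNReal.ofReal_eq_ofReal_iff (integral_nonneg fun x => (hs.pos x).le)
    (sub_nonneg.2 (monotone_cdf _ hab))).1 h1).symm

theorem intervalIntegrable_density (hs : HolderScore f ψ β L) (a b : ℝ) :
    IntervalIntegrable f volume a b := hs.continuous.intervalIntegrable a b

theorem massDiff_eq (hs : HolderScore f ψ β L) (h z : ℝ) :
    massDiff f h z = ∫ v in (0 : ℝ)..h, (f (z + v) - f (z - v)) := by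
  have h1 : Continuous fun v => f (z + v) := hs.continuous.comp (by fun_prop)
  have h2 : Continuous fun v => f (z - v) := hs.continuous.comp (by fun_prop)
  rw [intervalIntegral.integral_sub (h1.intervalIntegrable _ _) (h2.intervalIntegrable _ _),
    intervalIntegral.integral_comp_add_left, intervalIntegral.integral_comp_sub_left, massDiff,
    hs.cdf_sub, hs.cdf_sub]
  simp

theorem continuous_massMean_integrand (hs : HolderScore f ψ β L) (z : ℝ) :
    Continuous fun v => cdf (densityLaw f) (z + v) - cdf (densityLaw f) (z - v) := by
  have := hs.fullLaw
  have := continuous_cdf (densityLaw f)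
  fun_prop

theorem sub_le_score_mul (hs : HolderScore f ψ β L) {x a b : ℝ} (hx : x ≤ a) (hab : a ≤ b) :
    f b - f a ≤ ψ x * (cdf (densityLaw f) b - cdf (densityLaw f) a) := by
  rw [hs.sub_eq, hs.cdf_sub, ← intervalIntegral.integral_const_mul]
  refine intervalIntegral.integral_mono_on hab
    ((hs.intervalIntegrable _ _).mul_continuousOn hs.continuous.continuousOn)
    ((hs.intervalIntegrable_density _ _).const_mul _) fun u hu => ?_
  exact mul_le_mul_of_nonneg_right (hs.antitone (hx.trans hu.1)) (hs.pos u).le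

theorem score_mul_le_sub (hs : HolderScore f ψ β L) {x a b : ℝ} (hx : b ≤ x) (hab : a ≤ b) :
    ψ x * (cdf (densityLaw f) b - cdf (densityLaw f) a) ≤ f b - f a := by
  rw [hs.sub_eq, hs.cdf_sub, ← intervalIntegral.integral_const_mul]
  refine intervalIntegral.integral_mono_on hab ((hs.intervalIntegrable_density _ _).const_mul _)
    ((hs.intervalIntegrable _ _).mul_continuousOn hs.continuous.continuousOn) fun u hu => ?_
  exact mul_le_mul_of_nonneg_right (hs.antitone (hu.2.trans hx)) (hs.pos u).le

/-- Each increment `f (z + v) - f (z - v)` integrates `ψ f` over points to the right of `x`, where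
`ψ ≤ ψ x`. -/
theorem massDiff_le (hs : HolderScore f ψ β L) {h z x : ℝ} (hh : 0 ≤ h) (hx : h ≤ z - x) :
    massDiff f h z ≤ ψ x * massMean f h z := by
  rw [hs.massDiff_eq, massMean, ← intervalIntegral.integral_const_mul]
  refine intervalIntegral.integral_mono_on hh (Continuous.intervalIntegrable ?_ _ _)
    (((hs.continuous_massMean_integrand z).const_mul _).intervalIntegrable _ _) fun v hv => ?_
  · have := hs.continuous; fun_prop
  · exact hs.sub_le_score_mul (by linarith [hv.2]) (by linarith [hv.1])

theorem le_massDiff (hs : HolderScore f ψ β L) {h z x : ℝ} (hh : 0 ≤ h) (hx : h ≤ x - z) :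
    ψ x * massMean f h z ≤ massDiff f h z := by
  rw [hs.massDiff_eq, massMean, ← intervalIntegral.integral_const_mul]
  refine intervalIntegral.integral_mono_on hh
    (((hs.continuous_massMean_integrand z).const_mul _).intervalIntegrable _ _)
    (Continuous.intervalIntegrable ?_ _ _) fun v hv => ?_
  · have := hs.continuous; fun_prop
  · exact hs.score_mul_le_sub (by linarith [hv.2]) (by linarith [hv.1])

theorem mass_mem_of_density_mem (hs : HolderScore f ψ β L) {a b l u : ℝ} (hab : a ≤ b)
    (hf : ∀ x ∈ Icc a b, f x ∈ Icc l u) :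
    cdf (densityLaw f) b - cdf (densityLaw f) a ∈ Icc (l * (b - a)) (u * (b - a)) := by
  rw [hs.cdf_sub]
  have h1 : ∫ _ in a..b, l ≤ ∫ x in a..b, f x :=
    intervalIntegral.integral_mono_on hab (by simp) (hs.intervalIntegrable_density _ _)
      fun x hx => (hf x hx).1
  have h2 : ∫ x in a..b, f x ≤ ∫ _ in a..b, u :=
    intervalIntegral.integral_mono_on hab (hs.intervalIntegrable_density _ _) (by simp)
      fun x hx => (hf x hx).2
  simp only [intervalIntegral.integral_const, smul_eq_mul] at h1 h2
  exact ⟨by linarith, by linarith⟩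

theorem le_massMean (hs : HolderScore f ψ β L) {h z l : ℝ} (hh : 0 ≤ h)
    (hf : ∀ x ∈ Icc (z - h) (z + h), l ≤ f x) : h ^ 2 * l ≤ massMean f h z := by
  have e : h ^ 2 * l = ∫ v in (0 : ℝ)..h, 2 * l * v := by
    rw [intervalIntegral.integral_const_mul, integral_id]; ring
  rw [e, massMean]
  refine intervalIntegral.integral_mono_on hh (by apply Continuous.intervalIntegrable; fun_prop)
    ((hs.continuous_massMean_integrand z).intervalIntegrable _ _) fun v hv => ?_
  have hint := hs.intervalIntegrable_density (z - v) (z + v)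
  have h1 : ∫ _ in (z - v)..(z + v), l ≤ ∫ x in (z - v)..(z + v), f x :=
    intervalIntegral.integral_mono_on (by linarith [hv.1]) (by simp) hint
      fun x hx => hf x ⟨by linarith [hx.1, hv.2], by linarith [hx.2, hv.2]⟩
  simp only [intervalIntegral.integral_const, smul_eq_mul] at h1
  rw [hs.cdf_sub]
  linarith

theorem massMean_pos (hs : HolderScore f ψ β L) {h z : ℝ} (hh : 0 < h) : 0 < massMean f h z := by
  have := hs.fullLaw
  refine intervalIntegral.intervalIntegral_pos_of_pos_on
    ((hs.continuous_massMean_integrand z).intervalIntegrable _ _) (fun v hv => ?_) hh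
  exact sub_pos.2 (strictMono_cdf (densityLaw f) (by linarith [hv.1]))

/-- On a short window to the right of `x` on which the score is nonnegative, the density is
comparable to `f x`. -/
theorem density_mem_window (hs : HolderScore f ψ β L) {x h : ℝ} (h1 : 2 * h * ψ x ≤ 1)
    (h2 : 0 ≤ ψ (x + 2 * h)) {u : ℝ} (hu : u ∈ Icc x (x + 2 * h)) :
    f u ∈ Icc (f x) (3 * f x) := by
  have h3 := hs.antitone hu.2
  refine ⟨hs.le_of_le hu.1 (h2.trans h3), (hs.le_exp x u).trans ?_⟩
  have h4 : ψ x * (u - x) ≤ 1 := by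
    have h5 := h2.trans (h3.trans (hs.antitone hu.1))
    nlinarith [hu.2]
  have h6 : Real.exp (ψ x * (u - x)) ≤ 3 :=
    (Real.exp_le_exp.2 h4).trans (by linarith [Real.exp_one_lt_d9])
  rw [mul_comm]
  exact mul_le_mul_of_nonneg_right h6 (hs.pos x).le

end HolderScore

/-! ### Empirical quantities -/

theorem empirical_mono {n : ℕ} (X : Fin n → ℝ) {A B : Set ℝ} (h : A ⊆ B) :
    empirical X A ≤ empirical X B := by
  unfold empirical
  gcongr

theorem empirical_nonneg {n : ℕ} (X : Fin n → ℝ) (A : Set ℝ) : 0 ≤ empirical X A :=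
  div_nonneg (Finset.sum_nonneg fun _ _ => indicator_nonneg (fun _ _ => zero_le_one) _)
    (Nat.cast_nonneg _)

theorem kernelDeriv_eq {h : ℝ} (hh : 0 < h) (z x : ℝ) :
    kernelDeriv ((z - x) / h) =
      (Ioo z (z + h)).indicator (fun _ => (1 : ℝ)) x - (Ioc (z - h) z).indicator (fun _ => 1) x := by
  have h1 : |(z - x) / h| < 1 ↔ z - h < x ∧ x < z + h := by
    rw [abs_div, abs_of_pos hh, div_lt_one hh, abs_lt]
    constructor <;> rintro ⟨a, b⟩ <;> constructor <;> linarith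
  have h2 : 0 ≤ (z - x) / h ↔ x ≤ z := by
    rw [le_div_iff₀ hh, zero_mul, sub_nonneg]
  simp only [kernelDeriv, h1, sgn, h2, indicator, mem_Ioo, mem_Ioc]
  by_cases hx : x ≤ z
  · have h3 : ¬ z < x := not_lt.2 hx
    have h4 : x < z + h := by linarith
    by_cases h5 : z - h < x <;> simp [hx, h3, h4, h5]
  · have h3 : z < x := not_le.1 hx
    have h4 : z - h < x := by linarith
    by_cases h5 : x < z + h <;> simp [hx, h3, h4, h5]

theorem sq_mul_kdeDeriv {n : ℕ} (X : Fin n → ℝ) {h : ℝ} (hh : 0 < h) (z : ℝ) :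
    h ^ 2 * kdeDeriv X h z = empirical X (Ioo z (z + h)) - empirical X (Ioc (z - h) z) := by
  simp only [kdeDeriv, empirical, kernelDeriv_eq hh]
  rw [← sub_div, ← Finset.sum_sub_distrib, mul_div_assoc', Finset.mul_sum]
  congr 1
  refine Finset.sum_congr rfl fun i _ => ?_
  field_simp

/-- The triangular kernel is a mixture of centred boxes; this makes the kernel estimator an integral
of empirical interval masses. -/
theorem integral_indicator_abs_le {h : ℝ} (hh : 0 < h) (z x : ℝ) :
    ∫ v in (0 : ℝ)..h, (Icc (z - v) (z + v)).indicator (fun _ => (1 : ℝ)) x =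
      h * kernel ((z - x) / h) := by
  have e : ∀ v, (Icc (z - v) (z + v)).indicator (fun _ => (1 : ℝ)) x =
      (Ici |z - x|).indicator (fun _ => 1) v := by
    intro v
    have : x ∈ Icc (z - v) (z + v) ↔ v ∈ Ici |z - x| := by
      simp only [mem_Icc, mem_Ici, abs_le]
      constructor <;> rintro ⟨a, b⟩ <;> constructor <;> linarith
    by_cases hx : x ∈ Icc (z - v) (z + v)
    · rw [indicator_of_mem hx, indicator_of_mem (this.1 hx)]
    · rw [indicator_of_notMem hx, indicator_of_notMem (fun h => hx (this.2 h))]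
  simp only [e]
  rw [intervalIntegral.integral_of_le hh.le, integral_indicator_const _ measurableSet_Ici,
    smul_eq_mul, mul_one, Measure.real, Measure.restrict_apply measurableSet_Ici]
  have h0 := abs_nonneg (z - x)
  have hk : kernel ((z - x) / h) = if |z - x| ≤ h then 1 - |z - x| / h else 0 := by
    unfold kernel
    rw [abs_div, abs_of_pos hh]
    simp only [div_le_one hh]
  have hae : (volume : Measure ℝ) (Ici |z - x| ∩ Ioc 0 h) = ENNReal.ofReal (h - |z - x|) := by
    rw [← Real.volume_Icc]
    refine measure_congr ?_
    have h1 : (Ioc 0 h : Set ℝ) =ᵐ[volume] Icc 0 h := Ioc_ae_eq_Icc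
    have h2 : Ici |z - x| ∩ Icc 0 h = Icc |z - x| h := by
      ext v
      simp only [mem_inter_iff, mem_Ici, mem_Icc]
      exact ⟨fun ⟨a, _, c⟩ => ⟨a, c⟩, fun ⟨a, c⟩ => ⟨a, h0.trans a, c⟩⟩
    rw [← h2]
    exact (ae_eq_refl (Ici |z - x|)).inter h1
  rw [hae, hk]
  split_ifs with h1
  · rw [ENNReal.toReal_ofReal (by linarith)]; field_simp
  · rw [ENNReal.ofReal_of_nonpos (by linarith)]; simp

theorem monotone_indicator_Icc (z x : ℝ) :
    Monotone fun v => (Icc (z - v) (z + v)).indicator (fun _ => (1 : ℝ)) x := fun a b hab =>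
  indicator_le_indicator_of_subset (Icc_subset_Icc (by linarith) (by linarith))
    (fun _ => zero_le_one) _

theorem intervalIntegrable_empirical {n : ℕ} (X : Fin n → ℝ) (z a b : ℝ) :
    IntervalIntegrable (fun v => empirical X (Icc (z - v) (z + v))) volume a b :=
  Monotone.intervalIntegrable fun _ _ hab =>
    empirical_mono X (Icc_subset_Icc (by linarith) (by linarith))

theorem sq_mul_kde {n : ℕ} (X : Fin n → ℝ) {h : ℝ} (hh : 0 < h) (z : ℝ) :
    h * (h * kde X h z) = ∫ v in (0 : ℝ)..h, empirical X (Icc (z - v) (z + v)) := by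
  simp only [empirical, kde]
  rw [intervalIntegral.integral_div, intervalIntegral.integral_finsetSum
    fun i _ => (monotone_indicator_Icc z (X i)).intervalIntegrable]
  simp only [integral_indicator_abs_le hh]
  rw [mul_div_assoc', mul_div_assoc', Finset.mul_sum, Finset.mul_sum]
  congr 1
  refine Finset.sum_congr rfl fun i _ => ?_
  field_simp

end ScoreEstimation

namespace ScoreEstimation

open Set Filter Topology

open ProbabilityTheory FullLaw

/-! ### Validity and accuracy of the confidence band -/

theorem epsBand_nonneg_of {n : ℕ} {δ : ℝ} (hε : 0 < eps n δ) : 0 < epsBand n δ := by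
  unfold epsBand; positivity

section Band

variable {n : ℕ} {δ : ℝ} {X : Fin n → ℝ} {f ψ : ℝ → ℝ} {β L : ℝ}

/-- Both half windows obey the interval bounds with a width at most that of the full window, and the
centring terms `3 e` cancel in the difference. -/
theorem abs_massDiff_sub_le (hX : IntervalBounds (densityLaw f) δ X) (he : 0 < epsBand n δ)
    {h : ℝ} (hh : 0 < h) (z : ℝ) :
    |(1 + 4 * epsBand n δ) * massDiff f h z -
      (1 - 2 * epsBand n δ) * h ^ 2 * kdeDeriv X h z| ≤ 2 * bandV δ X h z := by
  have h1 := hX z (z + h) (Ioo z (z + h)) Subset.rfl Ioo_subset_Icc_self (by linarith)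
  have h2 := hX (z - h) z (Ioc (z - h) z) Ioo_subset_Ioc_self Ioc_subset_Icc_self (by linarith)
  have m1 : empirical X (Ioo z (z + h)) ≤ empirical X (Icc (z - h) (z + h)) :=
    empirical_mono X fun x hx => ⟨by linarith [hx.1], hx.2.le⟩
  have m2 : empirical X (Ioc (z - h) z) ≤ empirical X (Icc (z - h) (z + h)) :=
    empirical_mono X fun x hx => ⟨hx.1.le, by linarith [hx.2]⟩
  have hk := sq_mul_kdeDeriv X hh z
  rw [mul_assoc, hk]
  unfold massDiff bandV
  set e := epsBand n δ
  have s1 : √(e * empirical X (Ioo z (z + h)) + e ^ 2) ≤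
    √(e * empirical X (Icc (z - h) (z + h)) + e ^ 2) := Real.sqrt_le_sqrt (by nlinarith)
  have s2 : √(e * empirical X (Ioc (z - h) z) + e ^ 2) ≤
    √(e * empirical X (Icc (z - h) (z + h)) + e ^ 2) := Real.sqrt_le_sqrt (by nlinarith)
  have e1 : 2 * (1 + 4 * e) / n = 2 * ((1 + 4 * e) / n) := by ring
  rw [e1] at h1 h2
  rw [abs_le]
  constructor <;> linarith [h1.1, h1.2, h2.1, h2.2]

/-- The bounds for the centred intervals are integrated over their half-length `v`, with the square
root frozen at the full window. The offsets in `bandD` are those that recover both limits from the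
single width `bandV`. -/
theorem massMean_mem_band (hs : HolderScore f ψ β L) (hX : IntervalBounds (densityLaw f) δ X)
    (he : 0 < epsBand n δ) {h : ℝ} (hh : 0 < h) (z : ℝ) :
    bandD δ X h (-1) z ≤ (1 + 4 * epsBand n δ) * massMean f h z ∧
      (1 + 4 * epsBand n δ) * massMean f h z ≤ bandD δ X h 1 z := by
  set e := epsBand n δ with hedef
  set p := empirical X (Icc (z - h) (z + h)) with hp
  have key : ∀ v ∈ Icc 0 h,
      (1 - 2 * e) * empirical X (Icc (z - v) (z + v)) + (3 * e - 3 * √(e * p + e ^ 2) -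
        2 * (1 + 4 * e) / n) ≤ (1 + 4 * e) * (cdf (densityLaw f) (z + v) -
          cdf (densityLaw f) (z - v)) ∧
      (1 + 4 * e) * (cdf (densityLaw f) (z + v) - cdf (densityLaw f) (z - v)) ≤
      (1 - 2 * e) * empirical X (Icc (z - v) (z + v)) + (3 * e + 3 * √(e * p + e ^ 2)) := by
    intro v hv
    have h1 := hX (z - v) (z + v) (Icc (z - v) (z + v)) Ioo_subset_Icc_self Subset.rfl
      (by linarith [hv.1])
    have m1 : empirical X (Icc (z - v) (z + v)) ≤ p :=
      empirical_mono X (Icc_subset_Icc (by linarith [hv.2]) (by linarith [hv.2]))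
    have s1 : √(e * empirical X (Icc (z - v) (z + v)) + e ^ 2) ≤ √(e * p + e ^ 2) :=
      Real.sqrt_le_sqrt (by nlinarith)
    constructor <;> linarith [h1.1, h1.2]
  have hi := intervalIntegrable_empirical X z 0 h
  have hm := ((hs.continuous_massMean_integrand z).const_mul (1 + 4 * e)).intervalIntegrable
    (μ := volume) 0 h
  have hD : ∀ ω, bandD δ X h ω z = ∫ v in (0 : ℝ)..h,
      ((1 - 2 * e) * empirical X (Icc (z - v) (z + v)) +
        (ω * bandV δ X h z + (3 - 4 / n) * e - 1 / n)) := by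
    intro ω
    rw [intervalIntegral.integral_add (hi.const_mul _) (by simp),
      intervalIntegral.integral_const_mul, ← sq_mul_kde X hh, intervalIntegral.integral_const,
      bandD, smul_eq_mul]
    ring
  have hV : bandV δ X h z = 3 * √(e * p + e ^ 2) + (1 + 4 * e) / n := rfl
  rw [hD, hD, massMean, ← intervalIntegral.integral_const_mul]
  constructor
  · refine intervalIntegral.integral_mono_on hh.le ((hi.const_mul _).add (by simp)) hm
      fun v hv => le_trans (le_of_eq ?_) (key v hv).1
    rw [hV]; ring
  · refine intervalIntegral.integral_mono_on hh.le hm ((hi.const_mul _).add (by simp))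
      fun v hv => (key v hv).2.trans (le_of_eq ?_)
    rw [hV]; ring

theorem sgn_eq (x : ℝ) : sgn x = 1 ∧ 0 ≤ x ∨ sgn x = -1 ∧ x < 0 := by
  unfold sgn
  by_cases h : 0 ≤ x
  · left; simp [h]
  · right; simp [h, not_le.1 h]

/-- The numerator limits enclose the population numerator, up to the estimated sign. -/
theorem sgn_mul_massDiff_mem (hX : IntervalBounds (densityLaw f) δ X) (he : 0 < epsBand n δ)
    {h : ℝ} (hh : 0 < h) (z : ℝ) :
    bandM δ X h (-1) z ≤ sgn (kdeDeriv X h z) * ((1 + 4 * epsBand n δ) * massDiff f h z) ∧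
      sgn (kdeDeriv X h z) * ((1 + 4 * epsBand n δ) * massDiff f h z) ≤ bandM δ X h 1 z := by
  have h1 := abs_le.1 (abs_massDiff_sub_le hX he hh z)
  unfold bandM
  rcases sgn_eq (kdeDeriv X h z) with ⟨hτ, hw⟩ | ⟨hτ, hw⟩
  · rw [hτ, abs_of_nonneg hw]
    constructor <;> linarith [h1.1, h1.2]
  · rw [hτ, abs_of_neg hw]
    constructor <;> linarith [h1.1, h1.2]

/-- If `1 - 2 e` were negative, only the term `3 e` could help, and `bandV` exceeds it. The
consequence `bandM δ X h 1 z ≥ 0` is needed when the sign of the derivative is undecided. -/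
theorem two_mul_epsBand_le_one (he : 0 < epsBand n δ) {h : ℝ} (hh : 0 < h) {z : ℝ}
    (hD : 0 < bandD δ X h (-1) z) : 2 * epsBand n δ ≤ 1 := by
  by_contra! hlt
  set e := epsBand n δ with hedef
  have hk : 0 ≤ h * kde X h z := by
    have h1 := sq_mul_kde X hh z
    have h2 : 0 ≤ ∫ v in (0 : ℝ)..h, empirical X (Icc (z - v) (z + v)) :=
      intervalIntegral.integral_nonneg hh.le fun v _ => empirical_nonneg X _
    rw [← h1] at h2
    exact nonneg_of_mul_nonneg_right h2 hh
  have hV : 3 * e + (1 + 4 * e) / n ≤ bandV δ X h z := by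
    have : e ≤ √(e * empirical X (Icc (z - h) (z + h)) + e ^ 2) := Real.le_sqrt_of_sq_le (by
      have := mul_nonneg he.le (empirical_nonneg X (Icc (z - h) (z + h)))
      linarith)
    unfold bandV
    linarith
  have e2 : (3 - 4 / n) * e - 1 / n = 3 * e - (1 + 4 * e) / n := by ring
  have hn : 0 ≤ (1 + 4 * e) / n := by positivity
  unfold bandD at hD
  have h3 := pos_of_mul_pos_right hD hh.le
  nlinarith

/-- Scaled numerator `A` and denominator `B` are enclosed by the limits, and `ψ x * B ≤ A`. A
positive `bandM` at `-1` certifies the sign of `A`, hence which denominator limit is conservative;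
otherwise the smaller denominator is safe for either sign. -/
theorem le_bandAt_upper (hs : HolderScore f ψ β L) (hX : IntervalBounds (densityLaw f) δ X)
    (he : 0 < epsBand n δ) {h z x : ℝ} (hh : 0 < h) (hx : h ≤ x - z) :
    ((ψ x : ℝ) : EReal) ≤ bandAt δ X h 1 z := by
  have hA := sgn_mul_massDiff_mem hX he hh z
  have hB := massMean_mem_band hs hX he hh z
  have hAB := hs.le_massDiff hh.le hx
  have hB0 := hs.massMean_pos (z := z) hh
  have hc : 0 < 1 + 4 * epsBand n δ := by positivity
  set A := (1 + 4 * epsBand n δ) * massDiff f h z with hAdef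
  set B := (1 + 4 * epsBand n δ) * massMean f h z with hBdef
  have hB1 : 0 < B := mul_pos hc hB0
  have hAB' : ψ x * B ≤ A := by
    rw [hAdef, hBdef]; nlinarith
  unfold bandAt
  simp only
  split_ifs with h1 h2
  · obtain ⟨hD, hM⟩ := h1
    rw [EReal.coe_le_coe_iff]
    rcases sgn_eq (kdeDeriv X h z) with ⟨hτ, _⟩ | ⟨hτ, _⟩ <;> rw [hτ] at hA ⊢
    · norm_num
      rw [le_div_iff₀ hD]
      by_cases hψ : 0 ≤ ψ x
      · nlinarith [hA.2, hB.1]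
      · nlinarith [hA.1, hA.2]
    · norm_num
      have hD1 : 0 < bandD δ X h 1 z := hB1.trans_le hB.2
      rw [le_div_iff₀ hD1]
      have : ψ x < 0 := by
        by_contra! h0
        nlinarith [hA.1]
      nlinarith [hA.1, hB.2]
  · obtain ⟨hD, hM⟩ := h2
    rw [EReal.coe_le_coe_iff]
    rcases sgn_eq (kdeDeriv X h z) with ⟨hτ, _⟩ | ⟨hτ, _⟩ <;> rw [hτ] at hA ⊢
    · norm_num
      rw [le_div_iff₀ hD]
      by_cases hψ : 0 ≤ ψ x
      · nlinarith [hA.2, hB.1]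
      · have hM1 : 0 ≤ bandM δ X h 1 z := by
          have h3 := abs_massDiff_sub_le hX he hh z
          have h4 := two_mul_epsBand_le_one he hh hD
          unfold bandM
          exact add_nonneg (mul_nonneg (mul_nonneg (by linarith) (sq_nonneg h)) (abs_nonneg _))
            (by linarith [abs_nonneg ((1 + 4 * epsBand n δ) * massDiff f h z -
              (1 - 2 * epsBand n δ) * h ^ 2 * kdeDeriv X h z)])
        nlinarith
    · norm_num
      rw [le_div_iff₀ hD]
      by_cases hψ : 0 ≤ ψ x
      · nlinarith [hA.1, hB.1]
      · nlinarith [hA.1]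
  · simp

theorem bandAt_lower_le (hs : HolderScore f ψ β L) (hX : IntervalBounds (densityLaw f) δ X)
    (he : 0 < epsBand n δ) {h z x : ℝ} (hh : 0 < h) (hx : h ≤ z - x) :
    bandAt δ X h (-1) z ≤ ((ψ x : ℝ) : EReal) := by
  have hA := sgn_mul_massDiff_mem hX he hh z
  have hB := massMean_mem_band hs hX he hh z
  have hAB := hs.massDiff_le hh.le hx
  have hB0 := hs.massMean_pos (z := z) hh
  have hc : 0 < 1 + 4 * epsBand n δ := by positivity
  set A := (1 + 4 * epsBand n δ) * massDiff f h z with hAdef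
  set B := (1 + 4 * epsBand n δ) * massMean f h z with hBdef
  have hB1 : 0 < B := mul_pos hc hB0
  have hAB' : A ≤ ψ x * B := by
    rw [hAdef, hBdef]; nlinarith
  have hV : 0 ≤ bandV δ X h z := by
    have h3 := (abs_nonneg _).trans (abs_massDiff_sub_le hX he hh z)
    linarith
  unfold bandAt
  simp only
  split_ifs with h1 h2
  · obtain ⟨hD, hM⟩ := h1
    rw [EReal.coe_le_coe_iff]
    rcases sgn_eq (kdeDeriv X h z) with ⟨hτ, _⟩ | ⟨hτ, _⟩ <;> rw [hτ] at hA ⊢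
    · norm_num
      have hD1 : 0 < bandD δ X h 1 z := hB1.trans_le hB.2
      rw [div_le_iff₀ hD1]
      have : 0 < ψ x := by
        by_contra! h0
        nlinarith [hA.1]
      nlinarith [hA.1, hB.2]
    · norm_num
      rw [div_le_iff₀ hD]
      by_cases hψ : 0 ≤ ψ x
      · nlinarith [hA.1, hA.2]
      · nlinarith [hA.2, hB.1]
  · obtain ⟨hD, hM⟩ := h2
    rw [EReal.coe_le_coe_iff]
    rcases sgn_eq (kdeDeriv X h z) with ⟨hτ, _⟩ | ⟨hτ, _⟩ <;> rw [hτ] at hA ⊢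
    · norm_num
      rw [div_le_iff₀ hD]
      by_cases hψ : 0 ≤ ψ x
      · nlinarith [hA.1]
      · nlinarith [hA.1, hB.1]
    · norm_num
      rw [div_le_iff₀ hD]
      by_cases hψ : 0 ≤ ψ x
      · have hM1 : 0 ≤ bandM δ X h 1 z := by
          have h4 := two_mul_epsBand_le_one he hh hD
          unfold bandM
          exact add_nonneg (mul_nonneg (mul_nonneg (by linarith) (sq_nonneg h)) (abs_nonneg _))
            (by linarith)
        nlinarith
      · nlinarith [hA.2, hB.1]
  · simp

theorem lowerBand_le (hs : HolderScore f ψ β L) (hX : IntervalBounds (densityLaw f) δ X)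
    (he : 0 < epsBand n δ) (x : ℝ) : lowerBand δ X x ≤ ((ψ x : ℝ) : EReal) := by
  refine sSup_le ?_
  rintro u ⟨z, h, hh, hx, rfl⟩
  exact bandAt_lower_le hs hX he hh hx

theorem le_upperBand (hs : HolderScore f ψ β L) (hX : IntervalBounds (densityLaw f) δ X)
    (he : 0 < epsBand n δ) (x : ℝ) : ((ψ x : ℝ) : EReal) ≤ upperBand δ X x := by
  refine le_sInf ?_
  rintro u ⟨z, h, hh, hx, rfl⟩
  exact le_bandAt_upper hs hX he hh hx

theorem bandD_one_le {h : ℝ} (z : ℝ) :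
    bandD δ X h 1 z = bandD δ X h (-1) z + 2 * (h * bandV δ X h z) := by
  unfold bandD; ring

/-- A signal exceeding the noise forces the estimated sign and the first branch of `bandAt`. Passing
from empirical to population quantities then doubles each width. -/
theorem le_bandAt_lower (hs : HolderScore f ψ β L) (hX : IntervalBounds (densityLaw f) δ X)
    (he : 0 < epsBand n δ) (he1 : epsBand n δ ≤ 1 / 2) {h z : ℝ} (hh : 0 < h)
    (hA : 4 * bandV δ X h z < (1 + 4 * epsBand n δ) * massDiff f h z)
    (hB : 2 * (h * bandV δ X h z) < (1 + 4 * epsBand n δ) * massMean f h z) :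
    ((((1 + 4 * epsBand n δ) * massDiff f h z - 4 * bandV δ X h z) /
      ((1 + 4 * epsBand n δ) * massMean f h z + 2 * (h * bandV δ X h z)) : ℝ) : EReal) ≤
      bandAt δ X h (-1) z := by
  have h1 := abs_le.1 (abs_massDiff_sub_le hX he hh z)
  have h2 := massMean_mem_band hs hX he hh z
  have hV : 0 ≤ bandV δ X h z := by
    have h3 := (abs_nonneg _).trans (abs_massDiff_sub_le hX he hh z)
    linarith
  have hD := bandD_one_le (δ := δ) (X := X) (h := h) z
  have hN : 0 ≤ (1 - 2 * epsBand n δ) * h ^ 2 := mul_nonneg (by linarith) (sq_nonneg h)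
  have hw : 0 < kdeDeriv X h z := by
    by_contra! h0
    nlinarith [h1.2]
  have hτ : sgn (kdeDeriv X h z) = 1 := by unfold sgn; simp [hw.le]
  have hM : (1 + 4 * epsBand n δ) * massDiff f h z - 4 * bandV δ X h z ≤ bandM δ X h (-1) z := by
    unfold bandM
    rw [abs_of_pos hw]
    linarith [h1.2]
  unfold bandAt
  simp only
  rw [if_pos ⟨by linarith [h2.2], by linarith⟩, hτ, EReal.coe_le_coe_iff]
  norm_num
  refine div_le_div₀ (by linarith) hM (by linarith) (by linarith [h2.1])

theorem bandAt_upper_le (hs : HolderScore f ψ β L) (hX : IntervalBounds (densityLaw f) δ X)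
    (he : 0 < epsBand n δ) (he1 : epsBand n δ ≤ 1 / 2) {h z : ℝ} (hh : 0 < h)
    (hA : 4 * bandV δ X h z < -((1 + 4 * epsBand n δ) * massDiff f h z))
    (hB : 2 * (h * bandV δ X h z) < (1 + 4 * epsBand n δ) * massMean f h z) :
    bandAt δ X h 1 z ≤ ((-((-((1 + 4 * epsBand n δ) * massDiff f h z) - 4 * bandV δ X h z) /
      ((1 + 4 * epsBand n δ) * massMean f h z + 2 * (h * bandV δ X h z))) : ℝ) : EReal) := by
  have h1 := abs_le.1 (abs_massDiff_sub_le hX he hh z)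
  have h2 := massMean_mem_band hs hX he hh z
  have hV : 0 ≤ bandV δ X h z := by
    have h3 := (abs_nonneg _).trans (abs_massDiff_sub_le hX he hh z)
    linarith
  have hD := bandD_one_le (δ := δ) (X := X) (h := h) z
  have hN : 0 ≤ (1 - 2 * epsBand n δ) * h ^ 2 := mul_nonneg (by linarith) (sq_nonneg h)
  have hw : kdeDeriv X h z < 0 := by
    by_contra! h0
    nlinarith [h1.1]
  have hτ : sgn (kdeDeriv X h z) = -1 := by unfold sgn; simp [hw]
  have hM : -((1 + 4 * epsBand n δ) * massDiff f h z) - 4 * bandV δ X h z ≤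
      bandM δ X h (-1) z := by
    unfold bandM
    rw [abs_of_neg hw]
    linarith [h1.1]
  unfold bandAt
  simp only
  rw [if_pos ⟨by linarith [h2.2], by linarith⟩, hτ, EReal.coe_le_coe_iff]
  norm_num
  rw [neg_div]
  refine neg_le_neg (div_le_div₀ (by linarith) hM (by linarith) (by linarith [h2.1]))

end Band

end ScoreEstimation

/-! ### Accuracy of the band and of the estimator. -/

namespace ScoreEstimation

open Set Filter Topology

open ProbabilityTheory FullLaw

section Band

variable {n : ℕ} {δ : ℝ} {X : Fin n → ℝ} {f ψ : ℝ → ℝ} {β L : ℝ}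

/-- The width of the band when the window has mass at most `6 Y` with `Y` well above `ε`. -/
theorem bandV_le (hn : 3 ≤ n) (hδ : δ ∈ Ioo (0 : ℝ) 1) (hε1 : eps n δ ≤ 1)
    (hX : IntervalBounds (densityLaw f) δ X) {h z Y : ℝ} (hh : 0 ≤ h)
    (hY : 1000 * eps n δ ≤ Y)
    (hmass : cdf (densityLaw f) (z + h) - cdf (densityLaw f) (z - h) ≤ 6 * Y) :
    bandV δ X h z ≤ 8 * √(eps n δ * Y) := by
  have hε := eps_pos hn hδ
  have h2n := two_div_le_eps hn hδ
  have hn0 : (0 : ℝ) < n := by exact_mod_cast (by omega : 0 < n)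
  have h1 := (hX (z - h) (z + h) (Icc (z - h) (z + h)) Ioo_subset_Icc_self Subset.rfl
    (by linarith)).2
  have hp0 := empirical_nonneg X (Icc (z - h) (z + h))
  unfold bandV
  set p := empirical X (Icc (z - h) (z + h))
  set ε := eps n δ
  have hedef : epsBand n δ = 2 * ε / 9 := rfl
  set e := epsBand n δ
  have he : 0 < e := by rw [hedef]; positivity
  have hc : (1 + 4 * e) / n ≤ ε := by
    have e1 : (1 + 4 * e) / n = (1 + 4 * e) / 2 * (2 / n) := by ring
    rw [e1]
    have : (0 : ℝ) < 2 / n := by positivity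
    nlinarith
  have hs2 := Real.sq_sqrt (show 0 ≤ e * p + e ^ 2 by positivity)
  have hs0 := Real.sqrt_nonneg (e * p + e ^ 2)
  set S := √(e * p + e ^ 2)
  -- Arithmetic–geometric mean, with weights that let `p` be absorbed in the lower interval bound;
  -- this bounds the empirical mass by `26 Y`.
  have hS : 3 * S ≤ p / 9 + e / 9 + 81 / 4 * e := by
    refine le_of_sq_le_sq ?_ (by positivity)
    have : (3 * S) ^ 2 = 9 * (e * p + e ^ 2) := by rw [mul_pow, hs2]; norm_num
    rw [this]
    nlinarith [sq_nonneg (p / 9 + e / 9 - 81 / 4 * e)]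
  have e2 : 2 * (1 + 4 * e) / n = 2 * ((1 + 4 * e) / n) := by ring
  rw [e2] at h1
  have hp : p ≤ 26 * Y := by nlinarith
  have hS2 : 3 * S ≤ 7.3 * √(ε * Y) := by
    have hY0 : 0 ≤ Y := by linarith
    have h3 : √(e * p + e ^ 2) ≤ √((7.3 / 3) ^ 2 * (ε * Y)) := by
      refine Real.sqrt_le_sqrt ?_
      rw [hedef]
      nlinarith
    rw [Real.sqrt_mul (by positivity), Real.sqrt_sq (by norm_num)] at h3
    linarith
  have hεY : ε ≤ √(ε * Y) / 30 := by
    have : 30 * ε ≤ √(ε * Y) := Real.le_sqrt_of_sq_le (by nlinarith)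
    linarith
  linarith

/-- Compared with `ψ₂ ≤ A / B`, the limit loses `4 V` in the numerator and `2 h ψ₂ V ≤ V` through
the denominator. The loss `5 V` is at most `40 √(ε / (φ h ^ 3))` times the denominator. If the
numerator is not positive, `ψ₂` itself is below this noise level and `0 ≤ lb` suffices. -/
theorem score_sub_le_limit {A B V ψ₂ lb ε φ h c : ℝ} (hε : 0 < ε) (hφ : 0 < φ) (hh : 0 < h)
    (hc : 1 ≤ c) (hV : V ≤ 8 * √(ε * (h * φ))) (hV0 : 0 ≤ V) (hY : 1000 * ε ≤ h * φ)
    (hB : h ^ 2 * φ ≤ B) (hA : ψ₂ * B ≤ A) (hψ₂' : 2 * h * ψ₂ ≤ 1) (hlb : 0 ≤ lb)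
    (hlim : 4 * V < c * A → 2 * (h * V) < c * B → (c * A - 4 * V) / (c * B + 2 * (h * V)) ≤ lb) :
    ψ₂ - 40 * √(ε / (φ * h ^ 3)) ≤ lb := by
  set R := √(ε / (φ * h ^ 3)) with hR
  have hR0 : 0 ≤ R := Real.sqrt_nonneg _
  have hS : √(ε * (h * φ)) = R * (h ^ 2 * φ) := by
    have e : ε * (h * φ) = ε / (φ * h ^ 3) * (h ^ 2 * φ) ^ 2 := by field_simp
    rw [e, Real.sqrt_mul (by positivity), Real.sqrt_sq (by positivity)]
  have hS1 : √(ε * (h * φ)) ≤ h * φ / 30 := by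
    refine Real.sqrt_le_iff.2 ⟨by positivity, ?_⟩
    have : 0 < h * φ := by positivity
    nlinarith
  have hφ2 : 0 < h ^ 2 * φ := by positivity
  have hB0 : 0 < B := by linarith
  have hcB : B ≤ c * B := by nlinarith
  have h1 : 2 * (h * V) < c * B := by
    have h3 : h * V ≤ h * (8 * (h * φ / 30)) := mul_le_mul_of_nonneg_left (by linarith) hh.le
    nlinarith
  have h5 : 5 * V ≤ 40 * R * (c * B) := by
    have : R * (h ^ 2 * φ) ≤ R * (c * B) := mul_le_mul_of_nonneg_left (by linarith) hR0
    rw [hS] at hV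
    nlinarith
  have hcA : ψ₂ * (c * B) ≤ c * A := by nlinarith
  by_cases h2 : 4 * V < c * A
  · refine le_trans ?_ (hlim h2 h1)
    have hden : 0 < c * B + 2 * (h * V) := by positivity
    rw [le_div_iff₀ hden]
    have h6 : 2 * h * ψ₂ * V ≤ 1 * V := mul_le_mul_of_nonneg_right hψ₂' hV0
    have h7 : 0 ≤ 40 * R * (2 * (h * V)) := by positivity
    nlinarith
  · have h8 : ψ₂ * (c * B) ≤ 40 * R * (c * B) := by linarith
    have h9 : ψ₂ ≤ 40 * R := le_of_mul_le_mul_right h8 (by linarith)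
    linarith

theorem bandV_nonneg (hn : 3 ≤ n) (hδ : δ ∈ Ioo (0 : ℝ) 1) (h z : ℝ) : 0 ≤ bandV δ X h z := by
  have he := epsBand_nonneg_of (eps_pos hn hδ)
  unfold bandV
  positivity

/-- The lower limit at bandwidth `h` and centre `x + h` is used: on its window `[x, x + 2 h]` the
density is comparable to `f x` and the score is at least `ψ (x + 2 h)`. -/
theorem lower_accuracy (hs : HolderScore f ψ β L) (hn : 3 ≤ n) (hδ : δ ∈ Ioo (0 : ℝ) 1)
    (hε1 : eps n δ ≤ 1) (hX : IntervalBounds (densityLaw f) δ X) {x h lb : ℝ} (hh : 0 < h)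
    (h1 : 2 * h * ψ x ≤ 1) (h2 : 0 ≤ ψ (x + 2 * h)) (h3 : 1000 * eps n δ ≤ h * f x)
    (hlb0 : 0 ≤ lb) (hlb : lowerBand δ X x ≤ ((lb : ℝ) : EReal)) :
    ψ (x + 2 * h) - 40 * √(eps n δ / (f x * h ^ 3)) ≤ lb := by
  have hε := eps_pos hn hδ
  have he := epsBand_nonneg_of hε
  have he1 : epsBand n δ ≤ 1 / 2 := by unfold epsBand; linarith
  have hwin : ∀ u ∈ Icc (x + h - h) (x + h + h), f u ∈ Icc (f x) (3 * f x) := fun u hu =>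
    hs.density_mem_window h1 h2 ⟨by linarith [hu.1], by linarith [hu.2]⟩
  have hmass := hs.mass_mem_of_density_mem (by linarith) hwin
  have hV := bandV_le hn hδ hε1 hX hh.le h3 (hmass.2.trans (by ring_nf; rfl))
  have hB := hs.le_massMean (z := x + h) hh.le fun u hu => (hwin u hu).1
  have hA : ψ (x + 2 * h) * massMean f h (x + h) ≤ massDiff f h (x + h) :=
    hs.le_massDiff hh.le (by linarith)
  have hψ : ψ (x + 2 * h) ≤ ψ x := hs.antitone (by linarith)
  refine score_sub_le_limit hε (hs.pos x) hh (c := 1 + 4 * epsBand n δ) (by linarith) hV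
    (bandV_nonneg hn hδ _ _) h3 hB hA (by nlinarith) hlb0 fun h4 h5 => ?_
  have h6 := le_bandAt_lower hs hX he he1 hh h4 h5
  have h7 : bandAt δ X h (-1) (x + h) ≤ lowerBand δ X x :=
    le_sSup ⟨x + h, h, hh, by linarith, rfl⟩
  exact EReal.coe_le_coe_iff.1 (h6.trans (h7.trans hlb))

theorem upper_accuracy (hs : HolderScore f ψ β L) (hn : 3 ≤ n) (hδ : δ ∈ Ioo (0 : ℝ) 1)
    (hε1 : eps n δ ≤ 1) (hX : IntervalBounds (densityLaw f) δ X) {x h lb : ℝ} (hh : 0 < h)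
    (h1 : 2 * h * -ψ x ≤ 1) (h2 : 0 ≤ -ψ (x - 2 * h)) (h3 : 1000 * eps n δ ≤ h * f x)
    (hlb0 : 0 ≤ lb) (hlb : ((-lb : ℝ) : EReal) ≤ upperBand δ X x) :
    -ψ (x - 2 * h) - 40 * √(eps n δ / (f x * h ^ 3)) ≤ lb := by
  have hε := eps_pos hn hδ
  have he := epsBand_nonneg_of hε
  have he1 : epsBand n δ ≤ 1 / 2 := by unfold epsBand; linarith
  have hwin : ∀ u ∈ Icc (x - h - h) (x - h + h), f u ∈ Icc (f x) (3 * f x) := fun u hu => by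
    have := hs.reflect.density_mem_window (x := -x) (h := h) (u := -u) (by simpa using h1)
      (by rw [show -(-x + 2 * h) = x - 2 * h by ring]; exact h2)
      ⟨by linarith [hu.2], by linarith [hu.1]⟩
    simpa using this
  have hmass := hs.mass_mem_of_density_mem (by linarith) hwin
  have hV := bandV_le hn hδ hε1 hX hh.le h3 (hmass.2.trans (by ring_nf; rfl))
  have hB := hs.le_massMean (z := x - h) hh.le fun u hu => (hwin u hu).1
  have hA : massDiff f h (x - h) ≤ ψ (x - 2 * h) * massMean f h (x - h) :=
    hs.massDiff_le hh.le (by linarith)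
  have hψ : ψ x ≤ ψ (x - 2 * h) := hs.antitone (by linarith)
  refine score_sub_le_limit (A := -massDiff f h (x - h)) hε (hs.pos x) hh
    (c := 1 + 4 * epsBand n δ) (by linarith) hV
    (bandV_nonneg hn hδ _ _) h3 hB (by linarith) (by nlinarith) hlb0 fun h4 h5 => ?_
  rw [mul_neg] at h4 ⊢
  have h6 := bandAt_upper_le hs hX he he1 hh h4 h5
  have h7 : upperBand δ X x ≤ bandAt δ X h 1 (x - h) :=
    sInf_le ⟨x - h, h, hh, by linarith, rfl⟩
  have h8 := EReal.coe_le_coe_iff.1 (hlb.trans (h7.trans h6))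
  linarith

theorem multiscale_of_pos (hs : HolderScore f ψ β L) (hX : IntervalBounds (densityLaw f) δ X)
    (he : 0 < epsBand n δ) {x : ℝ} (hx : 0 ≤ ψ x) :
    multiscale n δ x X = max (lowerBand δ X x) 0 := by
  have h2 : (0 : EReal) ≤ upperBand δ X x :=
    (EReal.coe_nonneg.2 hx).trans (le_upperBand hs hX he x)
  unfold multiscale
  split_ifs with h h'
  · rw [max_eq_left h.le]
  · exact absurd h' (not_lt.2 h2)
  · rw [max_eq_right (not_lt.1 h)]

theorem multiscale_of_neg (hs : HolderScore f ψ β L) (hX : IntervalBounds (densityLaw f) δ X)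
    (he : 0 < epsBand n δ) {x : ℝ} (hx : ψ x ≤ 0) :
    multiscale n δ x X = min (upperBand δ X x) 0 := by
  have h1 : lowerBand δ X x ≤ (0 : EReal) :=
    (lowerBand_le hs hX he x).trans (EReal.coe_nonpos.2 hx)
  unfold multiscale
  rw [if_neg (not_lt.2 h1)]
  split_ifs with h'
  · rw [min_eq_left h'.le]
  · rw [min_eq_right (not_lt.1 h')]

/-- Covering the score and shrinking to zero keep the estimate between `0` and `ψ x`; in particular
it is finite. -/
theorem multiscale_mem_of_pos (hs : HolderScore f ψ β L) (hX : IntervalBounds (densityLaw f) δ X)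
    (he : 0 < epsBand n δ) {x : ℝ} (hx : 0 ≤ ψ x) :
    multiscale n δ x X ∈ Icc (0 : EReal) ((ψ x : ℝ) : EReal) := by
  rw [multiscale_of_pos hs hX he hx]
  exact ⟨le_max_right _ _, max_le (lowerBand_le hs hX he x) (EReal.coe_nonneg.2 hx)⟩

theorem multiscale_mem_of_neg (hs : HolderScore f ψ β L) (hX : IntervalBounds (densityLaw f) δ X)
    (he : 0 < epsBand n δ) {x : ℝ} (hx : ψ x ≤ 0) :
    multiscale n δ x X ∈ Icc ((ψ x : ℝ) : EReal) (0 : EReal) := by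
  rw [multiscale_of_neg hs hX he hx]
  exact ⟨le_min (le_upperBand hs hX he x) (EReal.coe_nonpos.2 hx), min_le_right _ _⟩

theorem coe_toReal_multiscale (hs : HolderScore f ψ β L) (hX : IntervalBounds (densityLaw f) δ X)
    (he : 0 < epsBand n δ) (x : ℝ) :
    (((multiscale n δ x X).toReal : ℝ) : EReal) = multiscale n δ x X := by
  rcases le_total 0 (ψ x) with hx | hx
  · have h := multiscale_mem_of_pos hs hX he hx
    exact EReal.coe_toReal (h.2.trans_lt (EReal.coe_lt_top _)).ne
      (lt_of_lt_of_le EReal.bot_lt_zero h.1).ne'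
  · have h := multiscale_mem_of_neg hs hX he hx
    exact EReal.coe_toReal (h.2.trans_lt EReal.zero_lt_top).ne
      (lt_of_lt_of_le (EReal.bot_lt_coe _) h.1).ne'

theorem toReal_multiscale_mem_of_pos (hs : HolderScore f ψ β L)
    (hX : IntervalBounds (densityLaw f) δ X) (he : 0 < epsBand n δ) {x : ℝ} (hx : 0 ≤ ψ x) :
    (multiscale n δ x X).toReal ∈ Icc 0 (ψ x) := by
  have h := multiscale_mem_of_pos hs hX he hx
  rw [← coe_toReal_multiscale hs hX he x] at h
  exact ⟨EReal.coe_nonneg.1 h.1, EReal.coe_le_coe_iff.1 h.2⟩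

theorem toReal_multiscale_mem_of_neg (hs : HolderScore f ψ β L)
    (hX : IntervalBounds (densityLaw f) δ X) (he : 0 < epsBand n δ) {x : ℝ} (hx : ψ x ≤ 0) :
    (multiscale n δ x X).toReal ∈ Icc (ψ x) 0 := by
  have h := multiscale_mem_of_neg hs hX he hx
  rw [← coe_toReal_multiscale hs hX he x] at h
  exact ⟨EReal.coe_le_coe_iff.1 h.1, EReal.coe_nonpos.1 h.2⟩

theorem multiscale_accuracy_left (hs : HolderScore f ψ β L) (hn : 3 ≤ n) (hδ : δ ∈ Ioo (0 : ℝ) 1)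
    (hε1 : eps n δ ≤ 1) (hX : IntervalBounds (densityLaw f) δ X) {x h : ℝ} (hx : 0 < ψ x)
    (hh : 0 < h) (h1 : 2 * h * ψ x ≤ 1) (h2 : 0 ≤ ψ (x + 2 * h))
    (h3 : 1000 * eps n δ ≤ h * f x) :
    ψ x - (multiscale n δ x X).toReal ≤
      ψ x - ψ (x + 2 * h) + 40 * √(eps n δ / (f x * h ^ 3)) := by
  have he := epsBand_nonneg_of (eps_pos hn hδ)
  have := lower_accuracy hs hn hδ hε1 hX hh h1 h2 h3
    (toReal_multiscale_mem_of_pos hs hX he hx.le).1 (by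
      rw [coe_toReal_multiscale hs hX he x, multiscale_of_pos hs hX he hx.le]
      exact le_max_left _ _)
  linarith

theorem multiscale_accuracy_right (hs : HolderScore f ψ β L) (hn : 3 ≤ n) (hδ : δ ∈ Ioo (0 : ℝ) 1)
    (hε1 : eps n δ ≤ 1) (hX : IntervalBounds (densityLaw f) δ X) {x h : ℝ} (hx : 0 < -ψ x)
    (hh : 0 < h) (h1 : 2 * h * -ψ x ≤ 1) (h2 : 0 ≤ -ψ (x - 2 * h))
    (h3 : 1000 * eps n δ ≤ h * f x) :
    -ψ x - -(multiscale n δ x X).toReal ≤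
      -ψ x - -ψ (x - 2 * h) + 40 * √(eps n δ / (f x * h ^ 3)) := by
  have he := epsBand_nonneg_of (eps_pos hn hδ)
  have hx' : ψ x ≤ 0 := by linarith
  have := upper_accuracy hs hn hδ hε1 hX hh h1 h2 h3
    (lb := -(multiscale n δ x X).toReal)
    (by linarith [(toReal_multiscale_mem_of_neg hs hX he hx').2]) (by
      rw [neg_neg, coe_toReal_multiscale hs hX he x, multiscale_of_neg hs hX he hx']
      exact min_le_left _ _)
  linarith

end Band

end ScoreEstimation

namespace ScoreEstimation

open Set Filter Topology

/-! ### Measurability of the multiscale estimator -/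

/-- A map is `CountablyPiecewise` if it is continuous on each set of a countable closed cover. -/
def CountablyPiecewise {E F : Type*} [TopologicalSpace E] [TopologicalSpace F] (f : E → F) :
    Prop :=
  ∃ S : ℕ → Set E, (∀ i, IsClosed (S i)) ∧ (∀ x, ∃ i, x ∈ S i) ∧ ∀ i, ContinuousOn f (S i)

namespace CountablyPiecewise

variable {E F G : Type*} [TopologicalSpace E] [TopologicalSpace F] [TopologicalSpace G]

theorem of_continuous {f : E → F} (hf : Continuous f) : CountablyPiecewise f :=
  ⟨fun _ => univ, fun _ => isClosed_univ, fun _ => ⟨0, trivial⟩, fun _ => hf.continuousOn⟩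

/-- Pulling a closed piece back along `f` restricted to a closed piece gives a closed set; this is
the reason for insisting on closed covers. -/
theorem comp {g : F → G} {f : E → F} (hg : CountablyPiecewise g) (hf : CountablyPiecewise f) :
    CountablyPiecewise fun x => g (f x) := by
  obtain ⟨S, hS, hS', hSf⟩ := hf
  obtain ⟨T, hT, hT', hTg⟩ := hg
  refine ⟨fun k => S k.unpair.1 ∩ f ⁻¹' T k.unpair.2, fun k =>
    (hSf _).preimage_isClosed_of_isClosed (hS _) (hT _), fun x => ?_, fun k =>
    (hTg _).comp ((hSf _).mono inter_subset_left) fun x hx => hx.2⟩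
  obtain ⟨i, hi⟩ := hS' x
  obtain ⟨j, hj⟩ := hT' (f x)
  exact ⟨Nat.pair i j, by simpa using ⟨hi, hj⟩⟩

theorem prodMk {f : E → F} {g : E → G} (hf : CountablyPiecewise f) (hg : CountablyPiecewise g) :
    CountablyPiecewise fun x => (f x, g x) := by
  obtain ⟨S, hS, hS', hSf⟩ := hf
  obtain ⟨T, hT, hT', hTg⟩ := hg
  refine ⟨fun k => S k.unpair.1 ∩ T k.unpair.2, fun k => (hS _).inter (hT _), fun x => ?_,
    fun k => ((hSf _).mono inter_subset_left).prodMk ((hTg _).mono inter_subset_right)⟩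
  obtain ⟨i, hi⟩ := hS' x
  obtain ⟨j, hj⟩ := hT' x
  exact ⟨Nat.pair i j, by simpa using ⟨hi, hj⟩⟩

theorem const (c : F) : CountablyPiecewise fun _ : E => c := of_continuous continuous_const

theorem continuous_comp {g : F → G} {f : E → F} (hg : Continuous g) (hf : CountablyPiecewise f) :
    CountablyPiecewise fun x => g (f x) := (of_continuous hg).comp hf

variable {u v : E → ℝ}

theorem add (hu : CountablyPiecewise u) (hv : CountablyPiecewise v) :
    CountablyPiecewise fun x => u x + v x :=
  continuous_comp (g := fun p : ℝ × ℝ => p.1 + p.2) (by fun_prop) (hu.prodMk hv)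

theorem sub (hu : CountablyPiecewise u) (hv : CountablyPiecewise v) :
    CountablyPiecewise fun x => u x - v x :=
  continuous_comp (g := fun p : ℝ × ℝ => p.1 - p.2) (by fun_prop) (hu.prodMk hv)

theorem mul (hu : CountablyPiecewise u) (hv : CountablyPiecewise v) :
    CountablyPiecewise fun x => u x * v x :=
  continuous_comp (g := fun p : ℝ × ℝ => p.1 * p.2) (by fun_prop) (hu.prodMk hv)

theorem neg (hu : CountablyPiecewise u) : CountablyPiecewise fun x => -u x :=
  continuous_comp (g := fun p : ℝ => -p) (by fun_prop) hu

theorem sum {n : ℕ} {u : Fin n → E → ℝ} (hu : ∀ i, CountablyPiecewise (u i)) :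
    CountablyPiecewise fun x => ∑ i, u i x := by
  classical
  induction (Finset.univ : Finset (Fin n)) using Finset.induction_on with
  | empty => simpa using const (0 : ℝ)
  | insert i s hi ih => simpa [Finset.sum_insert hi] using (hu i).add ih

theorem real_cover (x : ℝ) : ∃ k : ℕ, 1 / ((k : ℝ) + 1) ≤ x ∨ x ≤ 0 := by
  rcases le_or_gt x 0 with h | h
  · exact ⟨0, Or.inr h⟩
  · obtain ⟨k, hk⟩ := exists_nat_one_div_lt h
    exact ⟨k, Or.inl hk.le⟩

theorem ite_pos [∀ x, Decidable (0 < u x)] {f g : E → F} (hu : CountablyPiecewise u)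
    (hf : CountablyPiecewise f) (hg : CountablyPiecewise g) :
    CountablyPiecewise fun x => if 0 < u x then f x else g x := by
  classical
  have key : CountablyPiecewise fun p : ℝ × F × F => if 0 < p.1 then p.2.1 else p.2.2 := by
    refine ⟨fun k => if k = 0 then {p | p.1 ≤ 0} else {p | 1 / (((k - 1 : ℕ) : ℝ) + 1) ≤ p.1},
      fun k => ?_, fun p => ?_, fun k => ?_⟩
    · dsimp only
      split_ifs
      · exact isClosed_le (by fun_prop) (by fun_prop)
      · exact isClosed_le (by fun_prop) (by fun_prop)
    · obtain ⟨k, hk | hk⟩ := real_cover p.1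
      · exact ⟨k + 1, by simpa using hk⟩
      · exact ⟨0, by simpa using hk⟩
    · dsimp only
      split_ifs
      · exact (continuous_snd.comp continuous_snd).continuousOn.congr
          fun p hp => if_neg (not_lt.2 hp)
      · exact (continuous_fst.comp continuous_snd).continuousOn.congr
          fun p hp => if_pos (lt_of_lt_of_le (by positivity) hp)
  convert key.comp (hu.prodMk (hf.prodMk hg)) using 2 with x
  by_cases h : 0 < u x <;> simp [h]

theorem inv (hu : CountablyPiecewise u) : CountablyPiecewise fun x => (u x)⁻¹ := by
  have key : CountablyPiecewise fun p : ℝ => p⁻¹ := by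
    refine ⟨fun k => if k = 0 then {0} else {p | 1 / (((k - 1 : ℕ) : ℝ) + 1) ≤ |p|},
      fun k => ?_, fun p => ?_, fun k => ?_⟩
    · dsimp only
      split_ifs
      · exact isClosed_singleton
      · exact isClosed_le (by fun_prop) (by fun_prop)
    · obtain ⟨k, hk | hk⟩ := real_cover |p|
      · exact ⟨k + 1, by simpa using hk⟩
      · exact ⟨0, by simpa using hk⟩
    · dsimp only
      split_ifs
      · exact continuousOn_singleton _ _
      · exact continuousOn_inv₀.mono fun p hp => abs_pos.1 (lt_of_lt_of_le (by positivity) hp)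
  exact key.comp hu

theorem div (hu : CountablyPiecewise u) (hv : CountablyPiecewise v) :
    CountablyPiecewise fun x => u x / v x := by
  simpa only [div_eq_mul_inv] using hu.mul hv.inv

theorem ite_nonneg [∀ x, Decidable (0 ≤ u x)] {f g : E → F} (hu : CountablyPiecewise u)
    (hf : CountablyPiecewise f) (hg : CountablyPiecewise g) :
    CountablyPiecewise fun x => if 0 ≤ u x then f x else g x := by
  classical
  convert hu.neg.ite_pos hg hf using 2 with x
  by_cases h : 0 ≤ u x
  · rw [if_pos h, if_neg (by linarith)]
  · rw [if_neg h, if_pos (by linarith)]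

theorem isSigmaCompact_preimage [SigmaCompactSpace E] {f : E → F} (hf : CountablyPiecewise f)
    {T : Set F} (hT : IsClosed T) : IsSigmaCompact (f ⁻¹' T) := by
  obtain ⟨S, hS, hS', hSf⟩ := hf
  have e : f ⁻¹' T = ⋃ i, S i ∩ f ⁻¹' T := by
    ext x
    obtain ⟨i, hi⟩ := hS' x
    simp only [mem_iUnion, mem_inter_iff]
    exact ⟨fun h => ⟨i, hi, h⟩, fun ⟨_, _, h⟩ => h⟩
  rw [e]
  exact isSigmaCompact_iUnion _ fun i => isSigmaCompact_univ.of_isClosed_subset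
    ((hSf i).preimage_isClosed_of_isClosed (hS i) hT) (subset_univ _)

/-- Continuous images of σ-compact sets are σ-compact, hence Borel. Projections arising from suprema
over a continuum are thus handled without analytic sets. -/
theorem measurableSet_image [SigmaCompactSpace E] [T2Space G] [MeasurableSpace G]
    [OpensMeasurableSpace G] {f : E → F} (hf : CountablyPiecewise f) {T : Set F} (hT : IsClosed T)
    {π : E → G} (hπ : Continuous π) : MeasurableSet (π '' (f ⁻¹' T)) := by
  obtain ⟨K, hK, e⟩ := (hf.isSigmaCompact_preimage hT).image hπ
  rw [← e]
  exact MeasurableSet.iUnion fun i => (hK i).isClosed.measurableSet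

end CountablyPiecewise

section Estimator

open CountablyPiecewise

variable {E : Type*} [TopologicalSpace E] {u : E → ℝ}

theorem countablyPiecewise_sgn (hu : CountablyPiecewise u) :
    CountablyPiecewise fun x => sgn (u x) := by
  unfold sgn
  exact hu.ite_nonneg (.const _) (.const _)

theorem countablyPiecewise_kernel (hu : CountablyPiecewise u) :
    CountablyPiecewise fun x => kernel (u x) := by
  have h : CountablyPiecewise fun x => |u x| := continuous_comp continuous_abs hu
  have e : (fun x => kernel (u x)) = fun x => if 0 ≤ 1 - |u x| then 1 - |u x| else 0 := by
    funext x; simp [kernel]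
  rw [e]
  exact ((CountablyPiecewise.const 1).sub h).ite_nonneg ((CountablyPiecewise.const 1).sub h)
    (.const 0)

theorem countablyPiecewise_kernelDeriv (hu : CountablyPiecewise u) :
    CountablyPiecewise fun x => kernelDeriv (u x) := by
  have h : CountablyPiecewise fun x => |u x| := continuous_comp continuous_abs hu
  have e : (fun x => kernelDeriv (u x)) = fun x => if 0 < 1 - |u x| then -sgn (u x) else 0 := by
    funext x; simp [kernelDeriv]
  rw [e]
  exact ((CountablyPiecewise.const 1).sub h).ite_pos (countablyPiecewise_sgn hu).neg (.const 0)

variable {n : ℕ} {δ : ℝ} {X : E → Fin n → ℝ} {h z : E → ℝ}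

theorem countablyPiecewise_coord (hX : Continuous X) (i : Fin n) :
    CountablyPiecewise fun x => X x i := .of_continuous (by fun_prop)

theorem countablyPiecewise_kde (hX : Continuous X) (hh : Continuous h) (hz : Continuous z) :
    CountablyPiecewise fun x => kde (X x) (h x) (z x) := by
  unfold kde
  exact (CountablyPiecewise.sum fun i => (of_continuous hh).inv.mul (countablyPiecewise_kernel
    (((of_continuous hz).sub (countablyPiecewise_coord hX i)).div (of_continuous hh)))).div
    (.const _)

theorem countablyPiecewise_kdeDeriv (hX : Continuous X) (hh : Continuous h) (hz : Continuous z) :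
    CountablyPiecewise fun x => kdeDeriv (X x) (h x) (z x) := by
  unfold kdeDeriv
  exact (CountablyPiecewise.sum fun i => (of_continuous (by fun_prop)).inv.mul
    (countablyPiecewise_kernelDeriv
    (((of_continuous hz).sub (countablyPiecewise_coord hX i)).div (of_continuous hh)))).div
    (.const _)

theorem countablyPiecewise_empirical (hX : Continuous X) (hh : Continuous h) (hz : Continuous z) :
    CountablyPiecewise fun x => empirical (X x) (Icc (z x - h x) (z x + h x)) := by
  classical
  unfold empirical
  refine (CountablyPiecewise.sum fun i => ?_).div (.const _)
  have e : (fun x => (Icc (z x - h x) (z x + h x)).indicator (fun _ => (1 : ℝ)) (X x i)) =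
      fun x => if 0 ≤ h x - |X x i - z x| then 1 else 0 := by
    funext x
    have : X x i ∈ Icc (z x - h x) (z x + h x) ↔ 0 ≤ h x - |X x i - z x| := by
      rw [sub_nonneg, abs_le, mem_Icc]
      constructor <;> rintro ⟨a, b⟩ <;> constructor <;> linarith
    simp only [indicator, this]
  rw [e]
  exact (of_continuous (by fun_prop)).ite_nonneg (.const _) (.const _)

theorem countablyPiecewise_bandV (hX : Continuous X) (hh : Continuous h) (hz : Continuous z) :
    CountablyPiecewise fun x => bandV δ (X x) (h x) (z x) := by
  unfold bandV
  exact continuous_comp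
    (g := fun p : ℝ => 3 * √(epsBand n δ * p + epsBand n δ ^ 2) + (1 + 4 * epsBand n δ) / n)
    (by fun_prop) (countablyPiecewise_empirical hX hh hz)

theorem countablyPiecewise_bandM (hX : Continuous X) (hh : Continuous h) (hz : Continuous z)
    {ω : E → ℝ} (hω : CountablyPiecewise ω) :
    CountablyPiecewise fun x => bandM δ (X x) (h x) (ω x) (z x) := by
  unfold bandM
  exact ((of_continuous (by fun_prop)).mul
    (continuous_comp continuous_abs (countablyPiecewise_kdeDeriv hX hh hz))).add
    (((CountablyPiecewise.const 2).mul hω).mul (countablyPiecewise_bandV hX hh hz))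

theorem countablyPiecewise_bandD (hX : Continuous X) (hh : Continuous h) (hz : Continuous z)
    {ω : E → ℝ} (hω : CountablyPiecewise ω) :
    CountablyPiecewise fun x => bandD δ (X x) (h x) (ω x) (z x) := by
  unfold bandD
  exact (of_continuous hh).mul (((((of_continuous (by fun_prop)).mul
    (countablyPiecewise_kde hX hh hz)).add (hω.mul (countablyPiecewise_bandV hX hh hz))).add
    (.const _)).sub (.const _))

theorem countablyPiecewise_bandAt (hX : Continuous X) (hh : Continuous h) (hz : Continuous z)
    (ω : ℝ) : CountablyPiecewise fun x => bandAt δ (X x) (h x) ω (z x) := by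
  classical
  have hD : ∀ {ω : E → ℝ}, CountablyPiecewise ω →
    CountablyPiecewise fun x => bandD δ (X x) (h x) (ω x) (z x) := countablyPiecewise_bandD hX hh hz
  have hM : ∀ {ω : E → ℝ}, CountablyPiecewise ω →
    CountablyPiecewise fun x => bandM δ (X x) (h x) (ω x) (z x) := countablyPiecewise_bandM hX hh hz
  have hτ := countablyPiecewise_sgn (countablyPiecewise_kdeDeriv hX hh hz)
  have hωτ := (CountablyPiecewise.const ω).mul hτ
  have hA := continuous_comp continuous_coe_real_ereal ((hτ.mul (hM hωτ)).div (hD hωτ.neg))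
  have hB := continuous_comp continuous_coe_real_ereal ((hτ.mul (hM hωτ)).div (hD (.const (-1))))
  convert (hD (.const (-1))).ite_pos ((hM (.const (-1))).ite_pos hA hB)
    (.const ((ω : EReal) * ⊤)) using 2 with x
  unfold bandAt
  by_cases h1 : 0 < bandD δ (X x) (h x) (-1) (z x)
  · by_cases h2 : 0 < bandM δ (X x) (h x) (-1) (z x)
    · simp [h1, h2]
    · simp [h1, h2, not_lt.1 h2]
  · simp [h1]

theorem measurable_upperBand :
    Measurable fun p : ℝ × (Fin n → ℝ) => upperBand δ p.2 p.1 := by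
  classical
  refine measurable_of_Iio fun c => ?_
  -- The value `⊤` encodes inadmissible pairs `(z, h)`: they never satisfy `g ≤ q` for rational `q`.
  let g : (ℝ × (Fin n → ℝ)) × ℝ × ℝ → EReal := fun e =>
    if 0 < e.2.2 then
      if 0 ≤ e.1.1 - e.2.1 - e.2.2 then bandAt δ e.1.2 e.2.2 1 e.2.1 else ⊤
    else ⊤
  have hg : CountablyPiecewise g :=
    (of_continuous (by fun_prop)).ite_pos ((of_continuous (by fun_prop)).ite_nonneg
      (countablyPiecewise_bandAt (by fun_prop) (by fun_prop) (by fun_prop) 1) (.const _)) (.const _)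
  have e : (fun p : ℝ × (Fin n → ℝ) => upperBand δ p.2 p.1) ⁻¹' Iio c =
      ⋃ q : {q : ℚ // ((q : ℝ) : EReal) < c}, Prod.fst '' (g ⁻¹' Iic (((q : ℚ) : ℝ) : EReal)) := by
    ext p
    simp only [upperBand, mem_preimage, mem_Iio, sInf_lt_iff, mem_iUnion, mem_image, mem_Iic,
      mem_ofPred_eq]
    constructor
    · rintro ⟨_, ⟨z, h, h0, hz, rfl⟩, hc⟩
      obtain ⟨q, hq, hq'⟩ := EReal.lt_iff_exists_rat_btwn.1 hc
      refine ⟨⟨q, hq'⟩, (p, z, h), ?_, rfl⟩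
      simp only [g]
      rw [if_pos h0, if_pos (by linarith)]
      exact hq.le
    · rintro ⟨⟨q, hq⟩, ⟨p', z, h⟩, hle, rfl⟩
      have hlt := lt_of_le_of_lt hle (EReal.coe_lt_top _)
      simp only [g] at hle hlt
      split_ifs at hle hlt with h0 h1
      · exact ⟨_, ⟨z, h, h0, by linarith, rfl⟩, hle.trans_lt hq⟩
      · exact absurd hlt (lt_irrefl _)
      · exact absurd hlt (lt_irrefl _)
  rw [e]
  exact MeasurableSet.iUnion fun q => hg.measurableSet_image isClosed_Iic continuous_fst

theorem measurable_lowerBand :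
    Measurable fun p : ℝ × (Fin n → ℝ) => lowerBand δ p.2 p.1 := by
  classical
  refine measurable_of_Ioi fun c => ?_
  let g : (ℝ × (Fin n → ℝ)) × ℝ × ℝ → EReal := fun e =>
    if 0 < e.2.2 then
      if 0 ≤ e.2.1 - e.1.1 - e.2.2 then bandAt δ e.1.2 e.2.2 (-1) e.2.1 else ⊥
    else ⊥
  have hg : CountablyPiecewise g :=
    (of_continuous (by fun_prop)).ite_pos ((of_continuous (by fun_prop)).ite_nonneg
      (countablyPiecewise_bandAt (by fun_prop) (by fun_prop) (by fun_prop) (-1)) (.const _))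
      (.const _)
  have e : (fun p : ℝ × (Fin n → ℝ) => lowerBand δ p.2 p.1) ⁻¹' Ioi c =
      ⋃ q : {q : ℚ // c < ((q : ℝ) : EReal)}, Prod.fst '' (g ⁻¹' Ici (((q : ℚ) : ℝ) : EReal)) := by
    ext p
    simp only [lowerBand, mem_preimage, mem_Ioi, lt_sSup_iff, mem_iUnion, mem_image, mem_Ici,
      mem_ofPred_eq]
    constructor
    · rintro ⟨_, ⟨z, h, h0, hz, rfl⟩, hc⟩
      obtain ⟨q, hq, hq'⟩ := EReal.lt_iff_exists_rat_btwn.1 hc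
      refine ⟨⟨q, hq⟩, (p, z, h), ?_, rfl⟩
      simp only [g]
      rw [if_pos h0, if_pos (by linarith)]
      exact hq'.le
    · rintro ⟨⟨q, hq⟩, ⟨p', z, h⟩, hle, rfl⟩
      have hlt := lt_of_lt_of_le (EReal.bot_lt_coe _) hle
      simp only [g] at hle hlt
      split_ifs at hle hlt with h0 h1
      · exact ⟨_, ⟨z, h, h0, by linarith, rfl⟩, hq.trans_le hle⟩
      · exact absurd hlt (lt_irrefl _)
      · exact absurd hlt (lt_irrefl _)
  rw [e]
  exact MeasurableSet.iUnion fun q => hg.measurableSet_image isClosed_Ici continuous_fst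

theorem measurable_multiscale (n : ℕ) (δ : ℝ) :
    Measurable fun p : ℝ × (Fin n → ℝ) => multiscale n δ p.1 p.2 := by
  unfold multiscale
  exact Measurable.ite (measurableSet_lt measurable_const measurable_lowerBand)
    measurable_lowerBand (Measurable.ite (measurableSet_lt measurable_upperBand measurable_const)
      measurable_upperBand measurable_const)

end Estimator

end ScoreEstimation

namespace ScoreEstimation

open Set Filter Topology

open ProbabilityTheory FullLaw

/-! ### Rates -/

theorem one_le_logPlus (x : ℝ) : 1 ≤ logPlus x := le_max_left _ _

/-- Writing every positive variable as an exponential reduces the claim to a linear identity between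
exponents. -/
theorem rate_identity {β L ε s Λ κ : ℝ} (hβ : 1 ≤ β) (hL : 0 < L) (hε : 0 < ε) (hs : 0 < s)
    (hΛ : 0 < Λ) (hκ : 0 < κ) :
    √(κ * ε) * (4 * L ^ 2 / (κ * ε)) ^ (1 / (2 * (2 * β + 1))) *
        (s / (L ^ (1 / β) * Λ ^ ((β - 1) / β))) ^ ((β + 1) / (2 * β + 1) - 1) =
      √κ * (4 / κ) ^ (1 / (2 * (2 * β + 1))) *
        ((L ^ (2 / β) / s * ε) ^ (β / (2 * β + 1)) * Λ ^ ((β - 1) / (2 * β + 1))) := by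
  have h4 : (4 : ℝ) = Real.exp (Real.log 4) := (Real.exp_log (by norm_num)).symm
  rw [h4, ← Real.exp_log hL, ← Real.exp_log hε, ← Real.exp_log hs, ← Real.exp_log hΛ,
    ← Real.exp_log hκ, ← Real.exp_nat_mul]
  simp only [Real.sqrt_eq_rpow, ← Real.exp_mul, ← Real.exp_add, ← Real.exp_sub]
  congr 1
  have : 2 * β + 1 ≠ 0 := by positivity
  push_cast
  field_simp
  ring

/-- The rate of the error integral over the bulk of the distribution. -/
theorem bulk_rate_le {β L ε s Λ : ℝ} (hβ : 1 ≤ β) (hL : 0 < L) (hε : 0 < ε) (hs : 0 < s)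
    (hΛ : 0 < Λ) :
    √(32 * 40 ^ 2 * ε) * (4 * L ^ 2 / (32 * 40 ^ 2 * ε)) ^ (1 / (2 * (2 * β + 1))) *
        (s / (L ^ (1 / β) * Λ ^ ((β - 1) / β))) ^ ((β + 1) / (2 * β + 1) - 1) ≤
      300 * ((L ^ (2 / β) / s * ε) ^ (β / (2 * β + 1)) * Λ ^ ((β - 1) / (2 * β + 1))) := by
  rw [rate_identity hβ hL hε hs hΛ (by norm_num)]
  refine mul_le_mul_of_nonneg_right ?_ (by positivity)
  have h1 : √(32 * 40 ^ 2) ≤ 300 := Real.sqrt_le_iff.2 (by norm_num)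
  have h2 : (4 / (32 * 40 ^ 2) : ℝ) ^ (1 / (2 * (2 * β + 1))) ≤ 1 :=
    Real.rpow_le_one (by norm_num) (by norm_num) (by positivity)
  exact (mul_le_of_le_one_right (Real.sqrt_nonneg _) h2).trans h1

/-- Two logarithms cost at most `16 * ε ^ (-1/2)`, so the second term of the rate is dominated by
the first, whose exponent is below `1/2`. -/
theorem mul_logPlus_rpow_le {ε q : ℝ} (hε : 0 < ε) (hε1 : ε ≤ 1) (hq : q ≤ 2) {b : ℝ}
    (hb : b ≤ 1 / 2) : ε * logPlus (1 / ε) ^ q ≤ 16 * ε ^ b := by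
  have h1 := one_le_logPlus (1 / ε)
  have h2 : logPlus (1 / ε) ≤ 4 * ε ^ (-(1 / 4 : ℝ)) := by
    have h3 : 1 ≤ ε ^ (-(1 / 4 : ℝ)) :=
      Real.one_le_rpow_of_pos_of_le_one_of_nonpos hε hε1 (by norm_num)
    refine max_le (by linarith) ?_
    have h4 := Real.log_le_rpow_div (x := 1 / ε) (by positivity) (show (0 : ℝ) < 1 / 4 by norm_num)
    rw [one_div, Real.inv_rpow hε.le, ← Real.rpow_neg hε.le] at h4
    rw [one_div]
    linarith
  calc ε * logPlus (1 / ε) ^ q ≤ ε * (4 * ε ^ (-(1 / 4 : ℝ))) ^ 2 := by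
        refine mul_le_mul_of_nonneg_left ?_ hε.le
        refine (Real.rpow_le_rpow_of_exponent_le h1 hq).trans ?_
        rw [Real.rpow_two]
        exact pow_le_pow_left₀ (by linarith) h2 2
    _ = 16 * ε ^ (1 / 2 : ℝ) := by
        have e : ε * (ε ^ (-(1 / 4 : ℝ))) ^ 2 = ε ^ (1 / 2 : ℝ) := by
          rw [← Real.rpow_natCast, ← Real.rpow_mul hε.le]
          nth_rewrite 1 [← Real.rpow_one ε]
          rw [← Real.rpow_add hε]
          norm_num
        rw [mul_pow, ← e]; ring
    _ ≤ 16 * ε ^ b := by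
        refine mul_le_mul_of_nonneg_left ?_ (by norm_num)
        exact Real.rpow_le_rpow_of_exponent_ge hε hε1 hb

theorem holderRate_self_le {β L ε : ℝ} (hβ : β ∈ Icc (1 : ℝ) 2) (hL : 0 < L) (hε : 0 < ε) :
    holderRate β L (L ^ (2 / β)) ε ≤ 17 * (L ^ (2 / β) * min ε 1 ^ (β / (2 * β + 1))) := by
  have hβ0 : 0 < β := by linarith [hβ.1]
  have hLp : 0 < L ^ (2 / β) := Real.rpow_pos_of_pos hL _
  have hlog : logPlus 1 = 1 := by simp [logPlus]
  unfold holderRate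
  rw [div_self hLp.ne', one_mul, hlog, Real.one_rpow, mul_one]
  rcases le_total ε 1 with h | h
  · rw [min_eq_left h]
    have h1 := mul_logPlus_rpow_le (q := 3 - 2 / β) (b := β / (2 * β + 1)) hε h
      (by have : 1 ≤ 2 / β := by rw [le_div_iff₀ hβ0]; linarith [hβ.2]
          linarith) (by rw [div_le_div_iff₀ (by positivity) (by norm_num)]; linarith)
    have h2 := min_le_left (ε ^ (β / (2 * β + 1)) + ε * logPlus (1 / ε) ^ (3 - 2 / β)) 1
    nlinarith
  · rw [min_eq_right h, Real.one_rpow]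
    have h2 := min_le_right (ε ^ (β / (2 * β + 1)) + ε * logPlus (1 / ε) ^ (3 - 2 / β)) 1
    nlinarith

/-! ### From the two half lines to the whole line -/

theorem setLIntegral_neg (g : ℝ → ENNReal) (S : Set ℝ) :
    ∫⁻ x in S, g x = ∫⁻ x in {x | -x ∈ S}, g (-x) :=
  ((Measure.measurePreserving_neg (volume : Measure ℝ)).setLIntegral_comp_preimage_emb
    (MeasurableEquiv.neg ℝ).measurableEmbedding g S).symm

theorem lintegral_sq_error_le {f ψ e : ℝ → ℝ} (hψ : Measurable ψ) (h0 : ∀ x, ψ x = 0 → e x = 0) :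
    ∫⁻ x, ENNReal.ofReal ((e x - ψ x) ^ 2 * f x) ≤
      (∫⁻ x in {x | 0 < ψ x}, ENNReal.ofReal ((ψ x - e x) ^ 2 * f x)) +
        ∫⁻ x in {x | 0 < -ψ (-x)}, ENNReal.ofReal ((-ψ (-x) - -e (-x)) ^ 2 * f (-x)) := by
  set g : ℝ → ENNReal := fun x => ENNReal.ofReal ((e x - ψ x) ^ 2 * f x) with hg
  have hp : MeasurableSet {x | 0 < ψ x} := measurableSet_lt measurable_const hψ
  have hm : MeasurableSet {x | 0 < -ψ x} := measurableSet_lt measurable_const hψ.neg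
  have h1 : ∫⁻ x, g x = ∫⁻ x in {x | 0 < ψ x} ∪ {x | 0 < -ψ x}, g x := by
    rw [← lintegral_indicator (hp.union hm)]
    congr 1
    refine (indicator_eq_self.2 fun x hx => ?_).symm
    rcases lt_trichotomy (ψ x) 0 with h | h | h
    · exact Or.inr (show 0 < -ψ x by linarith)
    · exact absurd (by simp [hg, h, h0 x h]) hx
    · exact Or.inl h
  have h2 : ∫⁻ x in {x | 0 < -ψ (-x)}, ENNReal.ofReal ((-ψ (-x) - -e (-x)) ^ 2 * f (-x)) =
      ∫⁻ x in {x | 0 < -ψ x}, g x := by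
    rw [setLIntegral_neg g]
    refine lintegral_congr fun x => ?_
    simp only [hg]
    congr 2
    ring
  have h3 : ∫⁻ x in {x | 0 < ψ x}, ENNReal.ofReal ((ψ x - e x) ^ 2 * f x) =
      ∫⁻ x in {x | 0 < ψ x}, g x := by
    refine lintegral_congr fun x => ?_
    simp only [hg]
    congr 2
    ring
  rw [h1, h2, h3]
  exact lintegral_union_le _ _ _

theorem abs_coe_sub_coe_sq_mul (a b c : ℝ) :
    ((a : EReal) - (b : EReal)).abs ^ 2 * ENNReal.ofReal c = ENNReal.ofReal ((a - b) ^ 2 * c) := by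
  rw [← EReal.coe_sub, EReal.abs_def, ← ENNReal.ofReal_pow (abs_nonneg _), sq_abs,
    ENNReal.ofReal_mul (sq_nonneg _)]

theorem fisherInformation_eq {f : ℝ → ℝ} {β L : ℝ} (hf : f ∈ holderClass β L) :
    fisherInformation f = ∫⁻ x, ENNReal.ofReal ((score f x).toReal ^ 2 * f x) := by
  refine lintegral_congr fun x => ?_
  have := abs_coe_sub_coe_sq_mul (score f x).toReal 0 (f x)
  rwa [EReal.coe_zero, sub_zero, coe_toReal_score hf, sub_zero] at this

theorem loss_coe_eq {f : ℝ → ℝ} {β L : ℝ} (hf : f ∈ holderClass β L) (e : ℝ → ℝ) :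
    loss f (fun x => (e x : EReal)) (score f) =
      ∫⁻ x, ENNReal.ofReal ((e x - (score f x).toReal) ^ 2 * f x) := by
  refine lintegral_congr fun x => ?_
  rw [← abs_coe_sub_coe_sq_mul, coe_toReal_score hf]

/-! ### Loss of the estimator on the event of valid interval bounds. -/

section Loss

variable {n : ℕ} {δ : ℝ} {X : Fin n → ℝ} {f ψ : ℝ → ℝ} {β L s : ℝ}

/-- The truncated estimator never does worse than the Fisher information. -/
theorem sq_error_le_fisher (hs : HolderScore f ψ β L)
    (hX : IntervalBounds (densityLaw f) δ X) (he : 0 < epsBand n δ) (hs0 : 0 ≤ s)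
    (hl : ∫⁻ x in {x | 0 < ψ x}, ENNReal.ofReal (ψ x ^ 2 * f x) ≤ ENNReal.ofReal (36 * s))
    (hr : ∫⁻ x in {x | 0 < -ψ (-x)}, ENNReal.ofReal ((-ψ (-x)) ^ 2 * f (-x)) ≤
      ENNReal.ofReal (36 * s)) :
    ∫⁻ x, ENNReal.ofReal (((multiscale n δ x X).toReal - ψ x) ^ 2 * f x) ≤
      ENNReal.ofReal (72 * s) := by
  refine (lintegral_sq_error_le hs.measurable fun x hx => ?_).trans ?_
  · have h := toReal_multiscale_mem_of_pos hs hX he hx.ge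
    exact le_antisymm (h.2.trans hx.le) h.1
  · have e : ENNReal.ofReal (72 * s) = ENNReal.ofReal (36 * s) + ENNReal.ofReal (36 * s) := by
      rw [← ENNReal.ofReal_add (by positivity) (by positivity)]; ring_nf
    rw [e]
    refine add_le_add (le_trans ?_ hl) (le_trans ?_ hr)
    · refine setLIntegral_mono' (measurableSet_lt measurable_const hs.measurable) fun x hx =>
        ENNReal.ofReal_le_ofReal (mul_le_mul_of_nonneg_right ?_ (hs.pos x).le)
      have h := toReal_multiscale_mem_of_pos hs hX he (le_of_lt hx)
      exact pow_le_pow_left₀ (by linarith [h.2]) (by linarith [h.1]) 2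
    · refine setLIntegral_mono' (measurableSet_lt measurable_const hs.reflect.measurable)
        fun x hx => ENNReal.ofReal_le_ofReal (mul_le_mul_of_nonneg_right ?_ (hs.pos _).le)
      have h := toReal_multiscale_mem_of_neg hs hX he
        (show ψ (-x) ≤ 0 by have : 0 < -ψ (-x) := hx; linarith)
      exact pow_le_pow_left₀ (by linarith [h.1]) (by linarith [h.2]) 2

/-- The one-sided bound with the constants of the confidence band. -/
theorem loss_left_rate (hs : HolderScore f ψ β L) (hβ : β ∈ Icc (1 : ℝ) 2) (hL : 0 < L) {ε : ℝ}
    (hε : 0 < ε) (hs0 : 0 < s)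
    (hF : ∫⁻ x in {x | 0 < ψ x}, ENNReal.ofReal (ψ x ^ 2 * f x) ≤ ENNReal.ofReal (36 * s))
    {d : ℝ → ℝ} (hd0 : ∀ x, 0 < ψ x → 0 ≤ d x) (hd : ∀ x, 0 < ψ x → d x ≤ ψ x)
    (hband : ∀ x, 0 < ψ x → ∀ b, 0 < b → 2 * b * ψ x ≤ 1 → 0 ≤ ψ (x + 2 * b) →
      1000 * ε ≤ b * f x → d x ≤ ψ x - ψ (x + 2 * b) + 40 * √(ε / (f x * b ^ 3))) :
    ∫⁻ x in {x | 0 < ψ x}, ENNReal.ofReal (d x ^ 2 * f x) ≤ ENNReal.ofReal (5 * 10 ^ 8 * (s *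
      ((L ^ (2 / β) / s * ε) ^ (β / (2 * β + 1)) *
          logPlus (L ^ (2 / β) / s) ^ ((β - 1) / (2 * β + 1)) +
        L ^ (2 / β) / s * ε * logPlus (1 / ε) ^ (3 - 2 / β)))) := by
  refine (hs.loss_left_le hβ.1 hβ.2 hL hε (by norm_num) (by norm_num) hs0 (by norm_num) hF hd0 hd
    hband).trans ?_
  have hβ0 : 0 < β := by linarith [hβ.1]
  have hΛ := one_le_logPlus (L ^ (2 / β) / s)
  have hl := one_le_logPlus (1 / ε)
  have hbulk := bulk_rate_le (β := β) (Λ := logPlus (L ^ (2 / β) / s)) hβ.1 hL hε hs0 (by linarith)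
  have hLp : 0 < L ^ (2 / β) := Real.rpow_pos_of_pos hL _
  have hq : logPlus (1 / ε) ≤ logPlus (1 / ε) ^ (3 - 2 / β) := by
    refine Real.self_le_rpow_of_one_le hl ?_
    have : 2 / β ≤ 2 := div_le_self (by norm_num) hβ.1
    linarith
  set Λ := logPlus (L ^ (2 / β) / s)
  set ℓ := logPlus (1 / ε)
  set A := (L ^ (2 / β) / s * ε) ^ (β / (2 * β + 1)) * Λ ^ ((β - 1) / (2 * β + 1)) with hA
  set T := (s / (L ^ (1 / β) * Λ ^ ((β - 1) / β))) ^ ((β + 1) / (2 * β + 1) - 1)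
  set U := (4 * L ^ 2 / (32 * 40 ^ 2 * ε)) ^ (1 / (2 * (2 * β + 1)))
  have hA0 : 0 ≤ A := by positivity
  have hT0 : 0 ≤ T := by positivity
  have hU0 : 0 ≤ U := by positivity
  have hS0 := Real.sqrt_nonneg (32 * 40 ^ 2 * ε)
  set R := √(32 * 40 ^ 2 * ε)
  set W := L ^ (2 / β) * ε * ℓ ^ (3 - 2 / β) with hW
  have hW0 : 0 ≤ W := by positivity
  have eW : s * (L ^ (2 / β) / s * ε * ℓ ^ (3 - 2 / β)) = W := by rw [hW]; field_simp
  rw [mul_add s, eW]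
  have h2 : (2 : ENNReal) = ENNReal.ofReal 2 := by simp
  rw [h2, ← ENNReal.ofReal_mul (by norm_num), ← ENNReal.ofReal_add (by positivity) (by positivity),
    ← ENNReal.ofReal_add (by positivity) (by positivity)]
  refine ENNReal.ofReal_le_ofReal ?_
  have t1 : L ^ (2 / β) * ε * ℓ ≤ W := mul_le_mul_of_nonneg_left hq (by positivity)
  have t2 : (32 * 40 ^ 2 + 3 * 1000 ^ 2) * ε * (72 * (L ^ (2 / β) * ℓ ^ (3 - 2 / β))) =
      (32 * 40 ^ 2 + 3 * 1000 ^ 2) * 72 * W := by rw [hW]; ring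
  have t3 : 6 * R * U * ((80 + 36) * (s * T)) = 696 * (s * (R * U * T)) := by ring
  have t4 : s * (R * U * T) ≤ s * (300 * A) := mul_le_mul_of_nonneg_left hbulk hs0.le
  have t5 : 0 ≤ s * A := by positivity
  rw [t2, t3]
  linarith

theorem sq_error_le_rate (hs : HolderScore f ψ β L) (hβ : β ∈ Icc (1 : ℝ) 2) (hL : 0 < L)
    (hn : 3 ≤ n) (hδ : δ ∈ Ioo (0 : ℝ) 1) (hε1 : eps n δ ≤ 1)
    (hX : IntervalBounds (densityLaw f) δ X) (hs0 : 0 < s)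
    (hl : ∫⁻ x in {x | 0 < ψ x}, ENNReal.ofReal (ψ x ^ 2 * f x) ≤ ENNReal.ofReal (36 * s))
    (hr : ∫⁻ x in {x | 0 < -ψ (-x)}, ENNReal.ofReal ((-ψ (-x)) ^ 2 * f (-x)) ≤
      ENNReal.ofReal (36 * s)) :
    ∫⁻ x, ENNReal.ofReal (((multiscale n δ x X).toReal - ψ x) ^ 2 * f x) ≤
      ENNReal.ofReal (10 ^ 9 * (s *
      ((L ^ (2 / β) / s * eps n δ) ^ (β / (2 * β + 1)) *
          logPlus (L ^ (2 / β) / s) ^ ((β - 1) / (2 * β + 1)) +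
        L ^ (2 / β) / s * eps n δ * logPlus (1 / eps n δ) ^ (3 - 2 / β)))) := by
  have hε := eps_pos hn hδ
  have he := epsBand_nonneg_of hε
  refine (lintegral_sq_error_le hs.measurable fun x hx => ?_).trans ?_
  · have h := toReal_multiscale_mem_of_pos hs hX he hx.ge
    exact le_antisymm (h.2.trans hx.le) h.1
  have h1 := loss_left_rate hs hβ hL hε hs0 hl (d := fun x => ψ x - (multiscale n δ x X).toReal)
    (fun x hx => by linarith [(toReal_multiscale_mem_of_pos hs hX he hx.le).2])
    (fun x hx => by linarith [(toReal_multiscale_mem_of_pos hs hX he hx.le).1])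
    (fun x hx b hb hb1 hb2 hb3 => multiscale_accuracy_left hs hn hδ hε1 hX hx hb hb1 hb2 hb3)
  have h2 := loss_left_rate hs.reflect hβ hL hε hs0 hr
    (d := fun x => -ψ (-x) - -(multiscale n δ (-x) X).toReal)
    (fun x hx => by linarith [(toReal_multiscale_mem_of_neg hs hX he (x := -x) (by linarith)).1])
    (fun x hx => by linarith [(toReal_multiscale_mem_of_neg hs hX he (x := -x) (by linarith)).2])
    (fun x hx b hb hb1 hb2 hb3 => by
      rw [show -(x + 2 * b) = -x - 2 * b by ring] at hb2 ⊢
      exact multiscale_accuracy_right hs hn hδ hε1 hX hx hb hb1 hb2 hb3)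
  have hΛ := one_le_logPlus (L ^ (2 / β) / s)
  have hℓ := one_le_logPlus (1 / eps n δ)
  refine (add_le_add h1 h2).trans ?_
  rw [← ENNReal.ofReal_add (by positivity) (by positivity)]
  refine ENNReal.ofReal_le_ofReal (le_of_eq ?_)
  ring

theorem sq_error_le_holderRate (hs : HolderScore f ψ β L) (hβ : β ∈ Icc (1 : ℝ) 2) (hL : 0 < L)
    (hn : 3 ≤ n) (hδ : δ ∈ Ioo (0 : ℝ) 1)
    (hX : IntervalBounds (densityLaw f) δ X) (hs0 : 0 < s) (hsL : s ≤ L ^ (2 / β))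
    (hl : ∫⁻ x in {x | 0 < ψ x}, ENNReal.ofReal (ψ x ^ 2 * f x) ≤ ENNReal.ofReal (36 * s))
    (hr : ∫⁻ x in {x | 0 < -ψ (-x)}, ENNReal.ofReal ((-ψ (-x)) ^ 2 * f (-x)) ≤
      ENNReal.ofReal (36 * s)) :
    ∫⁻ x, ENNReal.ofReal (((multiscale n δ x X).toReal - ψ x) ^ 2 * f x) ≤
      ENNReal.ofReal (10 ^ 9 * holderRate β L s (eps n δ)) := by
  have hε := eps_pos hn hδ
  have hβ0 : 0 < β := by linarith [hβ.1]
  unfold holderRate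
  have hΛ := one_le_logPlus (L ^ (2 / β) / s)
  have hℓ := one_le_logPlus (1 / eps n δ)
  rcases le_total ((L ^ (2 / β) / s * eps n δ) ^ (β / (2 * β + 1)) *
      logPlus (L ^ (2 / β) / s) ^ ((β - 1) / (2 * β + 1)) +
      L ^ (2 / β) / s * eps n δ * logPlus (1 / eps n δ) ^ (3 - 2 / β)) 1 with h | h
  -- Since `s ≤ L ^ (2/β)`, a noise level above one would push the second term of the rate above
  -- one.
  · have hε1 : eps n δ ≤ 1 := by
      by_contra! hc
      have h1 : 1 ≤ L ^ (2 / β) / s := (one_le_div hs0).2 hsL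
      have h2 : 1 ≤ logPlus (1 / eps n δ) ^ (3 - 2 / β) :=
        Real.one_le_rpow hℓ (by linarith [div_le_self (show (0 : ℝ) ≤ 2 by norm_num) hβ.1])
      have h3 : 0 ≤ (L ^ (2 / β) / s * eps n δ) ^ (β / (2 * β + 1)) *
        logPlus (L ^ (2 / β) / s) ^ ((β - 1) / (2 * β + 1)) := by positivity
      have h4 : 1 < L ^ (2 / β) / s * eps n δ := by nlinarith
      nlinarith
    rw [min_eq_left h]
    exact sq_error_le_rate hs hβ hL hn hδ hε1 hX hs0 hl hr
  · rw [min_eq_right h, mul_one]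
    refine (sq_error_le_fisher hs hX (epsBand_nonneg_of hε) hs0.le hl hr).trans
      (ENNReal.ofReal_le_ofReal ?_)
    linarith

end Loss

/-! ### Quantiles -/

section Quantile

variable {n : ℕ} {δ β L r : ℝ} {f : ℝ → ℝ}

theorem half_fisher_le (hβ : 1 ≤ β) (hL : 0 < L) (hr : 0 ≤ r)
    (hf : f ∈ holderFisherClass β L r) :
    ∫⁻ x in {x | 0 < (score f x).toReal}, ENNReal.ofReal ((score f x).toReal ^ 2 * f x) ≤
        ENNReal.ofReal (36 * min r (L ^ (2 / β))) ∧
      ∫⁻ x in {x | 0 < -(score f (-x)).toReal},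
          ENNReal.ofReal ((-(score f (-x)).toReal) ^ 2 * f (-x)) ≤
        ENNReal.ofReal (36 * min r (L ^ (2 / β))) := by
  have hs := holderScore_of_mem hL hf.1
  have hF := hf.2
  rw [fisherInformation_eq hf.1] at hF
  have hr36 : ENNReal.ofReal r ≤ ENNReal.ofReal (36 * r) := ENNReal.ofReal_le_ofReal (by linarith)
  have key : ∀ {a : ENNReal}, a ≤ ENNReal.ofReal r → a ≤ ENNReal.ofReal (36 * L ^ (2 / β)) →
      a ≤ ENNReal.ofReal (36 * min r (L ^ (2 / β))) := by
    intro a h1 h2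
    rcases min_cases r (L ^ (2 / β)) with h | h
    · rw [h.1]; exact h1.trans hr36
    · rw [h.1]; exact h2
  refine ⟨key ((setLIntegral_le_lintegral _ _).trans hF) (hs.fisher_left_le hβ hL), key ?_
    (hs.reflect.fisher_left_le hβ hL)⟩
  have h := (setLIntegral_neg (fun x => ENNReal.ofReal ((score f x).toReal ^ 2 * f x)) univ).symm
  simp only [mem_univ, ofPred_true, Measure.restrict_univ] at h
  simp only [neg_sq]
  exact (setLIntegral_le_lintegral _ _).trans (h.le.trans hF)

theorem loss_le_holderRate (hβ : β ∈ Icc (1 : ℝ) 2) (hL : 0 < L) (hn : 3 ≤ n)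
    (hδ : δ ∈ Ioo (0 : ℝ) 1) (hr : 0 < r) (hf : f ∈ holderFisherClass β L r)
    {X : Fin n → ℝ} (hX : IntervalBounds (densityLaw f) δ X) :
    loss f (fun x => ((multiscale n δ x X).toReal : EReal)) (score f) ≤
      ENNReal.ofReal (10 ^ 9 * holderRate β L (min r (L ^ (2 / β))) (eps n δ)) := by
  rw [loss_coe_eq hf.1]
  obtain ⟨h1, h2⟩ := half_fisher_le hβ.1 hL hr.le hf
  exact sq_error_le_holderRate (holderScore_of_mem hL hf.1) hβ hL hn hδ hX
    (lt_min hr (Real.rpow_pos_of_pos hL _)) (min_le_right _ _) h1 h2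

/-- The zero estimator has the Fisher information as its loss, so the two half-line bounds `36 * L ^
(2 / β)` add up. -/
theorem mem_holderFisherClass_of_mem (hβ : 1 ≤ β) (hL : 0 < L) (hf : f ∈ holderClass β L) :
    f ∈ holderFisherClass β L (72 * L ^ (2 / β)) := by
  have hs := holderScore_of_mem hL hf
  have hLp : 0 < L ^ (2 / β) := Real.rpow_pos_of_pos hL _
  refine ⟨hf, ?_⟩
  have h := lintegral_sq_error_le (f := f) (e := 0) hs.measurable fun _ _ => rfl
  simp only [Pi.zero_apply, zero_sub, sub_zero, neg_zero, neg_sq] at h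
  rw [fisherInformation_eq hf]
  have h1 := hs.fisher_left_le hβ hL
  have h2 := hs.reflect.fisher_left_le hβ hL
  simp only [neg_sq] at h2
  refine (h.trans (add_le_add h1 h2)).trans ?_
  rw [← ENNReal.ofReal_add (by positivity) (by positivity)]
  exact ENNReal.ofReal_le_ofReal (by linarith)

theorem loss_le_of_mem_holderClass (hβ : β ∈ Icc (1 : ℝ) 2) (hL : 0 < L) (hn : 3 ≤ n)
    (hδ : δ ∈ Ioo (0 : ℝ) 1) (hf : f ∈ holderClass β L)
    {X : Fin n → ℝ} (hX : IntervalBounds (densityLaw f) δ X) :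
    loss f (fun x => ((multiscale n δ x X).toReal : EReal)) (score f) ≤
      ENNReal.ofReal (17 * 10 ^ 9 * (L ^ (2 / β) * min (eps n δ) 1 ^ (β / (2 * β + 1)))) := by
  have hLp : 0 < L ^ (2 / β) := Real.rpow_pos_of_pos hL _
  refine (loss_le_holderRate hβ hL hn hδ (by positivity)
    (mem_holderFisherClass_of_mem hβ.1 hL hf) hX).trans (ENNReal.ofReal_le_ofReal ?_)
  rw [min_eq_right (by linarith)]
  linarith [holderRate_self_le hβ hL (eps_pos hn hδ)]

theorem lossQuantile_le (hL : 0 < L) (hn : 3 ≤ n) (hδ : δ ∈ Ioo (0 : ℝ) 1)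
    (hf : f ∈ holderClass β L) {ψ : ℝ → (Fin n → ℝ) → EReal} {b : ℝ}
    (h : ∀ X, IntervalBounds (densityLaw f) δ X →
      loss f (fun x => ψ x X) (score f) ≤ ENNReal.ofReal b) :
    lossQuantile n δ f ψ ≤ ENNReal.ofReal b := by
  have := (holderScore_of_mem hL hf).fullLaw
  exact sInf_le ⟨ENNReal.ofReal_ne_top,
    (ofReal_le_measure_intervalBounds (densityLaw f) hn hδ).trans (measure_mono h)⟩

theorem toReal_multiscale_mem_estimators (n : ℕ) (δ : ℝ) :
    (fun x X => (multiscale n δ x X).toReal) ∈ estimators n :=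
  (measurable_multiscale n δ).ereal_toReal

/-- The minimax infimum runs over real-valued estimators, so the real part of `multiscale` serves
there; on the event the two agree. -/
theorem quantile_bounds (hL : 0 < L) (hn : 3 ≤ n) (hδ : δ ∈ Ioo (0 : ℝ) 1)
    {G : Set (ℝ → ℝ)} (hG : G ⊆ holderClass β L) {b : ℝ}
    (h : ∀ f ∈ G, ∀ X : Fin n → ℝ, IntervalBounds (densityLaw f) δ X →
      loss f (fun x => ((multiscale n δ x X).toReal : EReal)) (score f) ≤ ENNReal.ofReal b) :
    minimaxQuantile n δ G ≤ ENNReal.ofReal b ∧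
      worstQuantile n δ G (multiscale n δ) ≤ ENNReal.ofReal b := by
  refine ⟨iInf₂_le_of_le _ (toReal_multiscale_mem_estimators n δ) (iSup₂_le fun f hf =>
    lossQuantile_le hL hn hδ (hG hf) (h f hf)), iSup₂_le fun f hf =>
    lossQuantile_le hL hn hδ (hG hf) fun X hX => ?_⟩
  have := h f hf X hX
  simpa only [coe_toReal_multiscale (holderScore_of_mem hL (hG hf)) hX
    (epsBand_nonneg_of (eps_pos hn hδ))] using this

theorem holderRate_nonneg {s ε : ℝ} (hL : 0 < L) (hs : 0 < s) (hε : 0 < ε) :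
    0 ≤ holderRate β L s ε := by
  have hΛ := one_le_logPlus (L ^ (2 / β) / s)
  have hℓ := one_le_logPlus (1 / ε)
  unfold holderRate
  positivity

end Quantile

end ScoreEstimation

theorem theorem4 (β : ℝ) (hβ : β ∈ Set.Icc (1 : ℝ) 2) :
    ∃ C : ℝ, 0 < C ∧ ∀ n : ℕ, 3 ≤ n → ∀ δ ∈ Set.Ioo (0 : ℝ) 1,
      Measurable (fun p : ℝ × (Fin n → ℝ) => multiscale n δ p.1 p.2) ∧
      ∀ L : ℝ, 0 < L →
        (∀ r : ℝ, 0 < r →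
          minimaxQuantile n δ (holderFisherClass β L r)
              ≤ ENNReal.ofReal (C * holderRate β L (min r (L ^ (2 / β))) (eps n δ)) ∧
          worstQuantile n δ (holderFisherClass β L r) (multiscale n δ)
              ≤ ENNReal.ofReal (C * holderRate β L (min r (L ^ (2 / β))) (eps n δ))) ∧
        minimaxQuantile n δ (holderClass β L)
            ≤ ENNReal.ofReal (C * (L ^ (2 / β) * (min (eps n δ) 1) ^ (β / (2 * β + 1)))) ∧
        worstQuantile n δ (holderClass β L) (multiscale n δ)
            ≤ ENNReal.ofReal (C * (L ^ (2 / β) * (min (eps n δ) 1) ^ (β / (2 * β + 1)))) := by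
  -- One constant serves all `β`: `10 ^ 9` is the loss constant, and `17 = 1 + 16` comes from
  -- specialising the rate to `s = L ^ (2 / β)`.
  refine ⟨17 * 10 ^ 9, by norm_num, fun n hn δ hδ => ⟨measurable_multiscale n δ, fun L hL =>
    ⟨fun r hr => ?_, ?_⟩⟩⟩
  · refine quantile_bounds hL hn hδ (fun f hf => hf.1) fun f hf X hX =>
      (loss_le_holderRate hβ hL hn hδ hr hf hX).trans (ENNReal.ofReal_le_ofReal ?_)
    have := holderRate_nonneg (β := β) hL (lt_min hr (Real.rpow_pos_of_pos hL (2 / β)))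
      (eps_pos hn hδ)
    linarith
  · exact quantile_bounds hL hn hδ Set.Subset.rfl fun f hf X hX =>
      loss_le_of_mem_holderClass hβ hL hn hδ hf hX
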